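/- Let $d\ge 3$, $R>0$, and let $\Phi:\mathbb{R}^d\to\mathbb{R}$ be an even function of class $C^4$, supported in the ball of radius $R$ centred at $0$, whose fourth derivative is Lipschitz. For $\eta\ge 2$ and $N\in\mathbb{N}$, let $\mathbb{T}=[-N^\eta,N^\eta]^d$ with periodic boundary conditions (differences of positions are understood in $\mathbb{T}$). Consider a tagged particle $(X_t,V_t)$ and $\mathcal{N}$ background particles $(x^i_t,v^i_t)_{1\le i\le\mathcal{N}}$ in $\mathbb{T}\times\mathbb{R}^d$ with $$\dot X_t=V_t,\quad \dot V_t=-\frac1N\sum_{i}\nabla\Phi(X_t-x^i_t),\qquad \dot x^i_t=v^i_t,\quad \dot v^i_t=\frac1N\nabla\Phi(X_t-x^i_t).$$ Let $\gamma(v)=(2\pi)^{-d/2}e^{-|v|^2/2}$, and let $g_0:\mathbb{R}^d\to[0,K]$ be measurable with $\int g_0\gamma=1$ (for instance $g_0=1$, $K=1$). The initial configuration is distributed according to the grand canonical probability measure $$\mathbb{P}[A]=\frac1{\mathcal Z}\sum_{M\ge0}\frac{N^M}{M!}\int_{\mathbb{T}\times\mathbb{R}^d}dX\,dV\int_{(\mathbb{T}\times\mathbb{R}^d)^M}\prod_{i=1}^M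 dx_i\,dv_i\; e^{-\frac1N\sum_{i=1}^M\Phi(X-x_i)}g_0(V)\gamma(V)\prod_{i=1}^M\gamma(v_i)\,\mathbf 1_A .$$ Let $\delta\in(0,1/4)$ and let $(M_N)_N$ be a sequence of nonnegative numbers. For constants $C_{int},C_{time},C_{drift}>0$, the good set $\mathcal{G}_N(\delta)$ is the set of initial configurations with $\mathcal{N}>1$ such that, for all $t\in[-2N,2N]$: 1. $|V_t|<N^{1/2}$ and $|v^i_t|<N^{1/2}$ for all $i$; 2. $\sum_i\mathbf 1_{|x^i_t-X_t|\le R}\le C_{int}N$; 3. $\bigl|N^{-1/2}\sum_i\partial_{I}\Phi(X_t-x^i_t)\bigr|^2\le N^\delta$ for all multi-indices $I\in\{1,\dots,d\}^n$, $1\le n\le4$, as well as $\bigl|N^{-1/2}\sum_i\nabla\Phi(X_t-x^i_t)\bigr|^2\le N^\delta$ and $\bigl\|N^{-1/2}\sum_i\mathrm{Hess}\,\Phi(X_t-x^i_t)\bigr\|^2\le N^\delta$ (operator norm); 4. for $k\in\{1,\dots,6\}$, $\sum_i\bigl(\tfrac1{|v^i_t-V_t|}\wedge N^{1/3}\bigr)^k\mathbf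 1_{|x^i_t-X_t|\le R}$ is at most $C_{time}N^{1+\delta}$ if $k\le3$ and at most $C_{time}N^{k/3+\delta}$ if $k>3$ (with $1/0=+\infty$); 5. $\bigl|\frac1N\sum_i\partial_{I}\Phi(X_t-x^i_t)\mathbf 1_{|v^i_t-V_t|\ge M_N}\bigr|\le C_{drift}N^{-(1-\delta)/2}$ for all multi-indices $I$ as in 3. Then there exist constants $C_{int},C_{time},C_{drift},C>0$, depending only on $d$, $R$ and $\Phi$, such that for all $\eta\ge2$ and $\delta\in(0,1/4)$ there is $N_0$ such that, for all $N\ge N_0$, all sequences $(M_N)_N$ and all $g_0,K$ as above, $$\mathbb{P}\bigl[\,\overline{\mathcal{G}_N(\delta)}\,\bigr]\le C\,K\,e^{-N^{\delta/4}},$$ where $\overline{\mathcal{G}_N(\delta)}$ is the complement of $\mathcal{G}_N(\delta)$. -/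

import Mathlib

open MeasureTheory
open scoped ENNReal

noncomputable section

namespace TaggedParticle

/-- The Euclidean space `ℝ^d`. -/
abbrev Space (d : ℕ) := EuclideanSpace ℝ (Fin d)

/-- Pairs (position, velocity). Positions on the torus are represented by points of `ℝ^d`. -/
abbrev Phase (d : ℕ) := Space d × Space d

/-- An initial configuration `(M, Z, z_{1:M})`: the number `M` of background particles, the
position and velocity `Z = (X, V)` of the tagged particle, and those of the `M` background
particles. -/
abbrev Config (d : ℕ) := Σ M : ℕ, Phase d × (Fin M → Phase d)

variable {d : ℕ}

/-- The fundamental domain `[-L, L)^d` of the torus `ℝ^d / (2L ℤ)^d`. -/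
def box (d : ℕ) (L : ℝ) : Set (Space d) := {x | ∀ i, x i ∈ Set.Ico (-L) L}

/-- The representative of `y` modulo `(2L ℤ)^d` that lies in `[-L, L)^d`. For two positions `x, y`
on the torus, `‖wrap L (x - y)‖` is their distance, and a function supported in a ball of radius
smaller than `L` is made `2L`-periodic by composing it with `wrap L`. -/
def wrap (L : ℝ) (y : Space d) : Space d :=
  WithLp.toLp 2 fun i => y i - 2 * L * (round (y i / (2 * L)) : ℝ)

/-- The density of the standard normal distribution on `ℝ^d`. -/
def gaussianDensity (v : Space d) : ℝ :=
  (2 * Real.pi) ^ (-(d : ℝ) / 2) * Real.exp (-‖v‖ ^ 2 / 2)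

/-! ### The grand canonical measure -/

/-- The measure `dx dv` on the one-particle phase space `𝕋 × ℝ^d`. -/
def phaseMeasure (d : ℕ) (L : ℝ) : Measure (Phase d) :=
  ((volume : Measure (Space d)).restrict (box d L)).prod (volume : Measure (Space d))

/-- The weight `exp (-(1/N) ∑ Φ (X - x_i)) g₀(V) γ(V) ∏ γ(v_i)`. -/
def gcWeight (N : ℕ) (L : ℝ) (Φ g₀ : Space d → ℝ) (M : ℕ)
    (p : Phase d × (Fin M → Phase d)) : ℝ :=
  Real.exp (-(1 / (N : ℝ)) * ∑ i, Φ (wrap L (p.1.1 - (p.2 i).1))) *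
    (g₀ p.1.2 * gaussianDensity p.1.2) * ∏ i, gaussianDensity (p.2 i).2

/-- The unnormalized grand canonical measure
`∑_M (N^M / M!) ∫ dZ ∫ dz_{1:M} ρ_{M, g₀}(Z, z_{1:M})`. -/
def gcMass (N : ℕ) (L : ℝ) (Φ g₀ : Space d → ℝ) : Measure (Config d) :=
  Measure.sum fun M : ℕ =>
    ENNReal.ofReal ((N : ℝ) ^ M / (Nat.factorial M : ℝ)) •
      ((((phaseMeasure d L).prod (Measure.pi fun _ : Fin M => phaseMeasure d L)).withDensity
        fun p => ENNReal.ofReal (gcWeight N L Φ g₀ M p)).map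
          (fun p => (⟨M, p⟩ : Config d)))

/-- The grand canonical probability measure. -/
def gcMeasure (N : ℕ) (L : ℝ) (Φ g₀ : Space d → ℝ) : Measure (Config d) :=
  (gcMass N L Φ g₀ Set.univ)⁻¹ • gcMass N L Φ g₀

/-! ### The dynamics -/

/-- The Hamiltonian dynamics of the tagged particle `(X, V)` and of the `M` background particles
`(x^i, v^i)` on the torus (trajectories are lifted to `ℝ^d`), started from the configuration `c`.
-/
structure IsTrajectory (N : ℕ) (L : ℝ) (Φ : Space d → ℝ) (c : Config d)
    (X V : ℝ → Space d) (x v : Fin c.1 → ℝ → Space d) : Prop where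
  tagged_init : X 0 = c.2.1.1 ∧ V 0 = c.2.1.2
  back_init : ∀ i, x i 0 = (c.2.2 i).1 ∧ v i 0 = (c.2.2 i).2
  tagged_pos : ∀ t, HasDerivAt X (V t) t
  tagged_vel : ∀ t,
    HasDerivAt V (-((1 / (N : ℝ)) • ∑ i, gradient Φ (wrap L (X t - x i t)))) t
  back_pos : ∀ i t, HasDerivAt (x i) (v i t) t
  back_vel : ∀ i t, HasDerivAt (v i) ((1 / (N : ℝ)) • gradient Φ (wrap L (X t - x i t))) t

/-! ### The good set -/

/-- The partial derivative `∂_I Φ` for a multi-index `I ∈ {1, …, d}^n`. -/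
def partialDeriv (Φ : Space d → ℝ) {n : ℕ} (I : Fin n → Fin d) (y : Space d) : ℝ :=
  iteratedFDeriv ℝ n Φ y fun j => EuclideanSpace.single (I j) (1 : ℝ)

/-- The interaction time `T_m(v, V) = 1 / |v - V|`, equal to `∞` if `v = V`. -/
def interTime (v V : Space d) : ℝ≥0∞ := (ENNReal.ofReal ‖v - V‖)⁻¹

/-- The truncated interaction time `T_m(v, V) ∧ N^{1/3}`. -/
def cutInterTime (N : ℕ) (v V : Space d) : ℝ :=
  (min (interTime v V) (ENNReal.ofReal ((N : ℝ) ^ (1 / 3 : ℝ)))).toReal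

/-- The controls defining the good set, for the positions and velocities `X, V, x, v` of the
particles at one given time. -/
structure Controls (N : ℕ) (L R : ℝ) (Φ : Space d → ℝ) (δ m Cint Ctime Cdrift : ℝ)
    {M : ℕ} (X V : Space d) (x v : Fin M → Space d) : Prop where
  velocity : ‖V‖ < (N : ℝ) ^ (1 / 2 : ℝ) ∧ ∀ i, ‖v i‖ < (N : ℝ) ^ (1 / 2 : ℝ)
  interacting : (∑ i, if ‖wrap L (x i - X)‖ ≤ R then (1 : ℝ) else 0) ≤ Cint * N
  deriv_bound : ∀ n : ℕ, 1 ≤ n → n ≤ 4 → ∀ I : Fin n → Fin d,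
    |1 / Real.sqrt N * ∑ i, partialDeriv Φ I (wrap L (X - x i))| ^ 2 ≤ (N : ℝ) ^ δ
  grad_bound :
    ‖(1 / Real.sqrt N) • ∑ i, gradient Φ (wrap L (X - x i))‖ ^ 2 ≤ (N : ℝ) ^ δ
  hess_bound :
    ‖(1 / Real.sqrt N) • ∑ i, fderiv ℝ (gradient Φ) (wrap L (X - x i))‖ ^ 2 ≤ (N : ℝ) ^ δ
  time_moments : ∀ k : ℕ, 1 ≤ k → k ≤ 6 →
    (∑ i, if ‖wrap L (x i - X)‖ ≤ R then cutInterTime N (v i) V ^ k else 0) ≤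
      if k ≤ 3 then Ctime * (N : ℝ) ^ (1 + δ) else Ctime * (N : ℝ) ^ ((k : ℝ) / 3 + δ)
  fast_drift : ∀ n : ℕ, 1 ≤ n → n ≤ 4 → ∀ I : Fin n → Fin d,
    |1 / (N : ℝ) * ∑ i, if m ≤ ‖v i - V‖ then partialDeriv Φ I (wrap L (X - x i)) else 0| ≤
      Cdrift * (1 / (N : ℝ) ^ ((1 - δ) / 2))

/-- The good set: the initial configurations with more than one background particle whose
trajectory satisfies the controls at all times `t ∈ [-2N, 2N]`. (If `R < L` and `∇Φ` is Lipschitz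
with `Φ` supported in the ball of radius `R`, each configuration has exactly one trajectory.) -/
def goodSet (N : ℕ) (L R : ℝ) (Φ : Space d → ℝ) (δ m Cint Ctime Cdrift : ℝ) :
    Set (Config d) :=
  {c | 1 < c.1 ∧ ∃ (X V : ℝ → Space d) (x v : Fin c.1 → ℝ → Space d),
    IsTrajectory N L Φ c X V x v ∧
    ∀ t ∈ Set.Icc (-(2 * (N : ℝ))) (2 * N),
      Controls N L R Φ δ m Cint Ctime Cdrift (X t) (V t) (fun i => x i t) (fun i => v i t)}

end TaggedParticle

end

/-!
# Stretched exponential bounds on the bad set of a tagged particle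

It suffices to treat `g₀ = 1`, for which the grand canonical measure is the equilibrium measure:
since `0 ≤ g₀ ≤ K` and `∫ g₀ γ = 1 = ∫ γ`, both choices have the same partition function, and the
probability of an event for `g₀` is at most `K` times its equilibrium probability (`gcMeasure_le`).

*Invariance.* The equilibrium measure is invariant under the dynamics. Only an inequality is needed
(`gcMass_le_of_flow`): if each configuration of `A` is sent at time `t` into an open, `2L`-periodic
set `B`, then `A` has at most the mass of `B`. Instead of Liouville's theorem for a flow, the flow
is written as a limit of iterated shears (the symplectic Euler scheme, `tendsto_iterate_eulerStep`),
each of which preserves Lebesgue measure on the torus; Fatou's lemma passes to the limit, and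
conservation of energy takes care of the density (`withDensity_le_of_flow`).

*Chernoff's bound.* Given the tagged particle, the background is a Poisson process, so that
exponential moments of sums over the background particles are explicit and a control
`h V + ∑ ψ (X, V) (x_i, v_i) ≤ a` fails with probability at most
`∫ e^h γ · exp (-a + N ∫ (e^ψ - 1) e^{-Φ / N} γ)` (`gcMass_le_exp`). Such controls are called tests.
The sums of derivatives of the force are of order `√N` thanks to `∫ ∂_I Φ = 0`
(`lintegral_exp_signed_le`), and `∫ (1 / |v - V| ∧ N^{1/3})^3 γ` is only logarithmic in `N` as
`d ≥ 3` (`lintegral_cubedTime_le`); the latter integral governs all the time moments `k ≤ 6`.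

*Interpolation.* The tests are Lipschitz with constants polynomial in `N`, hence passing them on a
time grid with polynomially small step gives the controls at all times
(`StaticControls.controls_trajectory`). The sharp cutoff `|v - V| ≥ m` is not Lipschitz: it is
replaced by a ramp of width `N^{-q}`, and one more test bounds the number of particles in the shell
where the two differ. Finally a union bound over polynomially many times and finitely many tests
costs only a polynomial factor `N^k`, absorbed by `N^k exp (-2 N^{δ/4}) ≤ exp (-N^{δ/4})` for
large `N`.
-/

noncomputable section

namespace TaggedParticle

variable {d : ℕ}

/-! ### Periodization -/

theorem wrap_apply (L : ℝ) (y : Space d) (i : Fin d) :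
    wrap L y i = y i - 2 * L * (round (y i / (2 * L)) : ℝ) := rfl

theorem wrap_eq_of_lattice {L : ℝ} (hL : 0 < L) {x y : Space d} (k : Fin d → ℤ)
    (h : ∀ i, x i = y i + 2 * L * k i) : wrap L x = wrap L y := by
  ext i
  have h1 : x i / (2 * L) = y i / (2 * L) + k i := by rw [h i]; field_simp
  rw [wrap_apply, wrap_apply, h1, round_add_intCast, h i]
  push_cast
  ring

theorem exists_wrap_apply_eq (L : ℝ) (y : Space d) :
    ∃ k : Fin d → ℤ, ∀ i, wrap L y i = y i + 2 * L * k i :=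
  ⟨fun i => -round (y i / (2 * L)), fun i => by rw [wrap_apply]; push_cast; ring⟩

theorem wrap_wrap_sub_wrap {L : ℝ} (hL : 0 < L) (x y : Space d) :
    wrap L (wrap L x - wrap L y) = wrap L (x - y) := by
  obtain ⟨k, hk⟩ := exists_wrap_apply_eq L x
  obtain ⟨l, hl⟩ := exists_wrap_apply_eq L y
  refine wrap_eq_of_lattice hL (fun i => k i - l i) fun i => ?_
  simp only [PiLp.sub_apply, hk, hl]
  push_cast
  ring

theorem wrap_wrap_add {L : ℝ} (hL : 0 < L) (x y : Space d) :
    wrap L (wrap L x + y) = wrap L (x + y) := by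
  obtain ⟨k, hk⟩ := exists_wrap_apply_eq L x
  refine wrap_eq_of_lattice hL k fun i => ?_
  simp only [PiLp.add_apply, hk]
  ring

theorem wrap_mem_box {L : ℝ} (hL : 0 < L) (y : Space d) : wrap L y ∈ box d L := by
  intro i
  rw [wrap_apply]
  have h1 : y i = (y i / (2 * L)) * (2 * L) := by field_simp
  have h2 : round (y i / (2 * L)) = ⌊y i / (2 * L) + 1 / 2⌋ := round_eq _
  have h3 := Int.floor_le (y i / (2 * L) + 1 / 2)
  have h4 := Int.lt_floor_add_one (y i / (2 * L) + 1 / 2)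
  rw [h2]
  generalize y i / (2 * L) = s at *
  rw [h1]
  constructor <;> nlinarith

theorem wrap_eq_self {L : ℝ} (hL : 0 < L) {y : Space d} (hy : y ∈ box d L) : wrap L y = y := by
  ext i
  have h2 : round (y i / (2 * L)) = 0 := by
    rw [round_eq, Int.floor_eq_zero_iff]
    obtain ⟨h3, h4⟩ := hy i
    constructor
    · have : -(1 / 2 : ℝ) ≤ y i / (2 * L) := by rw [le_div_iff₀ (by positivity)]; linarith
      linarith
    · have : y i / (2 * L) < 1 / 2 := by rw [div_lt_iff₀ (by positivity)]; linarith
      linarith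
  simp [wrap_apply, h2]

theorem wrap_wrap {L : ℝ} (hL : 0 < L) (y : Space d) : wrap L (wrap L y) = wrap L y :=
  wrap_eq_self hL (wrap_mem_box hL y)

theorem mem_box_of_norm_lt {L : ℝ} {y : Space d} (hy : ‖y‖ < L) : y ∈ box d L := by
  intro i
  have := (PiLp.norm_apply_le y i).trans_lt hy
  rw [Real.norm_eq_abs, abs_lt] at this
  exact ⟨this.1.le, this.2⟩

theorem measurable_wrap (L : ℝ) : Measurable (wrap (d := d) L) := by
  unfold wrap
  refine (PiLp.continuous_toLp 2 _).measurable.comp (measurable_pi_lambda _ fun i => ?_)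
  have h : Measurable (fun y : Space d => y i) := by fun_prop
  have h1 : Measurable (fun s : ℝ => (round s : ℝ)) := by
    have : (fun s : ℝ => (round s : ℝ)) = fun s => ((⌊s + 1 / 2⌋ : ℤ) : ℝ) := by
      ext s; rw [round_eq]
    rw [this]; fun_prop
  exact h.sub ((h1.comp (h.div_const (2 * L))).const_mul (2 * L))

theorem measurableSet_box (d : ℕ) (L : ℝ) : MeasurableSet (box d L) := by
  have : box d L = ⋂ i, (fun y : Space d => y i) ⁻¹' Set.Ico (-L) L := by
    ext; simp [box]
  rw [this]
  exact MeasurableSet.iInter fun i => (by fun_prop : Measurable fun y : Space d => y i) measurableSet_Ico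

/-- The wrapped representative has the least norm in its class. -/
theorem norm_wrap_le {L : ℝ} (hL : 0 < L) {x y : Space d} (k : Fin d → ℤ)
    (h : ∀ i, x i = y i + 2 * L * k i) : ‖wrap L x‖ ≤ ‖y‖ := by
  rw [wrap_eq_of_lattice hL k h, EuclideanSpace.norm_eq, EuclideanSpace.norm_eq]
  apply Real.sqrt_le_sqrt
  refine Finset.sum_le_sum fun i _ => pow_le_pow_left₀ (norm_nonneg _) ?_ 2
  rw [wrap_apply, Real.norm_eq_abs, Real.norm_eq_abs]
  have h1 : y i = (y i / (2 * L)) * (2 * L) := by field_simp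
  have h2 := round_le (y i / (2 * L)) 0
  generalize y i / (2 * L) = s at *
  rw [h1, show s * (2 * L) - 2 * L * (round s : ℝ) = (s - round s) * (2 * L) by ring,
    abs_mul (s - _), abs_mul s]
  exact mul_le_mul_of_nonneg_right (by simpa using h2) (abs_nonneg _)

theorem norm_wrap_le_add {L : ℝ} (hL : 0 < L) (x y : Space d) :
    ‖wrap L y‖ ≤ ‖wrap L x‖ + ‖y - x‖ := by
  obtain ⟨k, hk⟩ := exists_wrap_apply_eq L x
  refine le_trans (norm_wrap_le hL (y := wrap L x + (y - x)) (fun i => - k i) fun i => ?_)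
    (norm_add_le _ _)
  simp only [PiLp.add_apply, PiLp.sub_apply, hk]
  push_cast
  ring

theorem lipschitzWith_norm_wrap {L : ℝ} (hL : 0 < L) :
    LipschitzWith 1 fun y : Space d => ‖wrap L y‖ := by
  refine LipschitzWith.of_le_add fun x y => ?_
  rw [dist_eq_norm]
  exact norm_wrap_le_add hL y x

theorem continuous_norm_wrap {L : ℝ} (hL : 0 < L) : Continuous fun y : Space d => ‖wrap L y‖ :=
  (lipschitzWith_norm_wrap hL).continuous

theorem norm_wrap_neg {L : ℝ} (hL : 0 < L) (y : Space d) : ‖wrap L (-y)‖ = ‖wrap L y‖ := by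
  have key : ∀ y : Space d, ‖wrap L (-y)‖ ≤ ‖wrap L y‖ := fun y => by
    obtain ⟨k, hk⟩ := exists_wrap_apply_eq L y
    rw [← norm_neg (wrap L y)]
    refine norm_wrap_le hL k fun i => ?_
    simp only [PiLp.neg_apply, hk]
    ring
  refine le_antisymm (key y) ?_
  simpa using key (-y)

theorem norm_wrap_sub_comm {L : ℝ} (hL : 0 < L) (x y : Space d) :
    ‖wrap L (x - y)‖ = ‖wrap L (y - x)‖ := by
  rw [← norm_wrap_neg hL, neg_sub]

theorem wrap_add_eq {L : ℝ} (hL : 0 < L) {y e : Space d} (h : ‖wrap L y + e‖ < L) :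
    wrap L (y + e) = wrap L y + e := by
  rw [← wrap_wrap_add hL, wrap_eq_self hL (mem_box_of_norm_lt h)]

/-- The periodization of a bounded Lipschitz function supported well inside the box is Lipschitz. -/
theorem norm_comp_wrap_sub_le {F : Type*} [NormedAddCommGroup F] {f : Space d → F} {L R K B : ℝ}
    (hR : 0 ≤ R) (hL : R + 1 ≤ L) (hK : 0 ≤ K) (hf : ∀ x y, ‖f x - f y‖ ≤ K * ‖x - y‖)
    (hB : ∀ x, ‖f x‖ ≤ B) (hs : ∀ x, R < ‖x‖ → f x = 0) (x y : Space d) :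
    ‖f (wrap L x) - f (wrap L y)‖ ≤ (K + 2 * B) * ‖x - y‖ := by
  have hL0 : 0 < L := by linarith
  have hB0 : 0 ≤ B := (norm_nonneg _).trans (hB 0)
  rcases le_or_gt 1 ‖x - y‖ with h1 | h1
  · have h2 : ‖f (wrap L x) - f (wrap L y)‖ ≤ B + B :=
      (norm_sub_le _ _).trans (add_le_add (hB _) (hB _))
    nlinarith [mul_nonneg hK (norm_nonneg (x - y))]
  · have key : ∀ x y : Space d, ‖x - y‖ < 1 → ‖wrap L x‖ ≤ R →
        ‖f (wrap L x) - f (wrap L y)‖ ≤ (K + 2 * B) * ‖x - y‖ := fun x y h1 h2 => by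
      have h3 : wrap L y = wrap L x + (y - x) := by
        have := wrap_add_eq hL0 (y := x) (e := y - x) (by
          refine (norm_add_le _ _).trans_lt ?_
          rw [norm_sub_rev]; linarith)
        rw [← this]; congr 1; abel
      rw [h3]
      refine (hf _ _).trans ?_
      rw [show wrap L x - (wrap L x + (y - x)) = x - y by abel]
      gcongr
      linarith
    rcases le_or_gt ‖wrap L x‖ R with h2 | h2
    · exact key x y h1 h2
    rcases le_or_gt ‖wrap L y‖ R with h3 | h3
    · rw [norm_sub_rev, norm_sub_rev x y]
      rw [norm_sub_rev] at h1
      exact key y x h1 h3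
    · rw [hs _ h2, hs _ h3]
      simp only [sub_zero, norm_zero]
      positivity

theorem continuous_comp_wrap {F : Type*} [NormedAddCommGroup F] {f : Space d → F} {L R K B : ℝ}
    (hR : 0 ≤ R) (hL : R + 1 ≤ L) (hK : 0 ≤ K) (hf : ∀ x y, ‖f x - f y‖ ≤ K * ‖x - y‖)
    (hB : ∀ x, ‖f x‖ ≤ B) (hs : ∀ x, R < ‖x‖ → f x = 0) :
    Continuous fun y => f (wrap L y) := by
  have hB0 : 0 ≤ B := (norm_nonneg _).trans (hB 0)
  have : LipschitzWith (Real.toNNReal (K + 2 * B)) fun y => f (wrap L y) := by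
    refine LipschitzWith.of_dist_le_mul fun x y => ?_
    rw [dist_eq_norm, dist_eq_norm, Real.coe_toNNReal _ (by positivity)]
    exact norm_comp_wrap_sub_le hR hL hK hf hB hs x y
  exact this.continuous

theorem hasFDerivAt_comp_wrap {Φ : Space d → ℝ} {L R : ℝ} (hR : 0 ≤ R) (hL : R + 1 ≤ L)
    (hΦ : Differentiable ℝ Φ) (hs : tsupport Φ ⊆ Metric.closedBall 0 R) (y : Space d) :
    HasFDerivAt (fun y => Φ (wrap L y)) (fderiv ℝ Φ (wrap L y)) y := by
  have hL0 : 0 < L := by linarith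
  have hz : ∀ x : Space d, R < ‖x‖ → Φ x = 0 := fun x hx => by
    by_contra h
    have := hs (subset_tsupport _ h)
    simp at this; linarith
  rcases lt_or_ge ‖wrap L y‖ L with h | h
  · -- near an interior point of the box, `wrap L` is a translation
    have h1 : (fun y => Φ (wrap L y)) =ᶠ[nhds y] fun x => Φ (x + (wrap L y - y)) := by
      filter_upwards [Metric.ball_mem_nhds y (sub_pos.2 h)] with x hx
      have := wrap_add_eq hL0 (y := y) (e := x - y) (by
          refine (norm_add_le _ _).trans_lt ?_
          rw [Metric.mem_ball, dist_eq_norm] at hx; linarith)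
      rw [add_sub_cancel] at this
      rw [this]; congr 1; abel
    refine HasFDerivAt.congr_of_eventuallyEq ?_ h1
    have h2 : wrap L y = y + (wrap L y - y) := by abel
    have h3 := (hΦ (y + (wrap L y - y))).hasFDerivAt.comp y
      ((hasFDerivAt_id y).add_const (wrap L y - y))
    rw [← h2] at h3
    exact h3
  · have h1 : (fun y => Φ (wrap L y)) =ᶠ[nhds y] fun _ => 0 := by
      filter_upwards [Metric.ball_mem_nhds y one_pos] with x hx
      apply hz
      have := norm_wrap_le_add hL0 x y
      rw [Metric.mem_ball, dist_eq_norm, norm_sub_rev] at hx; linarith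
    have h2 : fderiv ℝ Φ (wrap L y) = 0 := by
      apply fderiv_of_notMem_tsupport
      intro h3
      have := hs h3
      simp at this; linarith
    rw [h2]
    exact (hasFDerivAt_const (0 : ℝ) y).congr_of_eventuallyEq h1

/-! ### Translations and reflections of the torus preserve Lebesgue measure -/

/-- The one-dimensional representative modulo `2L`. -/
def wrapReal (L t : ℝ) : ℝ := t - 2 * L * (round (t / (2 * L)) : ℝ)

theorem wrapReal_mem {L : ℝ} (hL : 0 < L) (t : ℝ) : wrapReal L t ∈ Set.Ico (-L) L := by
  have := wrap_mem_box (d := 1) hL (WithLp.toLp 2 fun _ => t) 0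
  simpa [wrap_apply, wrapReal] using this

theorem wrapReal_eq_self {L : ℝ} (hL : 0 < L) {t : ℝ} (ht : t ∈ Set.Ico (-L) L) :
    wrapReal L t = t := by
  have := wrap_eq_self (d := 1) hL (y := WithLp.toLp 2 fun _ => t) (fun _ => ht)
  have := congrArg (fun z : Space 1 => z 0) this
  simpa [wrap_apply, wrapReal] using this

/-- The representative in `[-L, L)` of a point of the circle of length `2L`. -/
def circleRep (L : ℝ) (hL : 0 < L) (q : AddCircle (2 * L)) : ℝ :=
  haveI : Fact (0 < 2 * L) := ⟨by positivity⟩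
  (AddCircle.measurableEquivIco (2 * L) (-L) q : ℝ)

theorem circleRep_coe {L : ℝ} (hL : 0 < L) (t : ℝ) :
    circleRep L hL (t : AddCircle (2 * L)) = wrapReal L t := by
  have : Fact (0 < 2 * L) := ⟨by positivity⟩
  change toIcoMod (_ : 0 < 2 * L) (-L) t = _
  rw [toIcoMod_eq_iff]
  refine ⟨?_, round (t / (2 * L)), ?_⟩
  · have := wrapReal_mem hL t
    rwa [show -L + 2 * L = L by ring]
  · simp [wrapReal]; ring

theorem measurable_circleRep {L : ℝ} (hL : 0 < L) : Measurable (circleRep L hL) := by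
  have : Fact (0 < 2 * L) := ⟨by positivity⟩
  exact measurable_subtype_coe.comp (AddCircle.measurableEquivIco (2 * L) (-L)).measurable

theorem measurePreserving_coe_Ico {L : ℝ} (hL : 0 < L) :
    have : Fact (0 < 2 * L) := ⟨by positivity⟩
    MeasurePreserving ((↑) : ℝ → AddCircle (2 * L)) (volume.restrict (Set.Ico (-L) L)) volume := by
  have : Fact (0 < 2 * L) := ⟨by positivity⟩
  have h := AddCircle.measurePreserving_mk (2 * L) (-L)
  rw [show -L + 2 * L = L by ring, ← restrict_Ico_eq_restrict_Ioc] at h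
  exact h

theorem measurePreserving_circleRep {L : ℝ} (hL : 0 < L) :
    have : Fact (0 < 2 * L) := ⟨by positivity⟩
    MeasurePreserving (circleRep L hL) volume (volume.restrict (Set.Ico (-L) L)) := by
  have : Fact (0 < 2 * L) := ⟨by positivity⟩
  refine ⟨measurable_circleRep hL, ?_⟩
  rw [← (measurePreserving_coe_Ico hL).map_eq, Measure.map_map (measurable_circleRep hL)
    (measurePreserving_coe_Ico hL).measurable]
  conv_rhs => rw [← Measure.map_id (μ := volume.restrict (Set.Ico (-L) L))]
  refine Measure.map_congr ?_
  filter_upwards [ae_restrict_mem measurableSet_Ico] with t ht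
  simp only [Function.comp, circleRep_coe, id]
  exact wrapReal_eq_self hL ht

theorem measurePreserving_wrapReal_add {L : ℝ} (hL : 0 < L) (a : ℝ) :
    MeasurePreserving (fun t => wrapReal L (t + a)) (volume.restrict (Set.Ico (-L) L))
      (volume.restrict (Set.Ico (-L) L)) := by
  have : Fact (0 < 2 * L) := ⟨by positivity⟩
  have h := (measurePreserving_circleRep hL).comp ((measurePreserving_add_right volume
    (a : AddCircle (2 * L))).comp (measurePreserving_coe_Ico hL))
  convert h using 1
  ext t
  simp only [Function.comp]
  rw [← AddCircle.coe_add, circleRep_coe]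

theorem measurePreserving_wrapReal_sub {L : ℝ} (hL : 0 < L) (a : ℝ) :
    MeasurePreserving (fun t => wrapReal L (a - t)) (volume.restrict (Set.Ico (-L) L))
      (volume.restrict (Set.Ico (-L) L)) := by
  have : Fact (0 < 2 * L) := ⟨by positivity⟩
  have h := (measurePreserving_circleRep hL).comp ((measurePreserving_add_right volume
    (a : AddCircle (2 * L))).comp ((Measure.measurePreserving_neg
      (volume : Measure (AddCircle (2 * L)))).comp (measurePreserving_coe_Ico hL)))
  convert h using 1
  ext t
  simp only [Function.comp]
  rw [← AddCircle.coe_neg, ← AddCircle.coe_add, circleRep_coe, neg_add_eq_sub]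

theorem measurePreserving_box_of_coord {L : ℝ} (f : Fin d → ℝ → ℝ)
    (hf : ∀ i, MeasurePreserving (f i) (volume.restrict (Set.Ico (-L) L))
      (volume.restrict (Set.Ico (-L) L))) :
    MeasurePreserving (fun x : Space d => (WithLp.toLp 2 fun i => f i (x i) : Space d))
      (volume.restrict (box d L)) (volume.restrict (box d L)) := by
  have hb : box d L = WithLp.ofLp ⁻¹' (Set.univ.pi fun _ : Fin d => Set.Ico (-L) L) := by
    ext x; simp [box, Set.mem_pi]
  have hbm : MeasurableSet (Set.univ.pi fun _ : Fin d => Set.Ico (-L) L) :=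
    MeasurableSet.univ_pi fun _ => measurableSet_Ico
  have h1 : MeasurePreserving (WithLp.ofLp : Space d → Fin d → ℝ) (volume.restrict (box d L))
      (Measure.pi fun _ => volume.restrict (Set.Ico (-L) L)) := by
    rw [← Measure.restrict_pi_pi, hb]
    exact (PiLp.volume_preserving_ofLp (Fin d)).restrict_preimage hbm
  have h2 : MeasurePreserving (WithLp.toLp 2 : (Fin d → ℝ) → Space d)
      (Measure.pi fun _ => volume.restrict (Set.Ico (-L) L)) (volume.restrict (box d L)) := by
    rw [← Measure.restrict_pi_pi]
    have := (PiLp.volume_preserving_toLp (Fin d)).restrict_preimage (measurableSet_box d L)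
    rw [hb] at this ⊢
    exact this
  exact h2.comp ((measurePreserving_pi _ _ hf).comp h1)

theorem measurePreserving_wrap_add {L : ℝ} (hL : 0 < L) (a : Space d) :
    MeasurePreserving (fun x : Space d => wrap L (x + a)) (volume.restrict (box d L))
      (volume.restrict (box d L)) :=
  measurePreserving_box_of_coord (fun i t => wrapReal L (t + a i))
    fun i => measurePreserving_wrapReal_add hL (a i)

theorem measurePreserving_wrap_sub {L : ℝ} (hL : 0 < L) (a : Space d) :
    MeasurePreserving (fun x : Space d => wrap L (a - x)) (volume.restrict (box d L))
      (volume.restrict (box d L)) :=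
  measurePreserving_box_of_coord (fun i t => wrapReal L (a i - t))
    fun i => measurePreserving_wrapReal_sub hL (a i)

/-! ### Second order equations: global solutions and the symplectic Euler scheme -/

section ODE

open Filter Topology

variable {Q : Type*} [NormedAddCommGroup Q]

theorem lipschitzWith_phaseField {f : Q → Q} {K : NNReal} (hf : LipschitzWith K f) :
    LipschitzWith (max 1 K) fun p : Q × Q => (p.2, f p.1) := by
  have h1 : LipschitzWith 1 fun p : Q × Q => p.2 := LipschitzWith.prod_snd
  have h2 : LipschitzWith K fun p : Q × Q => f p.1 := by
    have := hf.comp (LipschitzWith.prod_fst (α := Q) (β := Q))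
    rwa [mul_one] at this
  exact h1.prodMk h2

variable [NormedSpace ℝ Q]

theorem exists_solution_Ioo [CompleteSpace Q] {f : Q → Q} {K : NNReal} (hf : LipschitzWith K f)
    {B : ℝ} (hB : ∀ x, ‖f x‖ ≤ B) (x₀ v₀ : Q) {T : ℝ} (hT : 0 < T) :
    ∃ u : ℝ → Q × Q, u 0 = (x₀, v₀) ∧
      ∀ t ∈ Set.Ioo (-T) T, HasDerivAt u ((u t).2, f (u t).1) t := by
  have hB0 : 0 ≤ B := (norm_nonneg _).trans (hB 0)
  -- Rescaling the velocity by `l = 1 / (2 T)` makes the field small enough on a large ball for the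
  -- Picard-Lindelöf theorem to reach the time `T`.
  set l : ℝ := 1 / (2 * T) with hl
  have hl0 : 0 < l := by positivity
  set w₀ : Q := l⁻¹ • v₀
  set a : ℝ := ‖w₀‖ + 4 * T ^ 2 * B + 1
  have ha : 0 ≤ a := by positivity
  set F : Q × Q → Q × Q := fun p => (l • p.2, l⁻¹ • f p.1)
  have hF : LipschitzWith (max (‖l‖₊ * 1) (‖l⁻¹‖₊ * (K * 1))) F := by
    have h1 := (lipschitzWith_smul l).comp (LipschitzWith.prod_snd (α := Q) (β := Q))
    have h2 := (lipschitzWith_smul l⁻¹).comp (hf.comp (LipschitzWith.prod_fst (α := Q) (β := Q)))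
    exact h1.prodMk h2
  have h0 : (0 : ℝ) ∈ Set.Icc (-T) T := ⟨by linarith, hT.le⟩
  have hb : ∀ p ∈ Metric.closedBall (x₀, w₀) a, ‖F p‖ ≤ a / T := by
    intro p hp
    have h1 : ‖p.2 - w₀‖ ≤ a := by
      rw [Metric.mem_closedBall, dist_eq_norm] at hp
      exact (norm_snd_le (p - (x₀, w₀))).trans hp
    have h2 : ‖p.2‖ ≤ ‖w₀‖ + a := by
      have := norm_add_le w₀ (p.2 - w₀)
      rw [add_sub_cancel] at this; linarith
    refine max_le ?_ ?_
    · simp only [F, norm_smul, Real.norm_eq_abs, abs_of_pos hl0]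
      rw [hl, div_mul_eq_mul_div, div_le_div_iff₀ (by positivity) hT]
      have : ‖w₀‖ ≤ a := by
        have : 0 ≤ 4 * T ^ 2 * B := by positivity
        simp only [a]; linarith
      nlinarith
    · simp only [F, norm_smul, Real.norm_eq_abs, abs_of_pos (inv_pos.2 hl0)]
      rw [hl, one_div, inv_inv, le_div_iff₀ hT]
      have h3 := hB p.1
      have h4 : 2 * T * ‖f p.1‖ * T ≤ 4 * T ^ 2 * B := by nlinarith [sq_nonneg T]
      simp only [a]
      linarith [norm_nonneg w₀]
  have hPL : IsPicardLindelof (fun _ : ℝ => F) (⟨0, h0⟩ : Set.Icc (-T) T) (x₀, w₀)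
      ⟨a, ha⟩ 0 ⟨a / T, by positivity⟩ (max (‖l‖₊ * 1) (‖l⁻¹‖₊ * (K * 1))) := by
    refine ⟨fun t _ => hF.lipschitzOnWith, fun x _ => continuousOn_const, fun t _ x hx => hb x hx, ?_⟩
    simp only [sub_zero, zero_sub, neg_neg, max_self, NNReal.coe_zero]
    exact (div_mul_cancel₀ a hT.ne').le
  obtain ⟨α, hα0, hα⟩ := hPL.exists_eq_forall_mem_Icc_hasDerivWithinAt₀
  refine ⟨fun t => ((α t).1, l • (α t).2), ?_, fun t ht => ?_⟩
  · simp only [hα0, w₀, smul_smul, mul_inv_cancel₀ hl0.ne', one_smul]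
  · have h := (hα t (Set.Ioo_subset_Icc_self ht)).hasDerivAt (Icc_mem_nhds ht.1 ht.2)
    have h1 := (ContinuousLinearMap.fst ℝ Q Q).hasFDerivAt.comp_hasDerivAt t h
    have h2 := ((ContinuousLinearMap.snd ℝ Q Q).hasFDerivAt.comp_hasDerivAt t h).const_smul l
    have := h1.prodMk h2
    simp only [F, ContinuousLinearMap.coe_fst', ContinuousLinearMap.coe_snd', smul_smul,
      mul_inv_cancel₀ hl0.ne', one_smul] at this
    exact this

/-- A second order equation with a bounded Lipschitz force has a solution for all times. -/
theorem exists_solution [CompleteSpace Q] {f : Q → Q} {K : NNReal} (hf : LipschitzWith K f)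
    {B : ℝ} (hB : ∀ x, ‖f x‖ ≤ B) (x₀ v₀ : Q) :
    ∃ u : ℝ → Q × Q, u 0 = (x₀, v₀) ∧ ∀ t, HasDerivAt u ((u t).2, f (u t).1) t := by
  have hT : ∀ T : ℝ, 0 < |T| + 1 := fun T => by positivity
  choose γ h0 hγ using fun T : ℝ => exists_solution_Ioo hf hB x₀ v₀ (hT T)
  have key : ∀ s t : ℝ, |t| < |s| + 1 → γ s t = γ t t := by
    intro s t hst
    have ht : |t| < |t| + 1 := by linarith
    set m := min (|s| + 1) (|t| + 1) with hm
    have hm0 : 0 < m := lt_min (hT s) (hT t)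
    have htm : |t| < m := lt_min hst ht
    refine ODE_solution_unique_of_mem_Ioo (v := fun _ p => (p.2, f p.1)) (s := fun _ => Set.univ)
      (K := max 1 K) (a := -m) (b := m) (t₀ := 0)
      (fun _ _ => (lipschitzWith_phaseField hf).lipschitzOnWith) ⟨by linarith, hm0⟩
      (fun r hr => ⟨hγ s r ⟨?_, ?_⟩, trivial⟩) (fun r hr => ⟨hγ t r ⟨?_, ?_⟩, trivial⟩)
      (by rw [h0, h0]) (abs_lt.1 htm)
    · linarith [hr.1, min_le_left (|s| + 1) (|t| + 1)]
    · linarith [hr.2, min_le_left (|s| + 1) (|t| + 1)]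
    · linarith [hr.1, min_le_right (|s| + 1) (|t| + 1)]
    · linarith [hr.2, min_le_right (|s| + 1) (|t| + 1)]
  refine ⟨fun t => γ t t, h0 0, fun t => ?_⟩
  refine (hγ t t (abs_lt.1 (by linarith))).congr_of_eventuallyEq ?_
  have : ∀ᶠ r in 𝓝 t, |r| < |t| + 1 :=
    (continuous_abs.tendsto t).eventually (gt_mem_nhds (by linarith))
  filter_upwards [this] with r hr
  exact (key t r hr).symm

/-- Convergence of one-step methods: if the step `S h` agrees with the Euler step up to `O(h ^ 2)`,
then `n` steps of size `t / n` approach the solution at time `t`. -/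
theorem tendsto_iterate_step {F : Q → Q} {K : NNReal} (hF : LipschitzWith K F) {u : ℝ → Q}
    (hu : ∀ s, HasDerivAt u (F (u s)) s) {S : ℝ → Q → Q} {C : ℝ}
    (hS : ∀ h z, ‖S h z - z - h • F z‖ ≤ C * h ^ 2) (t : ℝ) :
    Tendsto (fun n : ℕ => (S (t / n))^[n] (u 0)) atTop (𝓝 (u t)) := by
  have hC : 0 ≤ C := by
    have := (norm_nonneg _).trans (hS 1 0)
    simpa using this
  have huc : Continuous u := continuous_iff_continuousAt.2 fun s => (hu s).continuousAt
  obtain ⟨M, hM⟩ := (isCompact_Icc (a := -|t|) (b := |t|)).exists_bound_of_continuousOn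
    (hF.continuous.comp huc).continuousOn
  have hM0 : 0 ≤ M := (norm_nonneg _).trans (hM 0 ⟨by simp, by simp⟩)
  have hLip : ∀ r ∈ Set.Icc (-|t|) |t|, ∀ s ∈ Set.Icc (-|t|) |t|, ‖u r - u s‖ ≤ M * |r - s| :=
    fun r hr s hs => (convex_Icc (-|t|) |t|).norm_image_sub_le_of_norm_hasDerivWithin_le
      (fun x _ => (hu x).hasDerivWithinAt) hM hs hr
  -- The truncation error of one Euler step along the solution.
  have hloc : ∀ s ∈ Set.Icc (-|t|) |t|, ∀ h, s + h ∈ Set.Icc (-|t|) |t| →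
      ‖u (s + h) - u s - h • F (u s)‖ ≤ K * M * h ^ 2 := by
    intro s hs h hsh
    have hsub : Set.uIcc s (s + h) ⊆ Set.Icc (-|t|) |t| := Set.uIcc_subset_Icc hs hsh
    have h1 := (convex_uIcc s (s + h)).norm_image_sub_le_of_norm_hasDerivWithin_le
      (f := fun r => u r - (r - s) • F (u s)) (f' := fun r => F (u r) - (1 : ℝ) • F (u s))
      (C := K * M * |h|) (x := s) (y := s + h) (fun r _ => ?_) (fun r hr => ?_)
      Set.left_mem_uIcc Set.right_mem_uIcc
    · simp only [add_sub_cancel_left, sub_self, zero_smul, sub_zero, Real.norm_eq_abs] at h1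
      rw [mul_assoc, abs_mul_abs_self, ← sq] at h1
      convert h1 using 2
      abel
    · exact ((hu r).sub (((hasDerivAt_id r).sub_const s).smul_const _)).hasDerivWithinAt
    · rw [one_smul, ← dist_eq_norm]
      refine (hF.dist_le_mul _ _).trans ?_
      rw [dist_eq_norm, mul_assoc]
      gcongr
      have h2 := Set.abs_sub_left_of_mem_uIcc hr
      rw [add_sub_cancel_left] at h2
      exact (hLip r (hsub hr) s hs).trans (mul_le_mul_of_nonneg_left h2 hM0)
  set D := C + K * M
  have hD : 0 ≤ D := by positivity
  -- Each step adds an error `D h ^ 2` and amplifies the previous one by at most `1 + K |h|`.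
  have herr : ∀ n : ℕ, 0 < n → ∀ k ≤ n, ‖(S (t / n))^[k] (u 0) - u (k * (t / n))‖ ≤
      k * (D * (t / n) ^ 2) * (1 + K * |t / n|) ^ k := by
    intro n hn k
    induction k with
    | zero => simp
    | succ k ih =>
      intro hk
      have ih := ih (by omega)
      set h := t / n with hh
      set z := (S h)^[k] (u 0)
      have hn' : (0 : ℝ) < n := by exact_mod_cast hn
      have hin : ∀ j : ℕ, j ≤ n → (j : ℝ) * h ∈ Set.Icc (-|t|) |t| := by
        intro j hj
        rw [Set.mem_Icc, ← abs_le, abs_mul, Nat.abs_cast, hh, abs_div, Nat.abs_cast, mul_div_assoc',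
          div_le_iff₀ hn', mul_comm]
        gcongr
      have hj := hin (k + 1) hk
      push_cast at hj
      have e1 : ((k : ℝ) + 1) * h = k * h + h := by ring
      rw [e1] at hj
      have h2 := hloc (k * h) (hin k (by omega)) h hj
      rw [Function.iterate_succ_apply']
      push_cast
      rw [e1]
      have h3 : S h z - u (k * h + h) = (S h z - z - h • F z) + (z - u (k * h))
          + h • (F z - F (u (k * h))) - (u (k * h + h) - u (k * h) - h • F (u (k * h))) := by
        rw [smul_sub]; abel
      have h4 : ‖h • (F z - F (u (k * h)))‖ ≤ |h| * (K * ‖z - u (k * h)‖) := by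
        rw [norm_smul, Real.norm_eq_abs]
        gcongr
        rw [← dist_eq_norm, ← dist_eq_norm]
        exact hF.dist_le_mul _ _
      have h5 : ‖S h z - u (k * h + h)‖ ≤ (1 + K * |h|) * ‖z - u (k * h)‖ + D * h ^ 2 := by
        rw [h3]
        have := (norm_sub_le (S h z - z - h • F z + (z - u (k * h))
          + h • (F z - F (u (k * h)))) (u (k * h + h) - u (k * h) - h • F (u (k * h))))
        have h6 := norm_add_le (S h z - z - h • F z + (z - u (k * h))) (h • (F z - F (u (k * h))))
        have h7 := norm_add_le (S h z - z - h • F z) (z - u (k * h))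
        have h8 := hS h z
        simp only [D]
        linarith
      refine h5.trans ?_
      have hq : 1 ≤ 1 + (K : ℝ) * |h| := by
        have : 0 ≤ (K : ℝ) * |h| := by positivity
        linarith
      set q := 1 + (K : ℝ) * |h|
      have h9 : 1 ≤ q ^ (k + 1) := one_le_pow₀ hq
      have h10 : 0 ≤ D * h ^ 2 := by positivity
      calc q * ‖z - u (k * h)‖ + D * h ^ 2
          ≤ q * (k * (D * h ^ 2) * q ^ k) + D * h ^ 2 * q ^ (k + 1) := by
            exact add_le_add (by gcongr) (le_mul_of_one_le_right h10 h9)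
        _ = _ := by ring
  have hlim : Tendsto (fun n : ℕ => D * t ^ 2 * Real.exp (K * |t|) * (1 / (n : ℝ))) atTop (𝓝 0) := by
    simpa using tendsto_one_div_atTop_nhds_zero_nat.const_mul (D * t ^ 2 * Real.exp (K * |t|))
  rw [tendsto_iff_norm_sub_tendsto_zero]
  refine squeeze_zero' (Eventually.of_forall fun n => norm_nonneg _) ?_ hlim
  filter_upwards [eventually_gt_atTop 0] with n hn
  have hn' : (0 : ℝ) < n := by exact_mod_cast hn
  have h1 := herr n hn n le_rfl
  rw [mul_div_cancel₀ _ hn'.ne'] at h1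
  refine h1.trans ?_
  have h2 : (1 + K * |t / n|) ^ n ≤ Real.exp (K * |t|) := by
    have h3 : 1 + K * |t / n| ≤ Real.exp (K * |t / n|) := by
      rw [add_comm]; exact Real.add_one_le_exp _
    refine (pow_le_pow_left₀ (by positivity) h3 n).trans ?_
    rw [← Real.exp_nat_mul, abs_div, Nat.abs_cast]
    apply le_of_eq
    congr 1
    field_simp
  calc (n : ℝ) * (D * (t / n) ^ 2) * (1 + K * |t / n|) ^ n
      ≤ n * (D * (t / n) ^ 2) * Real.exp (K * |t|) := by gcongr
    _ = _ := by field_simp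

/-- One step of size `h` of the symplectic Euler scheme for `x'' = f x`: a kick followed by a free
flight. -/
def eulerStep (f : Q → Q) (h : ℝ) (p : Q × Q) : Q × Q :=
  (p.1 + h • (p.2 + h • f p.1), p.2 + h • f p.1)

theorem tendsto_iterate_eulerStep {f : Q → Q} {K : NNReal} (hf : LipschitzWith K f) {B : ℝ}
    (hB : ∀ x, ‖f x‖ ≤ B) {u : ℝ → Q × Q} (hu : ∀ t, HasDerivAt u ((u t).2, f (u t).1) t) (t : ℝ) :
    Tendsto (fun n : ℕ => (eulerStep f (t / n))^[n] (u 0)) atTop (𝓝 (u t)) := by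
  refine tendsto_iterate_step (lipschitzWith_phaseField hf) hu (C := B) (fun h z => ?_) t
  have h1 : eulerStep f h z - z - h • ((z.2, f z.1) : Q × Q) = (h ^ 2 • f z.1, 0) := by
    ext
    · simp [eulerStep, smul_add, smul_smul, sq]
    · simp [eulerStep]
  rw [h1, Prod.norm_mk, norm_zero, norm_smul, max_eq_left (by positivity), Real.norm_eq_abs,
    abs_of_nonneg (sq_nonneg h), mul_comm]
  gcongr
  exact hB _

end ODE

/-! ### The splitting scheme preserves the phase space measure -/

/-- The phase space of the tagged particle and of `M` background particles. -/
abbrev State (d M : ℕ) := Phase d × (Fin M → Phase d)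

/-- The positions, or the velocities, of all particles. -/
abbrev AllSpace (d M : ℕ) := Space d × (Fin M → Space d)

/-- The state with given positions and velocities. -/
def ofPosVel {M : ℕ} (p : AllSpace d M × AllSpace d M) : State d M :=
  ((p.1.1, p.2.1), fun i => (p.1.2 i, p.2.2 i))

/-- The positions and velocities of a state. -/
def toPosVel {M : ℕ} (z : State d M) : AllSpace d M × AllSpace d M :=
  ((z.1.1, fun i => (z.2 i).1), (z.1.2, fun i => (z.2 i).2))

theorem continuous_ofPosVel {M : ℕ} : Continuous (ofPosVel (d := d) (M := M)) := by
  unfold ofPosVel; fun_prop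

/-- All positions replaced by their representatives in the box. -/
def wrapState (L : ℝ) {M : ℕ} (z : State d M) : State d M :=
  ((wrap L z.1.1, z.1.2), fun i => (wrap L (z.2 i).1, (z.2 i).2))

/-- The forces on all particles, if the background particle at `x` is subject to `G (X - x)`. -/
def pairForce {M : ℕ} (G : Space d → Space d) (q : AllSpace d M) : AllSpace d M :=
  (-∑ i, G (q.1 - q.2 i), fun i => G (q.1 - q.2 i))

/-- The measure `dX dV ∏ dx_i dv_i` on the phase space, positions being in the box. -/
abbrev stateMeasure (d M : ℕ) (L : ℝ) : Measure (State d M) :=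
  (phaseMeasure d L).prod (Measure.pi fun _ : Fin M => phaseMeasure d L)

instance (L : ℝ) : SigmaFinite (phaseMeasure d L) := by
  unfold phaseMeasure; infer_instance

theorem measurePreserving_kick {g : Space d → Space d} (hg : Measurable g) (L : ℝ) :
    MeasurePreserving (fun p : Phase d => (p.1, p.2 + g p.1)) (phaseMeasure d L)
      (phaseMeasure d L) := by
  refine (MeasurePreserving.id _).skew_product (g := fun a c => c + g a) ?_ ?_
  · simp only [Function.uncurry_def]; fun_prop
  · exact Filter.Eventually.of_forall fun a => (measurePreserving_add_right volume (g a)).map_eq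

theorem measurePreserving_freeFlight {L : ℝ} (hL : 0 < L) (h : ℝ) :
    MeasurePreserving (fun p : Phase d => (wrap L (p.1 + h • p.2), p.2)) (phaseMeasure d L)
      (phaseMeasure d L) := by
  have h1 : MeasurePreserving (fun p : Space d × Space d => (p.1, wrap L (p.2 + h • p.1)))
      ((volume : Measure (Space d)).prod ((volume : Measure (Space d)).restrict (box d L)))
      ((volume : Measure (Space d)).prod ((volume : Measure (Space d)).restrict (box d L))) := by
    refine (MeasurePreserving.id _).skew_product (g := fun a c => wrap L (c + h • a)) ?_ ?_
    · exact (measurable_wrap L).comp (by fun_prop)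
    · exact Filter.Eventually.of_forall fun a => (measurePreserving_wrap_add hL (h • a)).map_eq
  exact Measure.measurePreserving_swap.comp (h1.comp Measure.measurePreserving_swap)

/-- One wrapped step of the symplectic Euler scheme. -/
def wrappedStep (G : Space d → Space d) (L h : ℝ) {M : ℕ} (z : State d M) : State d M :=
  wrapState L (ofPosVel (eulerStep (pairForce G) h (toPosVel z)))

/-- The wrapped step is a composition of kicks and free flights, each of which translates one
variable by a function of the others. -/
theorem measurePreserving_wrappedStep {G : Space d → Space d} (hG : Measurable G) {L : ℝ}
    (hL : 0 < L) (h : ℝ) (M : ℕ) :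
    MeasurePreserving (wrappedStep G L h) (stateMeasure d M L) (stateMeasure d M L) := by
  have hback : MeasurePreserving
      (fun z : State d M => (z.1, fun i => ((z.2 i).1, (z.2 i).2 + h • G (z.1.1 - (z.2 i).1))))
      (stateMeasure d M L) (stateMeasure d M L) := by
    refine (MeasurePreserving.id _).skew_product
      (g := fun (Z : Phase d) (b : Fin M → Phase d) i => ((b i).1, (b i).2 + h • G (Z.1 - (b i).1)))
      ?_ ?_
    · refine measurable_pi_lambda _ fun i => ?_
      simp only [Function.uncurry_def]
      fun_prop
    · refine Filter.Eventually.of_forall fun Z => MeasurePreserving.map_eq ?_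
      exact measurePreserving_pi (fun _ : Fin M => phaseMeasure d L) (fun _ => phaseMeasure d L)
        fun i => measurePreserving_kick (g := fun x => h • G (Z.1 - x)) (by fun_prop) L
  have htag : MeasurePreserving
      (fun z : State d M => ((z.1.1, z.1.2 + h • -∑ i, G (z.1.1 - (z.2 i).1)), z.2))
      (stateMeasure d M L) (stateMeasure d M L) := by
    have h1 : MeasurePreserving (fun z : (Fin M → Phase d) × Phase d =>
        (z.1, (z.2.1, z.2.2 + h • -∑ i, G (z.2.1 - (z.1 i).1))))
        ((Measure.pi fun _ : Fin M => phaseMeasure d L).prod (phaseMeasure d L))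
        ((Measure.pi fun _ : Fin M => phaseMeasure d L).prod (phaseMeasure d L)) := by
      refine (MeasurePreserving.id _).skew_product (g := fun (b : Fin M → Phase d) (Z : Phase d) =>
        (Z.1, Z.2 + h • -∑ i, G (Z.1 - (b i).1))) ?_ ?_
      · simp only [Function.uncurry_def]; fun_prop
      · exact Filter.Eventually.of_forall fun b => (measurePreserving_kick
          (g := fun x => h • -∑ i, G (x - (b i).1)) (by fun_prop) L).map_eq
    exact Measure.measurePreserving_swap.comp (h1.comp Measure.measurePreserving_swap)
  have hfree : MeasurePreserving
      (Prod.map (fun p : Phase d => (wrap L (p.1 + h • p.2), p.2))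
        (fun (b : Fin M → Phase d) i => (wrap L ((b i).1 + h • (b i).2), (b i).2)))
      (stateMeasure d M L) (stateMeasure d M L) :=
    (measurePreserving_freeFlight hL h).prod
      (measurePreserving_pi _ _ fun _ => measurePreserving_freeFlight hL h)
  -- The kick of the tagged particle only changes its velocity, on which the kicks of the
  -- background particles do not depend.
  exact hfree.comp (hback.comp htag)

theorem wrapState_wrappedStep (G : Space d → Space d) {L : ℝ} (hL : 0 < L) (h : ℝ) {M : ℕ}
    (z : State d M) : wrapState L (wrappedStep G L h z) = wrappedStep G L h z := by
  simp only [wrappedStep, wrapState, wrap_wrap hL]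

theorem wrappedStep_wrapState {G : Space d → Space d} {L : ℝ} (hL : 0 < L)
    (hper : ∀ x y, G (wrap L x - wrap L y) = G (x - y)) (h : ℝ) {M : ℕ} (z : State d M) :
    wrappedStep G L h (wrapState L z) = wrappedStep G L h z := by
  simp only [wrappedStep, wrapState, ofPosVel, toPosVel, eulerStep, pairForce, hper, Prod.fst_add,
    Prod.snd_add, Prod.smul_fst, Prod.smul_snd, Pi.add_apply, Pi.smul_apply, wrap_wrap_add hL]

theorem wrapState_iterate_eulerStep {G : Space d → Space d} {L : ℝ} (hL : 0 < L)
    (hper : ∀ x y, G (wrap L x - wrap L y) = G (x - y)) (h : ℝ) {M : ℕ} (z : State d M) (n : ℕ) :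
    wrapState L (ofPosVel ((eulerStep (pairForce G) h)^[n] (toPosVel z))) =
      wrapState L ((wrappedStep G L h)^[n] z) := by
  induction n with
  | zero => rfl
  | succ n ih =>
    rw [Function.iterate_succ_apply', Function.iterate_succ_apply', wrapState_wrappedStep G hL,
      ← wrappedStep_wrapState hL hper, ← ih, wrappedStep_wrapState hL hper]
    rfl

/-! ### The flow does not increase the measure of open sets -/

theorem norm_pairForce_sub_le {G : Space d → Space d} {K : ℝ} (hK : 0 ≤ K)
    (hG : ∀ x y, ‖G x - G y‖ ≤ K * ‖x - y‖) {M : ℕ} (p q : AllSpace d M) :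
    ‖pairForce G p - pairForce G q‖ ≤ (M + 1) * (K * 2) * ‖p - q‖ := by
  have h1 : ∀ i, ‖G (p.1 - p.2 i) - G (q.1 - q.2 i)‖ ≤ K * 2 * ‖p - q‖ := fun i => by
    refine (hG _ _).trans ?_
    rw [mul_assoc]
    gcongr
    have h2 : ‖p.1 - q.1‖ ≤ ‖p - q‖ := norm_fst_le (p - q)
    have h3 : ‖p.2 i - q.2 i‖ ≤ ‖p - q‖ :=
      (norm_le_pi_norm (p.2 - q.2) i).trans (norm_snd_le (p - q))
    calc ‖p.1 - p.2 i - (q.1 - q.2 i)‖ = ‖(p.1 - q.1) - (p.2 i - q.2 i)‖ := by congr 1; abel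
      _ ≤ _ := (norm_sub_le _ _).trans (by linarith)
  have h0 : 0 ≤ K * 2 * ‖p - q‖ := by positivity
  have hM : (0 : ℝ) ≤ M := Nat.cast_nonneg _
  refine max_le ?_ ?_
  · have h2 : (pairForce G p - pairForce G q).1 =
        -∑ i, (G (p.1 - p.2 i) - G (q.1 - q.2 i)) := by
      simp only [pairForce, Prod.fst_sub, Finset.sum_sub_distrib]; abel
    rw [h2, norm_neg]
    refine (norm_sum_le_of_le _ fun i _ => h1 i).trans ?_
    simp only [Finset.sum_const, Finset.card_univ, Fintype.card_fin, nsmul_eq_mul]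
    nlinarith
  · refine (pi_norm_le_iff_of_nonneg (by positivity)).2 fun i => (h1 i).trans ?_
    nlinarith

theorem norm_pairForce_le {G : Space d → Space d} {B : ℝ} (hG : ∀ x, ‖G x‖ ≤ B) {M : ℕ}
    (q : AllSpace d M) : ‖pairForce G q‖ ≤ (M + 1) * B := by
  have hB : 0 ≤ B := (norm_nonneg _).trans (hG 0)
  have hM : (0 : ℝ) ≤ M := Nat.cast_nonneg _
  refine max_le ?_ ?_
  · simp only [pairForce, norm_neg]
    refine (norm_sum_le_of_le _ fun i _ => hG _).trans ?_
    simp only [Finset.sum_const, Finset.card_univ, Fintype.card_fin, nsmul_eq_mul]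
    nlinarith
  · refine (pi_norm_le_iff_of_nonneg (by positivity)).2 fun i => (hG _).trans ?_
    nlinarith

theorem lipschitzWith_pairForce {G : Space d → Space d} {K : ℝ} (hK : 0 ≤ K)
    (hG : ∀ x y, ‖G x - G y‖ ≤ K * ‖x - y‖) (M : ℕ) :
    LipschitzWith (Real.toNNReal ((M + 1) * (K * 2))) (pairForce (M := M) G) := by
  refine LipschitzWith.of_dist_le_mul fun p q => ?_
  rw [dist_eq_norm, dist_eq_norm, Real.coe_toNNReal _ (by positivity)]
  exact norm_pairForce_sub_le hK hG p q

/-- If the flow carries a set `A` of states into an open set `B` of the torus, and does not change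
the continuous density `w` along the way, then `B` has at least the measure of `A`: the solution is
the limit of the measure preserving splitting scheme, and Fatou's lemma applies. -/
theorem withDensity_le_of_flow {G : Space d → Space d} {L K C : ℝ} (hL : 0 < L)
    (hper : ∀ x y, G (wrap L x - wrap L y) = G (x - y)) (hK : 0 ≤ K)
    (hGK : ∀ x y, ‖G x - G y‖ ≤ K * ‖x - y‖) (hGC : ∀ x, ‖G x‖ ≤ C) {M : ℕ}
    {w : State d M → ℝ≥0∞} (hw : Continuous w) (hwper : ∀ z, w (wrapState L z) = w z)
    {A B : Set (State d M)} (hB : IsOpen B) (hBper : ∀ z, wrapState L z ∈ B ↔ z ∈ B) (t : ℝ)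
    (hA : ∀ z ∈ A, ∃ u : ℝ → AllSpace d M × AllSpace d M, u 0 = toPosVel z ∧
      (∀ s, HasDerivAt u ((u s).2, pairForce G (u s).1) s) ∧ ofPosVel (u t) ∈ B ∧
      w (ofPosVel (u t)) = w z) :
    (stateMeasure d M L).withDensity w A ≤ (stateMeasure d M L).withDensity w B := by
  have hGm : Measurable G := by
    have : LipschitzWith (Real.toNNReal K) G := LipschitzWith.of_dist_le_mul fun x y => by
      rw [dist_eq_norm, dist_eq_norm, Real.coe_toNNReal _ hK]; exact hGK x y
    exact this.continuous.measurable
  set f : State d M → ℝ≥0∞ := B.indicator w with hf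
  have hfm : Measurable f := hw.measurable.indicator hB.measurableSet
  have hfper : ∀ z, f (wrapState L z) = f z := fun z => by
    by_cases h : z ∈ B
    · rw [hf, Set.indicator_of_mem h, Set.indicator_of_mem ((hBper z).2 h), hwper]
    · rw [hf, Set.indicator_of_notMem h, Set.indicator_of_notMem (mt (hBper z).1 h)]
  have hstep : ∀ n : ℕ, MeasurePreserving ((wrappedStep G L (t / n))^[n]) (stateMeasure d M L)
      (stateMeasure d M L) := fun n => (measurePreserving_wrappedStep hGm hL (t / n) M).iterate n
  set g : ℕ → State d M → ℝ≥0∞ := fun n z => f ((wrappedStep G L (t / n))^[n] z)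
  have hgm : ∀ n, Measurable (g n) := fun n => hfm.comp (hstep n).measurable
  -- As `B` is open, the iterates from a point of `A` are eventually in `B`, and their densities
  -- converge to that of the starting point.
  have hsub : A ⊆ {z | w z ≤ Filter.liminf (fun n => g n z) Filter.atTop} := by
    intro z hz
    obtain ⟨u, hu0, hu, huB, huw⟩ := hA z hz
    have h1 := tendsto_iterate_eulerStep (lipschitzWith_pairForce hK hGK M) (norm_pairForce_le hGC)
      hu t
    have h2 := (continuous_ofPosVel.tendsto _).comp h1
    have h3 : Filter.Tendsto (fun n => g n z) Filter.atTop (nhds (w z)) := by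
      have h4 := (hw.tendsto _).comp h2
      rw [huw] at h4
      refine h4.congr' ?_
      filter_upwards [h2.eventually (hB.mem_nhds huB)] with n hn
      simp only [Function.comp, g, hu0] at hn ⊢
      rw [← hfper, ← wrapState_iterate_eulerStep hL hper, hfper, hf, Set.indicator_of_mem hn]
    exact h3.liminf_eq.ge
  have hmeas : MeasurableSet {z | w z ≤ Filter.liminf (fun n => g n z) Filter.atTop} :=
    measurableSet_le hw.measurable (Measurable.liminf hgm)
  calc (stateMeasure d M L).withDensity w A
      ≤ (stateMeasure d M L).withDensity w {z | w z ≤ Filter.liminf (fun n => g n z) Filter.atTop} :=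
        measure_mono hsub
    _ = ∫⁻ z in {z | w z ≤ Filter.liminf (fun n => g n z) Filter.atTop}, w z ∂(stateMeasure d M L) :=
        withDensity_apply _ hmeas
    _ ≤ ∫⁻ z in {z | w z ≤ Filter.liminf (fun n => g n z) Filter.atTop},
          Filter.liminf (fun n => g n z) Filter.atTop ∂(stateMeasure d M L) :=
        setLIntegral_mono' hmeas fun z hz => hz
    _ ≤ ∫⁻ z, Filter.liminf (fun n => g n z) Filter.atTop ∂(stateMeasure d M L) :=
        setLIntegral_le_lintegral _ _
    _ ≤ Filter.liminf (fun n => ∫⁻ z, g n z ∂(stateMeasure d M L)) Filter.atTop :=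
        lintegral_liminf_le hgm
    _ = ∫⁻ z, f z ∂(stateMeasure d M L) := by
        have : ∀ n, ∫⁻ z, g n z ∂(stateMeasure d M L) = ∫⁻ z, f z ∂(stateMeasure d M L) :=
          fun n => (hstep n).lintegral_comp hfm
        simp only [this, Filter.liminf_const]
    _ = (stateMeasure d M L).withDensity w B := by
        rw [withDensity_apply _ hB.measurableSet, lintegral_indicator hB.measurableSet]

/-! ### The Hamiltonian flow and the Gibbs weight -/

/-- `f` is bounded by `K`, is `K`-Lipschitz, and vanishes outside the ball of radius `R`. -/
structure IsLipBump {F : Type*} [NormedAddCommGroup F] (R K : ℝ) (f : Space d → F) : Prop where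
  lip : ∀ x y, ‖f x - f y‖ ≤ K * ‖x - y‖
  bound : ∀ x, ‖f x‖ ≤ K
  supp : ∀ x, R < ‖x‖ → f x = 0

namespace IsLipBump

variable {F : Type*} [NormedAddCommGroup F] {R K : ℝ} {f : Space d → F}

theorem nonneg (hf : IsLipBump R K f) : 0 ≤ K := (norm_nonneg _).trans (hf.bound 0)

theorem mono (hf : IsLipBump R K f) {K' : ℝ} (h : K ≤ K') : IsLipBump R K' f :=
  ⟨fun x y => (hf.lip x y).trans (by gcongr), fun x => (hf.bound x).trans h, hf.supp⟩

theorem norm_wrap_sub_le (hf : IsLipBump R K f) {L : ℝ} (hR : 0 ≤ R) (hL : R + 1 ≤ L)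
    (x y : Space d) : ‖f (wrap L x) - f (wrap L y)‖ ≤ 3 * K * ‖x - y‖ := by
  refine (norm_comp_wrap_sub_le hR hL hf.nonneg hf.lip hf.bound hf.supp x y).trans (le_of_eq ?_)
  ring

theorem continuous_wrap (hf : IsLipBump R K f) {L : ℝ} (hR : 0 ≤ R) (hL : R + 1 ≤ L) :
    Continuous fun y => f (wrap L y) :=
  continuous_comp_wrap hR hL hf.nonneg hf.lip hf.bound hf.supp

theorem continuous (hf : IsLipBump R K f) : Continuous f := by
  have : LipschitzWith (Real.toNNReal K) f := LipschitzWith.of_dist_le_mul fun x y => by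
    rw [dist_eq_norm, dist_eq_norm, Real.coe_toNNReal _ hf.nonneg]; exact hf.lip x y
  exact this.continuous

end IsLipBump

theorem hasCompactSupport_of_tsupport {F : Type*} [NormedAddCommGroup F] {f : Space d → F} {R : ℝ}
    (hs : tsupport f ⊆ Metric.closedBall 0 R) : HasCompactSupport f :=
  (isCompact_closedBall (0 : Space d) R).of_isClosed_subset (isClosed_tsupport f) hs

theorem eq_zero_of_tsupport {F : Type*} [NormedAddCommGroup F] {f : Space d → F} {R : ℝ}
    (hs : tsupport f ⊆ Metric.closedBall 0 R) (x : Space d) (hx : R < ‖x‖) : f x = 0 := by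
  by_contra h
  have := hs (subset_tsupport f h)
  rw [mem_closedBall_zero_iff] at this
  linarith

theorem exists_isLipBump_of_lipschitz {F : Type*} [NormedAddCommGroup F] {f : Space d → F} {R : ℝ}
    {K : NNReal} (hf : LipschitzWith K f) (hs : tsupport f ⊆ Metric.closedBall 0 R) :
    ∃ K', IsLipBump R K' f := by
  obtain ⟨B, hB⟩ := hf.continuous.bounded_above_of_compact_support (hasCompactSupport_of_tsupport hs)
  refine ⟨max K B, fun x y => ?_, fun x => (hB x).trans (le_max_right _ _), eq_zero_of_tsupport hs⟩
  rw [← dist_eq_norm, ← dist_eq_norm]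
  exact (hf.dist_le_mul x y).trans (by gcongr; exact le_max_left _ _)

theorem exists_isLipBump_of_contDiff {F : Type*} [NormedAddCommGroup F] [NormedSpace ℝ F]
    {f : Space d → F} {R : ℝ} (hf : ContDiff ℝ 1 f) (hs : tsupport f ⊆ Metric.closedBall 0 R) :
    ∃ K, IsLipBump R K f := by
  obtain ⟨K, hK⟩ := hf.lipschitzWith_of_hasCompactSupport (hasCompactSupport_of_tsupport hs)
    one_ne_zero
  exact exists_isLipBump_of_lipschitz hK hs

theorem contDiff_gradient {Φ : Space d → ℝ} {n : ℕ} (hΦ : ContDiff ℝ (n + 1) Φ) :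
    ContDiff ℝ n (gradient Φ) :=
  (InnerProductSpace.toDual ℝ (Space d)).symm.contDiff.comp (hΦ.fderiv_right le_rfl)

theorem tsupport_gradient_subset {Φ : Space d → ℝ} : tsupport (gradient Φ) ⊆ tsupport Φ := by
  refine (closure_mono ?_).trans (tsupport_fderiv_subset ℝ (f := Φ))
  intro x hx h
  apply hx
  rw [gradient, h, map_zero]

theorem exists_isLipBump_gradient {Φ : Space d → ℝ} {R : ℝ} (hΦ : ContDiff ℝ 2 Φ)
    (hs : tsupport Φ ⊆ Metric.closedBall 0 R) : ∃ K, IsLipBump R K (gradient Φ) :=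
  exists_isLipBump_of_contDiff (by exact_mod_cast contDiff_gradient (n := 1) (by exact_mod_cast hΦ))
    (tsupport_gradient_subset.trans hs)

/-- The force on a background particle whose displacement from the tagged particle is `-y`. -/
def forceOn (N : ℕ) (L : ℝ) (Φ : Space d → ℝ) (y : Space d) : Space d :=
  (1 / (N : ℝ)) • gradient Φ (wrap L y)

theorem norm_forceOn_sub_le {Φ : Space d → ℝ} {L R K : ℝ} (hR : 0 ≤ R) (hL : R + 1 ≤ L)
    (hg : IsLipBump R K (gradient Φ)) (N : ℕ) (x y : Space d) :
    ‖forceOn N L Φ x - forceOn N L Φ y‖ ≤ 1 / (N : ℝ) * (3 * K) * ‖x - y‖ := by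
  rw [forceOn, forceOn, ← smul_sub, norm_smul, Real.norm_eq_abs, abs_of_nonneg (by positivity),
    mul_assoc]
  gcongr
  exact hg.norm_wrap_sub_le hR hL x y

theorem norm_forceOn_le {Φ : Space d → ℝ} {R K : ℝ} (hg : IsLipBump R K (gradient Φ)) (L : ℝ)
    (N : ℕ) (x : Space d) : ‖forceOn N L Φ x‖ ≤ 1 / (N : ℝ) * K := by
  rw [forceOn, norm_smul, Real.norm_eq_abs, abs_of_nonneg (by positivity)]
  gcongr
  exact hg.bound _

/-- Each configuration has a trajectory. -/
theorem exists_isTrajectory {Φ : Space d → ℝ} {L R K : ℝ} (hR : 0 ≤ R) (hL : R + 1 ≤ L)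
    (hg : IsLipBump R K (gradient Φ)) (N : ℕ) (c : Config d) :
    ∃ X V x v, IsTrajectory N L Φ c X V x v := by
  obtain ⟨M, z⟩ := c
  have hK := hg.nonneg
  obtain ⟨u, hu0, hu⟩ := exists_solution
    (lipschitzWith_pairForce (by positivity) (norm_forceOn_sub_le hR hL hg N) M)
    (norm_pairForce_le (norm_forceOn_le hg L N)) (toPosVel z).1 (toPosVel z).2
  have hpos : ∀ t, HasDerivAt (fun t => (u t).1) (u t).2 t := fun t =>
    (ContinuousLinearMap.fst ℝ (AllSpace d M) (AllSpace d M)).hasFDerivAt.comp_hasDerivAt t (hu t)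
  have hvel : ∀ t, HasDerivAt (fun t => (u t).2) (pairForce (forceOn N L Φ) (u t).1) t := fun t =>
    (ContinuousLinearMap.snd ℝ (AllSpace d M) (AllSpace d M)).hasFDerivAt.comp_hasDerivAt t (hu t)
  refine ⟨fun t => (u t).1.1, fun t => (u t).2.1, fun i t => (u t).1.2 i, fun i t => (u t).2.2 i,
    ⟨⟨by rw [hu0]; rfl, by rw [hu0]; rfl⟩, fun i => ⟨by rw [hu0]; rfl, by rw [hu0]; rfl⟩,
      fun t => ?_, fun t => ?_, fun i t => ?_, fun i t => ?_⟩⟩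
  · exact (ContinuousLinearMap.fst ℝ (Space d) (Fin M → Space d)).hasFDerivAt.comp_hasDerivAt t (hpos t)
  · have h1 := (ContinuousLinearMap.fst ℝ (Space d) (Fin M → Space d)).hasFDerivAt.comp_hasDerivAt t (hvel t)
    simp only [pairForce, ContinuousLinearMap.coe_fst', forceOn, ← Finset.smul_sum] at h1
    exact h1
  · exact hasDerivAt_pi.1 ((ContinuousLinearMap.snd ℝ (Space d) (Fin M → Space d)).hasFDerivAt.comp_hasDerivAt t (hpos t)) i
  · exact hasDerivAt_pi.1 ((ContinuousLinearMap.snd ℝ (Space d) (Fin M → Space d)).hasFDerivAt.comp_hasDerivAt t (hvel t)) i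

/-- The configuration reached at time `t`. -/
def configAt {M : ℕ} (X V : ℝ → Space d) (x v : Fin M → ℝ → Space d) (t : ℝ) : Config d :=
  ⟨M, (X t, V t), fun i => (x i t, v i t)⟩

/-- The energy of a state. -/
def energy (N : ℕ) (L : ℝ) (Φ : Space d → ℝ) {M : ℕ} (z : State d M) : ℝ :=
  1 / (N : ℝ) * ∑ i, Φ (wrap L (z.1.1 - (z.2 i).1)) + ‖z.1.2‖ ^ 2 / 2 + ∑ i, ‖(z.2 i).2‖ ^ 2 / 2

theorem gcWeight_one (N : ℕ) (L : ℝ) (Φ : Space d → ℝ) {M : ℕ} (z : State d M) :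
    gcWeight N L Φ (fun _ => 1) M z =
      ((2 * Real.pi) ^ (-(d : ℝ) / 2)) ^ (M + 1) * Real.exp (-energy N L Φ z) := by
  simp only [gcWeight, gaussianDensity, energy, Finset.prod_mul_distrib, Finset.prod_const,
    Finset.card_univ, Fintype.card_fin, ← Real.exp_sum]
  rw [neg_add, neg_add, Real.exp_add, Real.exp_add, ← Finset.sum_neg_distrib (f := fun i => _ / _)]
  simp only [neg_div, neg_mul, one_mul]
  ring

theorem energy_eq {Φ : Space d → ℝ} {L R : ℝ} (hR : 0 ≤ R) (hL : R + 1 ≤ L)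
    (hΦ : Differentiable ℝ Φ) (hs : tsupport Φ ⊆ Metric.closedBall 0 R) {N : ℕ} {c : Config d}
    {X V : ℝ → Space d} {x v : Fin c.1 → ℝ → Space d} (h : IsTrajectory N L Φ c X V x v) (t : ℝ) :
    energy N L Φ (configAt X V x v t).2 = energy N L Φ c.2 := by
  have hderiv : ∀ t, HasDerivAt (fun t => energy N L Φ (configAt X V x v t).2) 0 t := by
    intro t
    have h1 : ∀ i, HasDerivAt (fun t => Φ (wrap L (X t - x i t)))
        (inner ℝ (gradient Φ (wrap L (X t - x i t))) (V t - v i t)) t := fun i => by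
      have := (hasFDerivAt_comp_wrap hR hL hΦ hs (X t - x i t)).comp_hasDerivAt t
        ((h.tagged_pos t).sub (h.back_pos i t))
      rw [inner_gradient_left]
      exact this
    have h2 := (h.tagged_vel t).norm_sq.div_const 2
    have h3 : ∀ i, HasDerivAt (fun t => ‖v i t‖ ^ 2 / 2) _ t :=
      fun i => (h.back_vel i t).norm_sq.div_const 2
    have h4 := (((HasDerivAt.fun_sum fun i (_ : i ∈ Finset.univ) => h1 i).const_mul
      (1 / (N : ℝ))).add h2).add (HasDerivAt.fun_sum fun i (_ : i ∈ Finset.univ) => h3 i)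
    refine h4.congr_deriv ?_
    simp only [inner_neg_right, inner_smul_right, inner_sub_right, inner_sum, Finset.sum_sub_distrib]
    simp only [real_inner_comm (V t), real_inner_comm (v _ t)]
    rw [← Finset.sum_div, ← Finset.mul_sum, ← Finset.mul_sum]
    ring
  have h5 : energy N L Φ (configAt X V x v t).2 = energy N L Φ (configAt X V x v 0).2 :=
    is_const_of_deriv_eq_zero (fun t => (hderiv t).differentiableAt)
    (fun t => (hderiv t).deriv) t 0
  rw [h5]
  congr 1
  simp only [configAt, h.tagged_init.1, h.tagged_init.2, (h.back_init _).1, (h.back_init _).2]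

theorem gcMass_apply (N : ℕ) (L : ℝ) (Φ g₀ : Space d → ℝ) (A : Set (Config d)) :
    gcMass N L Φ g₀ A = ∑' M : ℕ, ENNReal.ofReal ((N : ℝ) ^ M / (Nat.factorial M : ℝ)) *
      ((stateMeasure d M L).withDensity fun p => ENNReal.ofReal (gcWeight N L Φ g₀ M p))
        {p | (⟨M, p⟩ : Config d) ∈ A} := by
  have hemb : ∀ M : ℕ, MeasurableEmbedding fun p : State d M => (⟨M, p⟩ : Config d) := fun M => by
    refine ⟨sigma_mk_injective, fun s hs => (MeasurableSpace.measurableSet_iInf.1 hs) M,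
      fun s hs => MeasurableSpace.measurableSet_iInf.2 fun m => ?_⟩
    rcases eq_or_ne M m with rfl | hne
    · change MeasurableSet (Sigma.mk M ⁻¹' (Sigma.mk M '' s))
      rwa [Set.preimage_image_eq _ sigma_mk_injective]
    · change MeasurableSet (Sigma.mk m ⁻¹' (Sigma.mk M '' s))
      convert MeasurableSet.empty
      ext p
      simp only [Set.mem_preimage, Set.mem_image, Set.mem_empty_iff_false, iff_false]
      rintro ⟨q, -, hq⟩
      exact hne (congrArg Sigma.fst hq)
  rw [gcMass, Measure.sum_apply_of_countable]
  refine tsum_congr fun M => ?_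
  rw [Measure.smul_apply, (hemb M).map_apply, smul_eq_mul]
  rfl

/-- The flow maps the grand canonical measure with `g₀ = 1` to itself; only one inequality, for open
sets of the torus, is stated. -/
theorem gcMass_le_of_flow {Φ : Space d → ℝ} {L R K : ℝ} (hR : 0 ≤ R) (hL : R + 1 ≤ L)
    (hΦ : ContDiff ℝ 1 Φ) (hs : tsupport Φ ⊆ Metric.closedBall 0 R)
    (hg : IsLipBump R K (gradient Φ)) (N : ℕ) {A B : Set (Config d)}
    (hB : ∀ M, IsOpen {z : State d M | (⟨M, z⟩ : Config d) ∈ B})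
    (hBper : ∀ M (z : State d M), (⟨M, wrapState L z⟩ : Config d) ∈ B ↔ (⟨M, z⟩ : Config d) ∈ B)
    (t : ℝ) (hA : ∀ c ∈ A, ∃ X V x v, IsTrajectory N L Φ c X V x v ∧ configAt X V x v t ∈ B) :
    gcMass N L Φ (fun _ => 1) A ≤ gcMass N L Φ (fun _ => 1) B := by
  have hL0 : 0 < L := by linarith
  have hK := hg.nonneg
  rw [gcMass_apply, gcMass_apply]
  refine ENNReal.tsum_le_tsum fun M => ?_
  gcongr 1
  obtain ⟨K', hΦK⟩ := exists_isLipBump_of_contDiff hΦ hs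
  have hΦc := hΦK.continuous_wrap hR hL
  refine withDensity_le_of_flow (G := forceOn N L Φ) hL0
    (fun x y => by simp only [forceOn, wrap_wrap_sub_wrap hL0]) (by positivity)
    (norm_forceOn_sub_le hR hL hg N) (norm_forceOn_le hg L N) ?_ ?_ (hB M)
    (hBper M) t ?_
  · refine ENNReal.continuous_ofReal.comp ?_
    have h1 : Continuous fun z : State d M => ∑ i, Φ (wrap L (z.1.1 - (z.2 i).1)) :=
      continuous_finsetSum _ fun i _ => hΦc.comp (by fun_prop)
    have h2 : Continuous fun z : State d M => energy N L Φ z :=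
      ((h1.const_mul _).add (by fun_prop)).add (by fun_prop)
    have h3 : Continuous fun z : State d M =>
        ((2 * Real.pi) ^ (-(d : ℝ) / 2)) ^ (M + 1) * Real.exp (-energy N L Φ z) := by fun_prop
    refine h3.congr fun z => (gcWeight_one N L Φ z).symm
  · intro z
    simp only [gcWeight_one, energy, wrapState, wrap_wrap_sub_wrap hL0]
  · intro z hz
    obtain ⟨X, V, x, v, h, hXB⟩ := hA _ hz
    refine ⟨fun s => ((X s, fun i => x i s), (V s, fun i => v i s)), ?_, fun s => ?_, hXB, ?_⟩
    · simp only [h.tagged_init.1, h.tagged_init.2, (h.back_init _).1, (h.back_init _).2, toPosVel]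
    · have h1 := (h.tagged_pos s).prodMk (hasDerivAt_pi.2 fun i => h.back_pos i s)
      have h2 := (h.tagged_vel s).prodMk (hasDerivAt_pi.2 fun i => h.back_vel i s)
      have h3 := h1.prodMk h2
      simp only [pairForce, forceOn, ← Finset.smul_sum]
      exact h3
    · simp only [gcWeight_one]
      congr 3
      have := energy_eq hR hL (hΦ.differentiable one_ne_zero) hs h t
      rw [← this]
      rfl

/-! ### Exponential moments of the grand canonical measure -/

theorem lintegral_pi_prod {α : Type*} [MeasurableSpace α] (μ : Measure α) [SigmaFinite μ]
    {f : α → ℝ≥0∞} (hf : Measurable f) (M : ℕ) :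
    ∫⁻ b, ∏ i, f (b i) ∂(Measure.pi fun _ : Fin M => μ) = (∫⁻ a, f a ∂μ) ^ M := by
  induction M with
  | zero => simp
  | succ M ih =>
    have h := (measurePreserving_piFinSuccAbove (fun _ : Fin (M + 1) => μ) 0).symm
    rw [← h.lintegral_comp_emb (MeasurableEquiv.measurableEmbedding _)]
    simp only [MeasurableEquiv.piFinSuccAbove_symm_apply, Fin.insertNthEquiv,
      Fin.prod_univ_succ, Fin.insertNth_zero, Equiv.coe_fn_mk, Fin.cons_succ, Fin.zero_succAbove,
      Fin.cons_zero, cast_eq]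
    rw [lintegral_prod_mul (f := f) (g := fun b : Fin M → α => ∏ i, f (b i)) hf.aemeasurable
      (Measurable.aemeasurable (by fun_prop)), ih, pow_succ, mul_comm]

theorem gaussianDensity_pos (v : Space d) : 0 < gaussianDensity v := by
  unfold gaussianDensity; positivity

theorem continuous_gaussianDensity : Continuous (gaussianDensity (d := d)) := by
  unfold gaussianDensity; fun_prop

theorem integral_gaussianDensity_mul_exp {b : ℝ} (hb : b < 1 / 2) :
    ∫ v : Space d, Real.exp (b * ‖v‖ ^ 2) * gaussianDensity v =
      (2 * Real.pi) ^ (-(d : ℝ) / 2) * (Real.pi / (1 / 2 - b)) ^ ((d : ℝ) / 2) := by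
  have h := GaussianFourier.integral_rexp_neg_mul_sq_norm (V := Space d) (b := 1 / 2 - b)
    (by linarith)
  rw [finrank_euclideanSpace_fin] at h
  rw [← h, ← integral_const_mul]
  refine integral_congr_ae (Filter.Eventually.of_forall fun v => ?_)
  simp only [gaussianDensity]
  rw [mul_left_comm, ← Real.exp_add]
  congr 2
  ring

theorem integrable_gaussianDensity_mul_exp {b : ℝ} (hb : b < 1 / 2) :
    Integrable fun v : Space d => Real.exp (b * ‖v‖ ^ 2) * gaussianDensity v := by
  refine Integrable.of_integral_ne_zero ?_
  rw [integral_gaussianDensity_mul_exp hb]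
  have : 0 < 1 / 2 - b := by linarith
  positivity

theorem lintegral_gaussianDensity : ∫⁻ v : Space d, ENNReal.ofReal (gaussianDensity v) = 1 := by
  have h1 := integral_gaussianDensity_mul_exp (d := d) (b := 0) (by norm_num)
  have h2 := integrable_gaussianDensity_mul_exp (d := d) (b := 0) (by norm_num)
  simp only [zero_mul, Real.exp_zero, one_mul, sub_zero] at h1 h2
  rw [← ofReal_integral_eq_lintegral_ofReal h2
    (Filter.Eventually.of_forall fun v => (gaussianDensity_pos v).le), h1, ENNReal.ofReal_eq_one]
  rw [show Real.pi / (1 / 2) = 2 * Real.pi by ring, ← Real.rpow_add (by positivity)]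
  rw [show -(d : ℝ) / 2 + d / 2 = 0 by ring, Real.rpow_zero]

/-- The Gibbs factor of a single background particle. -/
def gibbsFactor (N : ℕ) (Φ : Space d → ℝ) (y : Space d) : ℝ := Real.exp (-(1 / (N : ℝ)) * Φ y)

theorem gibbsFactor_pos (N : ℕ) (Φ : Space d → ℝ) (y : Space d) : 0 < gibbsFactor N Φ y :=
  Real.exp_pos _

/-- The density of a background particle at `z`, given that the tagged particle is at `X`. -/
def backDensity (N : ℕ) (L : ℝ) (Φ : Space d → ℝ) (X : Space d) (z : Phase d) : ℝ≥0∞ :=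
  ENNReal.ofReal (gibbsFactor N Φ (wrap L (X - z.1))) * ENNReal.ofReal (gaussianDensity z.2)

theorem ofReal_gcWeight (N : ℕ) (L : ℝ) (Φ : Space d → ℝ) {g₀ : Space d → ℝ} (hg : ∀ V, 0 ≤ g₀ V)
    {M : ℕ} (p : State d M) :
    ENNReal.ofReal (gcWeight N L Φ g₀ M p) =
      ENNReal.ofReal (g₀ p.1.2 * gaussianDensity p.1.2) *
        ∏ i, backDensity N L Φ p.1.1 (p.2 i) := by
  have h1 : gcWeight N L Φ g₀ M p = g₀ p.1.2 * gaussianDensity p.1.2 *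
      ∏ i, (gibbsFactor N Φ (wrap L (p.1.1 - (p.2 i).1)) * gaussianDensity (p.2 i).2) := by
    simp only [gcWeight, gibbsFactor, Finset.prod_mul_distrib, Finset.mul_sum, Real.exp_sum]
    ring
  rw [h1, ENNReal.ofReal_mul (mul_nonneg (hg _) (gaussianDensity_pos _).le),
    ENNReal.ofReal_prod_of_nonneg fun i _ => (mul_pos (gibbsFactor_pos _ _ _) (gaussianDensity_pos _)).le]
  simp only [backDensity, ENNReal.ofReal_mul (gibbsFactor_pos _ _ _).le]

theorem measurable_gibbsFactor {N : ℕ} {Φ : Space d → ℝ} (hΦ : Continuous Φ) :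
    Measurable (gibbsFactor N Φ) := by
  unfold gibbsFactor
  have := hΦ.measurable
  fun_prop

theorem measurable_backDensity {N : ℕ} {L : ℝ} {Φ : Space d → ℝ} (hΦ : Continuous Φ) :
    Measurable (Function.uncurry fun Z z : Phase d => backDensity N L Φ Z.1 z) := by
  simp only [Function.uncurry_def, backDensity]
  have h1 : Measurable fun p : Phase d × Phase d => gibbsFactor N Φ (wrap L (p.1.1 - p.2.1)) :=
    (measurable_gibbsFactor hΦ).comp ((measurable_wrap L).comp (by fun_prop))
  have h2 : Measurable fun p : Phase d × Phase d => gaussianDensity p.2.2 :=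
    continuous_gaussianDensity.measurable.comp (by fun_prop)
  exact h1.ennreal_ofReal.mul h2.ennreal_ofReal

/-- The position of a background particle relative to the tagged one is uniform on the box. -/
theorem lintegral_phaseMeasure_mul {L : ℝ} (hL : 0 < L) (X : Space d) {f q : Space d → ℝ≥0∞}
    (hf : Measurable f) (hq : Measurable q) :
    ∫⁻ z, f (wrap L (X - z.1)) * q z.2 ∂(phaseMeasure d L) =
      (∫⁻ y in box d L, f y) * ∫⁻ v, q v := by
  have hm := measurePreserving_wrap_sub hL X
  rw [phaseMeasure, lintegral_prod_mul (f := fun x => f (wrap L (X - x)))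
    (hf.comp hm.measurable).aemeasurable hq.aemeasurable, hm.lintegral_comp hf]

/-- The integral of the Gibbs factor over the box. -/
def gibbsVolume (N : ℕ) (L : ℝ) (Φ : Space d → ℝ) : ℝ := ∫ y in box d L, gibbsFactor N Φ y

theorem volume_box (d : ℕ) {L : ℝ} (hL : 0 < L) :
    (volume : Measure (Space d)) (box d L) = ENNReal.ofReal ((2 * L) ^ d) := by
  have hb : box d L = WithLp.ofLp ⁻¹' (Set.univ.pi fun _ : Fin d => Set.Ico (-L) L) := by
    ext x; simp [box, Set.mem_pi]
  rw [hb, (PiLp.volume_preserving_ofLp (Fin d)).measure_preimage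
    (MeasurableSet.univ_pi fun _ => measurableSet_Ico).nullMeasurableSet, Real.volume_pi_Ico]
  simp only [sub_neg_eq_add, Finset.prod_const, Finset.card_univ, Fintype.card_fin, ← two_mul]
  rw [ENNReal.ofReal_pow (by positivity)]

theorem gibbsFactor_le {N : ℕ} (hN : 1 ≤ N) {Φ : Space d → ℝ} {K : ℝ} (hK : ∀ y, ‖Φ y‖ ≤ K)
    (y : Space d) : gibbsFactor N Φ y ≤ Real.exp K := by
  have hK0 : 0 ≤ K := (norm_nonneg _).trans (hK 0)
  have hN' : (1 : ℝ) ≤ N := by exact_mod_cast hN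
  apply Real.exp_le_exp.2
  have h1 : -Φ y ≤ K := (neg_le_abs _).trans (hK y)
  have h2 : 1 / (N : ℝ) ≤ 1 := by rw [div_le_one (by linarith)]; exact hN'
  have h3 : 0 ≤ 1 / (N : ℝ) := by positivity
  nlinarith

theorem le_gibbsFactor {N : ℕ} (hN : 1 ≤ N) {Φ : Space d → ℝ} {K : ℝ} (hK : ∀ y, ‖Φ y‖ ≤ K)
    (y : Space d) : Real.exp (-K) ≤ gibbsFactor N Φ y := by
  have hK0 : 0 ≤ K := (norm_nonneg _).trans (hK 0)
  have hN' : (1 : ℝ) ≤ N := by exact_mod_cast hN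
  apply Real.exp_le_exp.2
  have h1 : Φ y ≤ K := (le_abs_self _).trans (hK y)
  have h2 : 1 / (N : ℝ) ≤ 1 := by rw [div_le_one (by linarith)]; exact hN'
  have h3 : 0 ≤ 1 / (N : ℝ) := by positivity
  nlinarith

theorem integrableOn_box_of_bound {L : ℝ} (hL : 0 < L) {f : Space d → ℝ} (hf : Measurable f) {K : ℝ}
    (hK : ∀ y, ‖f y‖ ≤ K) : IntegrableOn f (box d L) :=
  Measure.integrableOn_of_bounded (by rw [volume_box d hL]; exact ENNReal.ofReal_ne_top)
    hf.aestronglyMeasurable (Filter.Eventually.of_forall hK)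

theorem integrableOn_gibbsFactor {N : ℕ} (hN : 1 ≤ N) {L : ℝ} (hL : 0 < L) {Φ : Space d → ℝ}
    (hΦ : Continuous Φ) {K : ℝ} (hK : ∀ y, ‖Φ y‖ ≤ K) :
    IntegrableOn (gibbsFactor N Φ) (box d L) :=
  integrableOn_box_of_bound hL (measurable_gibbsFactor hΦ) fun y => by
    rw [Real.norm_eq_abs, abs_of_pos (gibbsFactor_pos N Φ y)]
    exact gibbsFactor_le hN hK y

theorem ofReal_gibbsVolume {N : ℕ} (hN : 1 ≤ N) {L : ℝ} (hL : 0 < L) {Φ : Space d → ℝ}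
    (hΦ : Continuous Φ) {K : ℝ} (hK : ∀ y, ‖Φ y‖ ≤ K) :
    ENNReal.ofReal (gibbsVolume N L Φ) = ∫⁻ y in box d L, ENNReal.ofReal (gibbsFactor N Φ y) :=
  ofReal_integral_eq_lintegral_ofReal (integrableOn_gibbsFactor hN hL hΦ hK)
    (Filter.Eventually.of_forall fun _ => (Real.exp_pos _).le)

theorem lintegral_backDensity {N : ℕ} (hN : 1 ≤ N) {L : ℝ} (hL : 0 < L) {Φ : Space d → ℝ}
    (hΦ : Continuous Φ) {K : ℝ} (hK : ∀ y, ‖Φ y‖ ≤ K) (X : Space d) :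
    ∫⁻ z, backDensity N L Φ X z ∂(phaseMeasure d L) = ENNReal.ofReal (gibbsVolume N L Φ) := by
  unfold backDensity
  rw [lintegral_phaseMeasure_mul hL X
    (f := fun y => ENNReal.ofReal (gibbsFactor N Φ y)) (q := fun v => ENNReal.ofReal (gaussianDensity v))
    (ENNReal.measurable_ofReal.comp (measurable_gibbsFactor hΦ))
    (ENNReal.measurable_ofReal.comp continuous_gaussianDensity.measurable),
    lintegral_gaussianDensity, mul_one, ofReal_gibbsVolume hN hL hΦ hK]

theorem tsum_poisson (N : ℕ) {s : ℝ} (hs : 0 ≤ s) :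
    ∑' M : ℕ, ENNReal.ofReal ((N : ℝ) ^ M / (Nat.factorial M : ℝ)) * ENNReal.ofReal s ^ M =
      ENNReal.ofReal (Real.exp (N * s)) := by
  have h1 : ∀ M : ℕ, ENNReal.ofReal ((N : ℝ) ^ M / (Nat.factorial M : ℝ)) * ENNReal.ofReal s ^ M =
      ENNReal.ofReal ((N * s) ^ M / (Nat.factorial M : ℝ)) := fun M => by
    rw [← ENNReal.ofReal_pow hs, ← ENNReal.ofReal_mul (by positivity), mul_pow]
    congr 1; ring
  have h2 := NormedSpace.expSeries_div_hasSum_exp (𝔸 := ℝ) (N * s)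
  rw [← Real.exp_eq_exp_ℝ] at h2
  simp only [h1]
  rw [← ENNReal.ofReal_tsum_of_nonneg (fun n => by positivity) h2.summable, h2.tsum_eq]

theorem lintegral_phaseMeasure_snd (L : ℝ) {f : Space d → ℝ≥0∞} (hf : Measurable f) :
    ∫⁻ Z, f Z.2 ∂(phaseMeasure d L) = volume (box d L) * ∫⁻ V, f V := by
  have h := lintegral_prod_mul (μ := (volume : Measure (Space d)).restrict (box d L))
    (ν := (volume : Measure (Space d))) (f := fun _ => 1) (g := f) aemeasurable_const hf.aemeasurable
  simp only [one_mul, lintegral_const, Measure.restrict_apply_univ] at h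
  exact h

theorem lintegral_stateMeasure {u : Space d → ℝ≥0∞} (hu : Measurable u)
    {e : Phase d → Phase d → ℝ≥0∞} (he : Measurable (Function.uncurry e)) (L : ℝ) (M : ℕ) :
    ∫⁻ p : State d M, u p.1.2 * ∏ i, e p.1 (p.2 i) ∂(stateMeasure d M L) =
      ∫⁻ Z, u Z.2 * (∫⁻ z, e Z z ∂(phaseMeasure d L)) ^ M ∂(phaseMeasure d L) := by
  have heZ : ∀ Z, Measurable (e Z) := fun Z => he.comp measurable_prodMk_left
  have h1 : ∀ i, Measurable fun p : State d M => e p.1 (p.2 i) := fun i =>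
    he.comp (by fun_prop : Measurable fun p : State d M => (p.1, p.2 i))
  have h2 : Measurable fun p : State d M => u p.1.2 * ∏ i, e p.1 (p.2 i) :=
    (hu.comp (by fun_prop)).mul (Finset.measurable_fun_prod _ fun i _ => h1 i)
  rw [lintegral_prod _ h2.aemeasurable]
  refine lintegral_congr fun Z => ?_
  have h3 : Measurable fun b : Fin M → Phase d => ∏ i, e Z (b i) :=
    Finset.measurable_fun_prod _ fun i _ => (heZ Z).comp (measurable_pi_apply i)
  simp only
  rw [lintegral_const_mul _ h3, lintegral_pi_prod _ (heZ Z)]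

/-- The exponential moments of `h V + ∑ ψ (Z, z_i)`: conditionally on the tagged particle, the
background particles form a Poisson process. -/
theorem lintegral_exp_le {N : ℕ} {L : ℝ} {Φ : Space d → ℝ}
    (hΦ : Continuous Φ) {h : Space d → ℝ} (hh : Measurable h)
    {g₀ : Space d → ℝ} (hg : Measurable g₀)
    {ψ : Phase d → Phase d → ℝ} (hψ : Measurable (Function.uncurry ψ)) {s : ℝ} (hs : 0 ≤ s)
    (hψs : ∀ Z, ∫⁻ z, ENNReal.ofReal (Real.exp (ψ Z z)) * backDensity N L Φ Z.1 z ∂(phaseMeasure d L)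
      ≤ ENNReal.ofReal s) :
    ∑' M : ℕ, ENNReal.ofReal ((N : ℝ) ^ M / (Nat.factorial M : ℝ)) *
      ∫⁻ p : State d M, ENNReal.ofReal (g₀ p.1.2 * gaussianDensity p.1.2) *
        (∏ i, backDensity N L Φ p.1.1 (p.2 i)) *
        ENNReal.ofReal (Real.exp (h p.1.2 + ∑ i, ψ p.1 (p.2 i))) ∂(stateMeasure d M L) ≤
      volume (box d L) *
        (∫⁻ V, ENNReal.ofReal (Real.exp (h V)) * ENNReal.ofReal (g₀ V * gaussianDensity V)) *
        ENNReal.ofReal (Real.exp (N * s)) := by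
  set u : Space d → ℝ≥0∞ := fun V =>
    ENNReal.ofReal (Real.exp (h V)) * ENNReal.ofReal (g₀ V * gaussianDensity V)
  have hγ := (continuous_gaussianDensity (d := d)).measurable
  have hu : Measurable u := by fun_prop
  set e : Phase d → Phase d → ℝ≥0∞ := fun Z z =>
    ENNReal.ofReal (Real.exp (ψ Z z)) * backDensity N L Φ Z.1 z
  have he : Measurable (Function.uncurry e) := by
    have h1 := measurable_backDensity (N := N) (L := L) hΦ
    exact (Real.measurable_exp.comp hψ).ennreal_ofReal.mul h1
  have key : ∀ M : ℕ, ∫⁻ p : State d M, ENNReal.ofReal (g₀ p.1.2 * gaussianDensity p.1.2) *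
        (∏ i, backDensity N L Φ p.1.1 (p.2 i)) *
        ENNReal.ofReal (Real.exp (h p.1.2 + ∑ i, ψ p.1 (p.2 i))) ∂(stateMeasure d M L) ≤
      volume (box d L) * (∫⁻ V, u V) * ENNReal.ofReal s ^ M := by
    intro M
    have h1 : ∀ p : State d M, ENNReal.ofReal (g₀ p.1.2 * gaussianDensity p.1.2) *
        (∏ i, backDensity N L Φ p.1.1 (p.2 i)) *
        ENNReal.ofReal (Real.exp (h p.1.2 + ∑ i, ψ p.1 (p.2 i))) =
        u p.1.2 * ∏ i, e p.1 (p.2 i) := fun p => by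
      rw [Real.exp_add, Real.exp_sum, ENNReal.ofReal_mul (Real.exp_pos _).le,
        ENNReal.ofReal_prod_of_nonneg fun i _ => (Real.exp_pos _).le]
      simp only [u, e, Finset.prod_mul_distrib]
      ring
    simp only [h1]
    rw [lintegral_stateMeasure hu he, mul_assoc, ← lintegral_mul_const _ hu,
      ← lintegral_phaseMeasure_snd L (hu.mul_const _)]
    refine lintegral_mono fun Z => ?_
    gcongr
    exact hψs Z
  calc _ ≤ ∑' M : ℕ, ENNReal.ofReal ((N : ℝ) ^ M / (Nat.factorial M : ℝ)) *
        (volume (box d L) * (∫⁻ V, u V) * ENNReal.ofReal s ^ M) :=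
        ENNReal.tsum_le_tsum fun M => by gcongr; exact key M
    _ = _ := by
        rw [← tsum_poisson N hs, ← ENNReal.tsum_mul_left]
        refine tsum_congr fun M => ?_
        ring

theorem measurable_gcWeight {N : ℕ} {L : ℝ} {Φ g₀ : Space d → ℝ} (hΦ : Continuous Φ)
    (hg : Measurable g₀) (M : ℕ) : Measurable (gcWeight N L Φ g₀ M) := by
  have hγ := (continuous_gaussianDensity (d := d)).measurable
  have h1 : Measurable fun p : State d M => ∑ i, Φ (wrap L (p.1.1 - (p.2 i).1)) :=
    Finset.measurable_fun_sum _ fun i _ =>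
      hΦ.measurable.comp ((measurable_wrap L).comp (by fun_prop))
  have h2 : Measurable fun p : State d M => g₀ p.1.2 * gaussianDensity p.1.2 := by fun_prop
  have h3 : Measurable fun p : State d M => ∏ i, gaussianDensity (p.2 i).2 := by fun_prop
  exact ((Real.measurable_exp.comp (h1.const_mul _)).mul h2).mul h3

/-- The grand canonical partition function does not depend on `g₀`. -/
theorem gcMass_univ {N : ℕ} (hN : 1 ≤ N) {L : ℝ} (hL : 0 < L) {Φ : Space d → ℝ}
    (hΦ : Continuous Φ) {K : ℝ} (hK : ∀ y, ‖Φ y‖ ≤ K) {g₀ : Space d → ℝ} (hg : Measurable g₀)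
    (hg0 : ∀ V, 0 ≤ g₀ V) (hg1 : ∫⁻ V, ENNReal.ofReal (g₀ V * gaussianDensity V) = 1) :
    gcMass N L Φ g₀ Set.univ =
      volume (box d L) * ENNReal.ofReal (Real.exp (N * gibbsVolume N L Φ)) := by
  have hκ : 0 ≤ gibbsVolume N L Φ := integral_nonneg fun _ => (Real.exp_pos _).le
  rw [gcMass_apply, ← tsum_poisson N hκ, ← ENNReal.tsum_mul_left]
  refine tsum_congr fun M => ?_
  have hγ := (continuous_gaussianDensity (d := d)).measurable
  have h1 : ∀ A : Set (State d M), A = Set.univ →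
      ((stateMeasure d M L).withDensity fun p => ENNReal.ofReal (gcWeight N L Φ g₀ M p)) A =
        volume (box d L) * ENNReal.ofReal (gibbsVolume N L Φ) ^ M := by
    rintro _ rfl
    have hu : Measurable fun V => ENNReal.ofReal (g₀ V * gaussianDensity V) := by fun_prop
    have he : Measurable (Function.uncurry fun Z z : Phase d => backDensity N L Φ Z.1 z) :=
      measurable_backDensity hΦ
    rw [withDensity_apply _ MeasurableSet.univ, Measure.restrict_univ]
    simp only [ofReal_gcWeight N L Φ hg0]
    rw [lintegral_stateMeasure hu he]
    simp only [lintegral_backDensity hN hL hΦ hK]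
    rw [lintegral_phaseMeasure_snd L (hu.mul_const _), lintegral_mul_const _ hu, hg1, one_mul]
  rw [h1 _ (by ext; simp)]
  exact mul_left_comm _ _ _

/-- Chernoff's bound for the grand canonical measure with `g₀ = 1`. -/
theorem gcMass_le_exp {N : ℕ} (hN : 1 ≤ N) {L : ℝ} (hL : 0 < L) {Φ : Space d → ℝ}
    (hΦ : Continuous Φ) {K : ℝ} (hK : ∀ y, ‖Φ y‖ ≤ K) {h : Space d → ℝ} (hh : Measurable h)
    {ψ : Phase d → Phase d → ℝ} (hψ : Measurable (Function.uncurry ψ)) {s : ℝ} (hs : 0 ≤ s)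
    (hψs : ∀ Z, ∫⁻ z, ENNReal.ofReal (Real.exp (ψ Z z)) * backDensity N L Φ Z.1 z ∂(phaseMeasure d L)
      ≤ ENNReal.ofReal s) {H : ℝ} (hH : 0 ≤ H)
    (hhH : ∫⁻ V, ENNReal.ofReal (Real.exp (h V)) * ENNReal.ofReal (gaussianDensity V) ≤
      ENNReal.ofReal H) (a : ℝ) :
    gcMass N L Φ (fun _ => 1) {c | a < h c.2.1.2 + ∑ i, ψ c.2.1 (c.2.2 i)} ≤
      ENNReal.ofReal (H * Real.exp (-a + N * (s - gibbsVolume N L Φ))) *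
        gcMass N L Φ (fun _ => 1) Set.univ := by
  have h1 : ∀ M : ℕ, ((stateMeasure d M L).withDensity fun p =>
      ENNReal.ofReal (gcWeight N L Φ (fun _ => 1) M p))
        {p | (⟨M, p⟩ : Config d) ∈ {c : Config d | a < h c.2.1.2 + ∑ i, ψ c.2.1 (c.2.2 i)}} ≤
      ENNReal.ofReal (Real.exp (-a)) *
      ∫⁻ p : State d M, ENNReal.ofReal (1 * gaussianDensity p.1.2) *
        (∏ i, backDensity N L Φ p.1.1 (p.2 i)) *
        ENNReal.ofReal (Real.exp (h p.1.2 + ∑ i, ψ p.1 (p.2 i))) ∂(stateMeasure d M L) := by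
    intro M
    have hm : Measurable fun p : State d M => h p.1.2 + ∑ i, ψ p.1 (p.2 i) := by
      refine (hh.comp (by fun_prop)).add (Finset.measurable_fun_sum _ fun i _ => ?_)
      exact hψ.comp (by fun_prop : Measurable fun p : State d M => (p.1, p.2 i))
    have hms : MeasurableSet {p : State d M | a < h p.1.2 + ∑ i, ψ p.1 (p.2 i)} :=
      measurableSet_lt measurable_const hm
    have hwm := (measurable_gcWeight (N := N) (L := L) hΦ
      (g₀ := fun _ => 1) measurable_const M).ennreal_ofReal
    rw [← lintegral_const_mul' _ _ ENNReal.ofReal_ne_top]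
    refine (le_of_eq (withDensity_apply _ hms)).trans ?_
    rw [← lintegral_indicator hms]
    refine lintegral_mono fun p => ?_
    by_cases hp : p ∈ {p : State d M | a < h p.1.2 + ∑ i, ψ p.1 (p.2 i)}
    swap
    · rw [Set.indicator_of_notMem hp]
      exact zero_le
    rw [Set.indicator_of_mem hp]
    rw [ofReal_gcWeight N L Φ (g₀ := fun _ => 1) (fun _ => zero_le_one)]
    have h2 : 1 ≤ ENNReal.ofReal (Real.exp (-a)) *
        ENNReal.ofReal (Real.exp (h p.1.2 + ∑ i, ψ p.1 (p.2 i))) := by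
      rw [← ENNReal.ofReal_mul (Real.exp_pos _).le, ← Real.exp_add, ENNReal.one_le_ofReal]
      apply Real.one_le_exp
      have : a < h p.1.2 + ∑ i, ψ p.1 (p.2 i) := hp
      linarith
    rw [mul_left_comm]
    exact le_mul_of_one_le_right (zero_le) h2
  rw [gcMass_univ hN hL hΦ hK measurable_const (fun _ => zero_le_one)
    (by simpa using lintegral_gaussianDensity), gcMass_apply]
  calc _ ≤ ∑' M : ℕ, ENNReal.ofReal ((N : ℝ) ^ M / (Nat.factorial M : ℝ)) *
        (ENNReal.ofReal (Real.exp (-a)) *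
      ∫⁻ p : State d M, ENNReal.ofReal (1 * gaussianDensity p.1.2) *
        (∏ i, backDensity N L Φ p.1.1 (p.2 i)) *
        ENNReal.ofReal (Real.exp (h p.1.2 + ∑ i, ψ p.1 (p.2 i))) ∂(stateMeasure d M L)) :=
        ENNReal.tsum_le_tsum fun M => by gcongr; exact h1 M
    _ = ENNReal.ofReal (Real.exp (-a)) *
        ∑' M : ℕ, ENNReal.ofReal ((N : ℝ) ^ M / (Nat.factorial M : ℝ)) *
      ∫⁻ p : State d M, ENNReal.ofReal (1 * gaussianDensity p.1.2) *
        (∏ i, backDensity N L Φ p.1.1 (p.2 i)) *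
        ENNReal.ofReal (Real.exp (h p.1.2 + ∑ i, ψ p.1 (p.2 i))) ∂(stateMeasure d M L) := by
        rw [← ENNReal.tsum_mul_left]
        exact tsum_congr fun M => mul_left_comm _ _ _
    _ ≤ ENNReal.ofReal (Real.exp (-a)) * (volume (box d L) * ENNReal.ofReal H *
        ENNReal.ofReal (Real.exp (N * s))) := by
        gcongr
        refine (lintegral_exp_le hΦ hh measurable_const hψ hs hψs).trans ?_
        simp only [one_mul]
        gcongr
    _ = _ := by
        have e1 : H * Real.exp (-a + N * (s - gibbsVolume N L Φ)) *
            Real.exp (N * gibbsVolume N L Φ) = Real.exp (-a) * H * Real.exp (N * s) := by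
          rw [mul_assoc, ← Real.exp_add, mul_comm (Real.exp (-a)), mul_assoc, ← Real.exp_add]
          congr 2; ring
        rw [mul_left_comm (ENNReal.ofReal (H * _)), ← ENNReal.ofReal_mul (by positivity), e1,
          ENNReal.ofReal_mul (by positivity), ENNReal.ofReal_mul (by positivity)]
        ring

/-- Passing from a bounded `g₀` to `g₀ = 1`. -/
theorem gcMeasure_le {N : ℕ} (hN : 1 ≤ N) {L : ℝ} (hL : 0 < L) {Φ : Space d → ℝ}
    (hΦ : Continuous Φ) {K : ℝ} (hK : ∀ y, ‖Φ y‖ ≤ K) {g₀ : Space d → ℝ} (hg : Measurable g₀)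
    {Kg : ℝ} (hg0 : ∀ V, 0 ≤ g₀ V ∧ g₀ V ≤ Kg)
    (hg1 : ∫ V, g₀ V * gaussianDensity V = 1) (A : Set (Config d)) {r : ℝ}
    (hA : gcMass N L Φ (fun _ => 1) A ≤ ENNReal.ofReal r * gcMass N L Φ (fun _ => 1) Set.univ) :
    gcMeasure N L Φ g₀ A ≤ ENNReal.ofReal (Kg * r) := by
  have hKg : 0 ≤ Kg := (hg0 0).1.trans (hg0 0).2
  have hint : Integrable fun V => g₀ V * gaussianDensity V :=
    Integrable.of_integral_ne_zero (by rw [hg1]; exact one_ne_zero)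
  have hg1' : ∫⁻ V, ENNReal.ofReal (g₀ V * gaussianDensity V) = 1 := by
    rw [← ofReal_integral_eq_lintegral_ofReal hint (Filter.Eventually.of_forall fun V =>
      mul_nonneg (hg0 V).1 (gaussianDensity_pos V).le), hg1, ENNReal.ofReal_one]
  have h1 : gcMass N L Φ g₀ A ≤ ENNReal.ofReal Kg * gcMass N L Φ (fun _ => 1) A := by
    rw [gcMass_apply, gcMass_apply, ← ENNReal.tsum_mul_left]
    refine ENNReal.tsum_le_tsum fun M => ?_
    rw [mul_left_comm]
    gcongr
    rw [← smul_eq_mul, ← Measure.smul_apply, ← withDensity_smul _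
      (measurable_gcWeight hΦ measurable_const M).ennreal_ofReal]
    refine withDensity_mono (Filter.Eventually.of_forall fun p => ?_) _
    simp only [Pi.smul_apply, smul_eq_mul, ofReal_gcWeight N L Φ (fun V => (hg0 V).1),
      ofReal_gcWeight N L Φ (fun _ => zero_le_one (α := ℝ)), one_mul]
    rw [ENNReal.ofReal_mul (hg0 _).1, mul_assoc]
    gcongr
    exact (hg0 _).2
  have hu1 := gcMass_univ hN hL hΦ hK hg (fun V => (hg0 V).1) hg1'
  have hu2 := gcMass_univ hN hL hΦ hK (g₀ := fun _ => 1) measurable_const (fun _ => zero_le_one)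
    (by simpa using lintegral_gaussianDensity)
  have hne0 : gcMass N L Φ (fun _ => 1) Set.univ ≠ 0 := by
    rw [hu2, volume_box d hL]
    refine mul_ne_zero ?_ ?_ <;> rw [ENNReal.ofReal_ne_zero_iff] <;> positivity
  have hnet : gcMass N L Φ (fun _ => 1) Set.univ ≠ ⊤ := by
    rw [hu2, volume_box d hL]
    exact ENNReal.mul_ne_top ENNReal.ofReal_ne_top ENNReal.ofReal_ne_top
  rw [gcMeasure, Measure.smul_apply, smul_eq_mul, hu1, ← hu2, ENNReal.ofReal_mul hKg]
  calc _ ≤ (gcMass N L Φ (fun _ => 1) Set.univ)⁻¹ * (ENNReal.ofReal Kg * (ENNReal.ofReal r *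
        gcMass N L Φ (fun _ => 1) Set.univ)) := by
        gcongr
        exact h1.trans (by gcongr)
    _ = (gcMass N L Φ (fun _ => 1) Set.univ)⁻¹ * gcMass N L Φ (fun _ => 1) Set.univ *
        (ENNReal.ofReal Kg * ENNReal.ofReal r) := by ring
    _ = _ := by rw [ENNReal.inv_mul_cancel hne0 hnet, one_mul]

/-! ### One-particle exponential integrals -/

theorem measurable_backDensity_right {N : ℕ} {L : ℝ} {Φ : Space d → ℝ} (hΦ : Continuous Φ)
    (X : Space d) : Measurable (backDensity N L Φ X) := by
  have h1 : Measurable fun z : Phase d => gibbsFactor N Φ (wrap L (X - z.1)) :=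
    (measurable_gibbsFactor hΦ).comp ((measurable_wrap L).comp (by fun_prop))
  have h2 : Measurable fun z : Phase d => gaussianDensity z.2 :=
    continuous_gaussianDensity.measurable.comp (by fun_prop)
  exact h1.ennreal_ofReal.mul h2.ennreal_ofReal

/-- Exponential integral of an observable that is nontrivial only for relative positions in `S`. -/
theorem lintegral_exp_le_of_le {N : ℕ} (hN : 1 ≤ N) {L : ℝ} (hL : 0 < L) {Φ : Space d → ℝ}
    (hΦ : Continuous Φ) {K : ℝ} (hK : ∀ y, ‖Φ y‖ ≤ K) {S : Set (Space d)} (hS : MeasurableSet S)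
    {w J : ℝ} (hw : 0 ≤ w) (hSw : volume (S ∩ box d L) ≤ ENNReal.ofReal w) {q : Space d → ℝ}
    (hq : Measurable q) (hq0 : ∀ v, 0 ≤ q v) (hJ : 0 ≤ J)
    (hqJ : ∫⁻ v, ENNReal.ofReal (q v) * ENNReal.ofReal (gaussianDensity v) ≤ ENNReal.ofReal J)
    (X : Space d) {ψ : Phase d → ℝ}
    (hψ : ∀ z, Real.exp (ψ z) ≤ 1 + S.indicator (fun _ => 1) (wrap L (X - z.1)) * q z.2) :
    ∫⁻ z, ENNReal.ofReal (Real.exp (ψ z)) * backDensity N L Φ X z ∂(phaseMeasure d L) ≤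
      ENNReal.ofReal (gibbsVolume N L Φ + Real.exp K * w * J) := by
  have hκ : 0 ≤ gibbsVolume N L Φ := integral_nonneg fun _ => (Real.exp_pos _).le
  set f : Space d → ℝ≥0∞ := S.indicator fun y => ENNReal.ofReal (gibbsFactor N Φ y)
  have hf : Measurable f := (measurable_gibbsFactor hΦ).ennreal_ofReal.indicator hS
  have hγ := (continuous_gaussianDensity (d := d)).measurable
  have hqm : Measurable fun v => ENNReal.ofReal (q v) * ENNReal.ofReal (gaussianDensity v) := by
    fun_prop
  have h1 : ∀ z : Phase d, ENNReal.ofReal (Real.exp (ψ z)) * backDensity N L Φ X z ≤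
      backDensity N L Φ X z + f (wrap L (X - z.1)) *
        (ENNReal.ofReal (q z.2) * ENNReal.ofReal (gaussianDensity z.2)) := by
    intro z
    have h2 : ENNReal.ofReal (Real.exp (ψ z)) ≤
        1 + S.indicator (fun _ => 1) (wrap L (X - z.1)) * ENNReal.ofReal (q z.2) := by
      refine (ENNReal.ofReal_le_ofReal (hψ z)).trans ?_
      by_cases hz : wrap L (X - z.1) ∈ S
      · rw [Set.indicator_of_mem hz, Set.indicator_of_mem hz, one_mul, one_mul,
          ENNReal.ofReal_add zero_le_one (hq0 _), ENNReal.ofReal_one]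
      · rw [Set.indicator_of_notMem hz, Set.indicator_of_notMem hz]
        simp
    calc _ ≤ (1 + S.indicator (fun _ => 1) (wrap L (X - z.1)) * ENNReal.ofReal (q z.2)) *
          backDensity N L Φ X z := by gcongr
      _ = _ := by
        rw [add_mul, one_mul]
        congr 1
        simp only [f, backDensity]
        by_cases hz : wrap L (X - z.1) ∈ S
        · rw [Set.indicator_of_mem hz, Set.indicator_of_mem hz]; ring
        · rw [Set.indicator_of_notMem hz, Set.indicator_of_notMem hz]; simp
  refine (lintegral_mono h1).trans ?_
  rw [lintegral_add_left (measurable_backDensity_right hΦ X), lintegral_backDensity hN hL hΦ hK,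
    lintegral_phaseMeasure_mul hL X hf hqm, ENNReal.ofReal_add hκ (by positivity),
    ENNReal.ofReal_mul (by positivity), ENNReal.ofReal_mul (by positivity)]
  gcongr
  have h3 : ∀ y, f y ≤ S.indicator (fun _ => ENNReal.ofReal (Real.exp K)) y := fun y =>
    Set.indicator_le_indicator (ENNReal.ofReal_le_ofReal (gibbsFactor_le hN hK y))
  calc ∫⁻ y in box d L, f y
      ≤ ∫⁻ y in box d L, S.indicator (fun _ => ENNReal.ofReal (Real.exp K)) y := lintegral_mono h3
    _ = ENNReal.ofReal (Real.exp K) * volume (S ∩ box d L) := by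
        rw [lintegral_indicator_const hS, Measure.restrict_apply hS]
    _ ≤ _ := by gcongr

theorem gaussianDensity_le_one (v : Space d) : gaussianDensity v ≤ 1 := by
  have h1 : Real.exp (-‖v‖ ^ 2 / 2) ≤ 1 := by
    rw [Real.exp_le_one_iff]; nlinarith [sq_nonneg ‖v‖]
  have h2 : (2 * Real.pi) ^ (-(d : ℝ) / 2) ≤ 1 := by
    refine Real.rpow_le_one_of_one_le_of_nonpos (by nlinarith [Real.pi_gt_three]) ?_
    have : (0 : ℝ) ≤ d := Nat.cast_nonneg d
    linarith
  exact mul_le_one₀ h2 (Real.exp_pos _).le h1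

/-- The volume of the unit ball. -/
def unitVolume (d : ℕ) : ℝ := (volume : Measure (Space d)).real (Metric.ball 0 1)

theorem unitVolume_nonneg (d : ℕ) : 0 ≤ unitVolume d := measureReal_nonneg

theorem volume_closedBall_eq (x : Space d) {r : ℝ} (hr : 0 ≤ r) :
    volume (Metric.closedBall x r) = ENNReal.ofReal (r ^ d * unitVolume d) := by
  rw [Measure.addHaar_closedBall _ _ hr, finrank_euclideanSpace_fin, ENNReal.ofReal_mul (by positivity),
    unitVolume, Measure.real, ENNReal.ofReal_toReal measure_ball_lt_top.ne]

theorem pow_sub_pow_le {a b P : ℝ} (ha : 0 ≤ a) (hab : a ≤ b) (hbP : b ≤ P) (hP : 1 ≤ P) (n : ℕ) :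
    b ^ n - a ^ n ≤ n * P ^ n * (b - a) := by
  induction n with
  | zero => simp
  | succ n ih =>
    have h1 : a ^ n ≤ P ^ n := pow_le_pow_left₀ ha (hab.trans hbP) n
    have h2 : P ^ n ≤ P ^ (n + 1) := pow_le_pow_right₀ hP n.le_succ
    have h3 : 0 ≤ b ^ n - a ^ n := sub_nonneg.2 (pow_le_pow_left₀ ha hab n)
    have h4 : 0 ≤ b - a := sub_nonneg.2 hab
    calc b ^ (n + 1) - a ^ (n + 1) = b * (b ^ n - a ^ n) + a ^ n * (b - a) := by ring
      _ ≤ P * (n * P ^ n * (b - a)) + P ^ (n + 1) * (b - a) := by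
          gcongr
          exact h1.trans h2
      _ = _ := by push_cast; ring

/-- Thin spherical shells have small volume. -/
theorem volume_shell_le (hd : d ≠ 0) (V : Space d) {m s P : ℝ} (hm : 0 ≤ m) (hs : 0 ≤ s)
    (hP : 1 ≤ P) (hmP : m + s ≤ P) :
    volume {v : Space d | |‖v - V‖ - m| ≤ s} ≤
      ENNReal.ofReal (d * P ^ d * (2 * s) * unitVolume d) := by
  have hU := unitVolume_nonneg d
  set a := max (m - s) 0
  have ha : 0 ≤ a := le_max_right _ _
  have hab : a ≤ m + s := max_le (by linarith) (by linarith)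
  have hsub : {v : Space d | |‖v - V‖ - m| ≤ s} ⊆ Metric.closedBall V (m + s) \ Metric.ball V a := by
    intro v hv
    have hv' : |‖v - V‖ - m| ≤ s := hv
    rw [abs_le] at hv'
    refine ⟨?_, ?_⟩
    · rw [Metric.mem_closedBall, dist_eq_norm]; linarith
    · rw [Metric.mem_ball, dist_eq_norm, not_lt]
      exact max_le (by linarith) (norm_nonneg _)
  have hball : volume (Metric.ball V a) = ENNReal.ofReal (a ^ d * unitVolume d) := by
    rcases ha.eq_or_lt with h0 | h0
    · rw [← h0, Metric.ball_zero, measure_empty, zero_pow hd, zero_mul, ENNReal.ofReal_zero]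
    · rw [Measure.addHaar_ball_of_pos _ _ h0, finrank_euclideanSpace_fin,
        ENNReal.ofReal_mul (by positivity), unitVolume, Measure.real,
        ENNReal.ofReal_toReal measure_ball_lt_top.ne]
  refine (measure_mono hsub).trans ?_
  rw [measure_sdiff ((Metric.ball_subset_ball hab).trans Metric.ball_subset_closedBall)
    Metric.isOpen_ball.measurableSet.nullMeasurableSet measure_ball_lt_top.ne, hball,
    volume_closedBall_eq V (by linarith), ← ENNReal.ofReal_sub _ (by positivity)]
  apply ENNReal.ofReal_le_ofReal
  rw [← sub_mul]
  gcongr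
  refine (pow_sub_pow_le ha hab hmP hP d).trans ?_
  gcongr
  have : m - s ≤ a := le_max_left _ _
  linarith

theorem lintegral_indicator_gaussianDensity_le (S : Set (Space d)) (hS : MeasurableSet S) :
    ∫⁻ v, S.indicator (fun _ => 1) v * ENNReal.ofReal (gaussianDensity v) ≤ volume S := by
  calc _ ≤ ∫⁻ v, S.indicator (fun _ => 1) v := by
        refine lintegral_mono fun v => mul_le_of_le_one_right zero_le ?_
        exact ENNReal.ofReal_le_one.2 (gaussianDensity_le_one v)
    _ = volume S := by rw [lintegral_indicator_const hS, one_mul]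

theorem lintegral_const_mul_gaussianDensity (c : ℝ) :
    ∫⁻ v : Space d, ENNReal.ofReal c * ENNReal.ofReal (gaussianDensity v) = ENNReal.ofReal c := by
  rw [lintegral_const_mul _ continuous_gaussianDensity.measurable.ennreal_ofReal,
    lintegral_gaussianDensity, mul_one]

/-- The Gaussian moment `∫ exp (|v|² / 4) γ(v) dv`. -/
def gaussMoment (d : ℕ) : ℝ := ∫ v : Space d, Real.exp (1 / 4 * ‖v‖ ^ 2) * gaussianDensity v

theorem gaussMoment_nonneg (d : ℕ) : 0 ≤ gaussMoment d :=
  integral_nonneg fun v => (mul_pos (Real.exp_pos _) (gaussianDensity_pos v)).le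

theorem lintegral_exp_sq_gaussianDensity (d : ℕ) :
    ∫⁻ v : Space d, ENNReal.ofReal (Real.exp (1 / 4 * ‖v‖ ^ 2)) *
      ENNReal.ofReal (gaussianDensity v) = ENNReal.ofReal (gaussMoment d) := by
  rw [gaussMoment, ofReal_integral_eq_lintegral_ofReal
    (integrable_gaussianDensity_mul_exp (by norm_num))
    (Filter.Eventually.of_forall fun v => (mul_pos (Real.exp_pos _) (gaussianDensity_pos v)).le)]
  simp only [ENNReal.ofReal_mul (Real.exp_pos _).le]

/-- The cube of the truncated interaction time. -/
def cubedTime (N : ℕ) (w : Space d) : ℝ := (max ‖w‖ ((N : ℝ) ^ (-(1 / 3) : ℝ)))⁻¹ ^ 3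

theorem cubedTime_nonneg (N : ℕ) (w : Space d) : 0 ≤ cubedTime N w := by
  unfold cubedTime; positivity

theorem cubedTime_le {N : ℕ} (hN : 1 ≤ N) (w : Space d) : cubedTime N w ≤ N := by
  have hN' : (0 : ℝ) < N := by exact_mod_cast hN
  have h1 : 0 < (N : ℝ) ^ (-(1 / 3) : ℝ) := by positivity
  calc cubedTime N w ≤ ((N : ℝ) ^ (-(1 / 3) : ℝ))⁻¹ ^ 3 := by
        unfold cubedTime
        gcongr
        exact le_max_right _ _
    _ = N := by
        rw [← Real.rpow_neg hN'.le, neg_neg, ← Real.rpow_natCast, ← Real.rpow_mul hN'.le]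
        norm_num

theorem continuous_cubedTime {N : ℕ} (hN : 1 ≤ N) : Continuous (cubedTime (d := d) N) := by
  have hN' : (0 : ℝ) < N := by exact_mod_cast hN
  have h1 : 0 < (N : ℝ) ^ (-(1 / 3) : ℝ) := by positivity
  unfold cubedTime
  refine (Continuous.inv₀ (by fun_prop) fun w => ?_).pow 3
  exact (lt_max_of_lt_right h1).ne'

/-- Dyadic decomposition of the truncated interaction time. -/
theorem cubedTime_le_sum {N J : ℕ} (hN : 1 ≤ N) (hJ : N ≤ 2 ^ J) (w : Space d) :
    cubedTime N w ≤ 1 + ∑ j ∈ Finset.range (J + 1),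
      8 ^ (j + 1) * (Metric.closedBall (0 : Space d) ((1 / 2) ^ j)).indicator (fun _ => 1) w := by
  have hN' : (0 : ℝ) < N := by exact_mod_cast hN
  have hsum : 0 ≤ ∑ j ∈ Finset.range (J + 1),
      8 ^ (j + 1) * (Metric.closedBall (0 : Space d) ((1 / 2) ^ j)).indicator (fun _ => (1 : ℝ)) w :=
    Finset.sum_nonneg fun j _ => mul_nonneg (by positivity)
      (Set.indicator_nonneg (fun _ _ => zero_le_one) _)
  have h0 : 0 < (N : ℝ) ^ (-(1 / 3) : ℝ) := by positivity
  set r := max ‖w‖ ((N : ℝ) ^ (-(1 / 3) : ℝ)) with hr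
  have hr0 : 0 < r := lt_max_of_lt_right h0
  rcases le_or_gt 1 r with h1 | h1
  · have : r⁻¹ ^ 3 ≤ 1 := pow_le_one₀ (by positivity) (inv_le_one_of_one_le₀ h1)
    unfold cubedTime
    linarith
  · obtain ⟨j, hj1, hj2⟩ := exists_nat_pow_near (one_le_inv₀ hr0 |>.2 h1.le) (one_lt_two (α := ℝ))
    have hjJ : j < J + 1 := by
      have h2 : r⁻¹ ≤ (N : ℝ) := by
        have h3 : r⁻¹ ≤ ((N : ℝ) ^ (-(1 / 3) : ℝ))⁻¹ := by gcongr; exact le_max_right _ _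
        refine h3.trans ?_
        rw [← Real.rpow_neg hN'.le, neg_neg]
        exact (Real.rpow_le_rpow_of_exponent_le (by exact_mod_cast hN) (by norm_num)).trans_eq
          (Real.rpow_one _)
      have h4 : (2 : ℝ) ^ j ≤ 2 ^ J := (hj1.trans h2).trans (by exact_mod_cast hJ)
      have := (pow_le_pow_iff_right₀ (one_lt_two (α := ℝ))).1 h4
      omega
    have hw : w ∈ Metric.closedBall (0 : Space d) ((1 / 2) ^ j) := by
      rw [mem_closedBall_zero_iff]
      have h5 : r ≤ (1 / 2) ^ j := by
        rw [one_div, inv_pow]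
        exact (le_inv_comm₀ (by positivity) hr0).1 hj1
      exact (le_max_left _ _).trans h5
    have h6 : cubedTime N w ≤ 8 ^ (j + 1) := by
      unfold cubedTime
      rw [← hr]
      calc r⁻¹ ^ 3 ≤ (2 ^ (j + 1)) ^ 3 := by gcongr
        _ = 8 ^ (j + 1) := by rw [← pow_mul, mul_comm, pow_mul]; norm_num
    have h7 := Finset.single_le_sum (f := fun j => (8 : ℝ) ^ (j + 1) *
      (Metric.closedBall (0 : Space d) ((1 / 2) ^ j)).indicator (fun _ => (1 : ℝ)) w)
      (fun j _ => mul_nonneg (by positivity) (Set.indicator_nonneg (fun _ _ => zero_le_one) _))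
      (Finset.mem_range.2 hjJ)
    simp only [Set.indicator_of_mem hw, mul_one] at h7
    linarith

/-- The logarithmic bound on the mean of the cubed interaction time, where `d ≥ 3` is used. -/
theorem lintegral_cubedTime_le (hd : 3 ≤ d) {N J : ℕ} (hN : 1 ≤ N) (hJ : N ≤ 2 ^ J) (V : Space d) :
    ∫⁻ v, ENNReal.ofReal (cubedTime N (v - V)) * ENNReal.ofReal (gaussianDensity v) ≤
      ENNReal.ofReal (1 + (J + 1) * (8 * unitVolume d)) := by
  have hU := unitVolume_nonneg d
  have hγ := (continuous_gaussianDensity (d := d)).measurable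
  set S : ℕ → Set (Space d) := fun j => Metric.closedBall V ((1 / 2) ^ j)
  have hS : ∀ j, MeasurableSet (S j) := fun j => Metric.isClosed_closedBall.measurableSet
  have h1 : ∀ v, ENNReal.ofReal (cubedTime N (v - V)) ≤ 1 + ∑ j ∈ Finset.range (J + 1),
      ENNReal.ofReal (8 ^ (j + 1)) * (S j).indicator (fun _ => 1) v := by
    intro v
    refine (ENNReal.ofReal_le_ofReal (cubedTime_le_sum hN hJ _)).trans ?_
    have hnn : ∀ j ∈ Finset.range (J + 1), (0 : ℝ) ≤ 8 ^ (j + 1) *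
        (Metric.closedBall (0 : Space d) ((1 / 2) ^ j)).indicator (fun _ => (1 : ℝ)) (v - V) :=
      fun j _ => mul_nonneg (by positivity) (Set.indicator_nonneg (fun _ _ => zero_le_one) _)
    rw [ENNReal.ofReal_add zero_le_one (Finset.sum_nonneg hnn), ENNReal.ofReal_one,
      ENNReal.ofReal_sum_of_nonneg hnn]
    gcongr with j
    rw [ENNReal.ofReal_mul (by positivity)]
    gcongr
    by_cases hv : v ∈ S j
    · rw [Set.indicator_of_mem hv]
      refine ENNReal.ofReal_le_one.2 ?_
      exact Set.indicator_le' (f := fun _ => (1 : ℝ)) (g := fun _ => 1) (fun _ _ => le_rfl)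
        (fun _ _ => zero_le_one) _
    · have hv' : v - V ∉ Metric.closedBall (0 : Space d) ((1 / 2) ^ j) := fun h => hv (by
        rwa [mem_closedBall_zero_iff, ← dist_eq_norm] at h)
      rw [Set.indicator_of_notMem hv, Set.indicator_of_notMem hv', ENNReal.ofReal_zero]
  have h2 : ∀ j, Measurable fun v : Space d =>
      (S j).indicator (fun _ => (1 : ℝ≥0∞)) v * ENNReal.ofReal (gaussianDensity v) := fun j =>
    (measurable_const.indicator (hS j)).mul hγ.ennreal_ofReal
  calc _ ≤ ∫⁻ v, (ENNReal.ofReal (gaussianDensity v) + ∑ j ∈ Finset.range (J + 1),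
        ENNReal.ofReal (8 ^ (j + 1)) *
          ((S j).indicator (fun _ => 1) v * ENNReal.ofReal (gaussianDensity v))) := by
        refine lintegral_mono fun v => (mul_le_mul_left (h1 v) _).trans (le_of_eq ?_)
        rw [add_mul, one_mul, Finset.sum_mul]
        simp only [mul_assoc]
    _ = 1 + ∑ j ∈ Finset.range (J + 1), ENNReal.ofReal (8 ^ (j + 1)) *
          ∫⁻ v, (S j).indicator (fun _ => 1) v * ENNReal.ofReal (gaussianDensity v) := by
        rw [lintegral_add_left hγ.ennreal_ofReal, lintegral_gaussianDensity,
          lintegral_finsetSum _ fun j _ => (h2 j).const_mul _]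
        congr 1
        exact Finset.sum_congr rfl fun j _ => lintegral_const_mul _ (h2 j)
    _ ≤ 1 + ∑ j ∈ Finset.range (J + 1), ENNReal.ofReal (8 * unitVolume d) := by
        gcongr with j
        refine (mul_le_mul_right (lintegral_indicator_gaussianDensity_le _ (hS j)) _).trans ?_
        rw [volume_closedBall_eq V (by positivity), ← ENNReal.ofReal_mul (by positivity)]
        apply ENNReal.ofReal_le_ofReal
        have h3 : ((1 / 2 : ℝ) ^ j) ^ d ≤ ((1 / 2) ^ j) ^ 3 :=
          pow_le_pow_of_le_one (by positivity) (pow_le_one₀ (by norm_num) (by norm_num)) hd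
        have h4 : (8 : ℝ) ^ (j + 1) * ((1 / 2) ^ j) ^ 3 = 8 := by
          rw [← pow_mul, mul_comm j 3, pow_mul, pow_succ, mul_right_comm, ← mul_pow]; norm_num
        calc (8 : ℝ) ^ (j + 1) * (((1 / 2) ^ j) ^ d * unitVolume d)
            ≤ 8 ^ (j + 1) * (((1 / 2) ^ j) ^ 3 * unitVolume d) := by gcongr
          _ = 8 * unitVolume d := by rw [← mul_assoc, h4]
    _ = _ := by
        rw [Finset.sum_const, Finset.card_range, nsmul_eq_mul,
          ENNReal.ofReal_add zero_le_one (by positivity), ENNReal.ofReal_one,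
          ENNReal.ofReal_mul (p := (J : ℝ) + 1) (by positivity), ← Nat.cast_add_one (R := ℝ),
          ENNReal.ofReal_natCast]

/-- The integral of a mean-zero bump against the Gibbs factor is of order `1 / N`. -/
theorem abs_integral_mul_gibbsFactor_le {N : ℕ} {L R K : ℝ} (hRL : R < L) (hN : 1 ≤ N)
    {Φ : Space d → ℝ} (hΦ : Continuous Φ) (hK : ∀ y, ‖Φ y‖ ≤ K) (hKN : K ≤ N) {f : Space d → ℝ}
    (hf : IsLipBump R K f) (hf0 : ∫ y, f y = 0) :
    |∫ y in box d L, f y * gibbsFactor N Φ y| ≤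
      2 * K ^ 2 * (volume : Measure (Space d)).real (Metric.closedBall 0 R) / N := by
  have hN' : (0 : ℝ) < N := by exact_mod_cast hN
  have hsub : Metric.closedBall (0 : Space d) R ⊆ box d L := fun y hy =>
    mem_box_of_norm_lt ((mem_closedBall_zero_iff.1 hy).trans_lt hRL)
  have hz : ∀ y, y ∉ Metric.closedBall (0 : Space d) R → f y = 0 := fun y hy =>
    hf.supp y (by simpa using hy)
  have hfin : volume (Metric.closedBall (0 : Space d) R) < ⊤ := measure_closedBall_lt_top
  have h1 : ∫ y in box d L, f y * gibbsFactor N Φ y =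
      ∫ y in Metric.closedBall (0 : Space d) R, f y * gibbsFactor N Φ y :=
    setIntegral_eq_of_subset_of_forall_sdiff_eq_zero (measurableSet_box d L) hsub
      fun y hy => by rw [hz y hy.2, zero_mul]
  have h2 : ∫ y in Metric.closedBall (0 : Space d) R, f y = 0 := by
    rw [← hf0]
    exact setIntegral_eq_integral_of_forall_compl_eq_zero fun y hy => hz y hy
  have hfc := hf.continuous
  have hgc : Continuous (gibbsFactor N Φ) := by unfold gibbsFactor; fun_prop
  have hc : IsCompact (Metric.closedBall (0 : Space d) R) := isCompact_closedBall _ _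
  have h3 : ∫ y in Metric.closedBall (0 : Space d) R, f y * gibbsFactor N Φ y =
      ∫ y in Metric.closedBall (0 : Space d) R, f y * (gibbsFactor N Φ y - 1) := by
    simp only [mul_sub, mul_one]
    have hi : IntegrableOn (fun y => f y * gibbsFactor N Φ y) (Metric.closedBall 0 R) :=
      (hfc.mul hgc).continuousOn.integrableOn_compact hc
    rw [integral_sub hi (hfc.continuousOn.integrableOn_compact hc), h2, sub_zero]
  rw [h1, h3, ← Real.norm_eq_abs]
  refine (norm_setIntegral_le_of_norm_le_const (C := 2 * K ^ 2 / N) hfin fun y _ => ?_).trans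
    (le_of_eq (by ring))
  rw [norm_mul, Real.norm_eq_abs (gibbsFactor N Φ y - 1)]
  have h4 : |-(1 / (N : ℝ)) * Φ y| ≤ K / N := by
    rw [abs_mul, abs_neg, abs_of_pos (by positivity), one_div, inv_mul_eq_div]
    gcongr
    exact hK y
  have h5 : |gibbsFactor N Φ y - 1| ≤ 2 * (K / N) :=
    (Real.abs_exp_sub_one_le (h4.trans ((div_le_one hN').2 hKN))).trans (by linarith)
  calc ‖f y‖ * |gibbsFactor N Φ y - 1| ≤ K * (2 * (K / N)) :=
        mul_le_mul (hf.bound y) h5 (abs_nonneg _) hf.nonneg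
    _ = _ := by ring

/-- Exponential integral of a mean-zero observable: the first order term is `O(l / N)`. -/
theorem lintegral_exp_signed_le {N : ℕ} {L R K l : ℝ} (hL : 0 < L) (hRL : R < L) (hN : 1 ≤ N)
    {Φ : Space d → ℝ} (hΦ : Continuous Φ) (hK : ∀ y, ‖Φ y‖ ≤ K) (hKN : K ≤ N) {f : Space d → ℝ}
    (hf : IsLipBump R K f) (hf0 : ∫ y, f y = 0) (hl : 0 ≤ l) (hlK : l * K ≤ 1)
    {χ : Space d → ℝ} (hχ : Measurable χ) (hχ0 : ∀ v, 0 ≤ χ v) (hχ1 : ∀ v, χ v ≤ 1) (X : Space d) :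
    ∫⁻ z, ENNReal.ofReal (Real.exp (l * (f (wrap L (X - z.1)) * χ z.2))) * backDensity N L Φ X z
        ∂(phaseMeasure d L) ≤
      ENNReal.ofReal (gibbsVolume N L Φ +
        l * (2 * K ^ 2 * (volume : Measure (Space d)).real (Metric.closedBall 0 R) / N) +
        l ^ 2 * (K ^ 2 * Real.exp K * (volume : Measure (Space d)).real (Metric.closedBall 0 R))) := by
  set ω := (volume : Measure (Space d)).real (Metric.closedBall 0 R)
  have hω : 0 ≤ ω := measureReal_nonneg
  have hK0 := hf.nonneg
  have hκ : 0 ≤ gibbsVolume N L Φ := integral_nonneg fun _ => (Real.exp_pos _).le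
  have hγ := (continuous_gaussianDensity (d := d)).measurable
  have hgm := measurable_gibbsFactor (N := N) hΦ
  have hfm := hf.continuous.measurable
  have hlf : ∀ y, |l * f y| ≤ 1 := fun y => by
    rw [abs_mul, abs_of_nonneg hl]
    exact (mul_le_mul_of_nonneg_left (hf.bound y) hl).trans hlK
  set S := Metric.closedBall (0 : Space d) R
  have hS : MeasurableSet S := Metric.isClosed_closedBall.measurableSet
  -- `exp (l f χ) ≤ (1 - χ) + χ (1 + l f) + (l K)² 1_S`, a sum of products of nonnegative functions
  set f₁ : Space d → ℝ≥0∞ := fun y => ENNReal.ofReal (gibbsFactor N Φ y)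
  set f₂ : Space d → ℝ≥0∞ := fun y => ENNReal.ofReal ((1 + l * f y) * gibbsFactor N Φ y)
  set f₃ : Space d → ℝ≥0∞ := S.indicator fun y => ENNReal.ofReal (l ^ 2 * K ^ 2 * gibbsFactor N Φ y)
  set q₁ : Space d → ℝ≥0∞ := fun v => ENNReal.ofReal ((1 - χ v) * gaussianDensity v)
  set q₂ : Space d → ℝ≥0∞ := fun v => ENNReal.ofReal (χ v * gaussianDensity v)
  set q₃ : Space d → ℝ≥0∞ := fun v => ENNReal.ofReal (gaussianDensity v)
  have hf₁ : Measurable f₁ := hgm.ennreal_ofReal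
  have hf₂ : Measurable f₂ := by
    refine Measurable.ennreal_ofReal (Measurable.mul ?_ hgm)
    fun_prop
  have hf₃ : Measurable f₃ := (hgm.const_mul _).ennreal_ofReal.indicator hS
  have hq₁ : Measurable q₁ := by fun_prop
  have hq₂ : Measurable q₂ := by fun_prop
  have hq₃ : Measurable q₃ := by fun_prop
  have hpt : ∀ z : Phase d, ENNReal.ofReal (Real.exp (l * (f (wrap L (X - z.1)) * χ z.2))) *
      backDensity N L Φ X z ≤ f₁ (wrap L (X - z.1)) * q₁ z.2 + f₂ (wrap L (X - z.1)) * q₂ z.2 +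
        f₃ (wrap L (X - z.1)) * q₃ z.2 := by
    intro z
    set y := wrap L (X - z.1) with hy
    have hg0 := gibbsFactor_pos N Φ y
    have hγ0 := gaussianDensity_pos z.2
    have h1 : 0 ≤ 1 + l * f y := by linarith [neg_le_of_abs_le (hlf y)]
    have e1 : |l * (f y * χ z.2)| ≤ 1 := by
      rw [← mul_assoc, abs_mul, abs_of_nonneg (hχ0 _)]
      exact mul_le_one₀ (hlf y) (hχ0 _) (hχ1 _)
    have e2 := (abs_le.1 (Real.abs_exp_sub_one_sub_id_le e1)).2
    simp only [backDensity, f₁, f₂, f₃, q₁, q₂, q₃]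
    rw [← hy]
    rcases le_or_gt ‖y‖ R with hyR | hyR
    · rw [Set.indicator_of_mem (mem_closedBall_zero_iff.2 hyR)]
      simp only [← ENNReal.ofReal_mul hg0.le, ← ENNReal.ofReal_mul (Real.exp_pos _).le]
      rw [← ENNReal.ofReal_mul (mul_nonneg h1 hg0.le), ← ENNReal.ofReal_mul (by positivity),
        ← ENNReal.ofReal_add (mul_nonneg hg0.le (mul_nonneg (by linarith [hχ1 z.2]) hγ0.le))
          (mul_nonneg (mul_nonneg h1 hg0.le) (mul_nonneg (hχ0 _) hγ0.le)),
        ← ENNReal.ofReal_add (add_nonneg (mul_nonneg hg0.le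
          (mul_nonneg (by linarith [hχ1 z.2]) hγ0.le))
          (mul_nonneg (mul_nonneg h1 hg0.le) (mul_nonneg (hχ0 _) hγ0.le))) (by positivity)]
      apply ENNReal.ofReal_le_ofReal
      have e3 : (l * (f y * χ z.2)) ^ 2 ≤ l ^ 2 * K ^ 2 := by
        rw [← mul_pow]
        refine sq_le_sq' ?_ ?_
        · have : |l * (f y * χ z.2)| ≤ l * K := by
            rw [abs_mul, abs_mul, abs_of_nonneg hl, abs_of_nonneg (hχ0 _)]
            gcongr
            exact (mul_le_of_le_one_right (abs_nonneg _) (hχ1 _)).trans (hf.bound y)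
          exact neg_le_of_abs_le this
        · rw [← mul_assoc]
          refine (le_abs_self _).trans ?_
          rw [abs_mul, abs_mul, abs_of_nonneg hl, abs_of_nonneg (hχ0 _)]
          exact (mul_le_of_le_one_right (by positivity) (hχ1 _)).trans
            (mul_le_mul_of_nonneg_left (hf.bound y) hl)
      have e4 : Real.exp (l * (f y * χ z.2)) ≤ (1 - χ z.2) + (1 + l * f y) * χ z.2 + l ^ 2 * K ^ 2 := by
        linarith
      calc _ ≤ ((1 - χ z.2) + (1 + l * f y) * χ z.2 + l ^ 2 * K ^ 2) *
            (gibbsFactor N Φ y * gaussianDensity z.2) := by gcongr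
        _ = _ := by ring
    · rw [Set.indicator_of_notMem (by simpa [S] using hyR), hf.supp y hyR]
      simp only [zero_mul, mul_zero, Real.exp_zero, ENNReal.ofReal_one, one_mul, add_zero]
      rw [← mul_add, ← ENNReal.ofReal_add (mul_nonneg (by linarith [hχ1 z.2]) hγ0.le)
        (mul_nonneg (hχ0 _) hγ0.le)]
      refine le_of_eq ?_
      congr 2
      ring
  refine (lintegral_mono hpt).trans ?_
  have hm : ∀ {f q : Space d → ℝ≥0∞}, Measurable f → Measurable q →
      Measurable fun z : Phase d => f (wrap L (X - z.1)) * q z.2 := fun hf hq =>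
    (hf.comp ((measurable_wrap L).comp (by fun_prop))).mul (hq.comp measurable_snd)
  have hm12 : Measurable fun z : Phase d =>
      f₁ (wrap L (X - z.1)) * q₁ z.2 + f₂ (wrap L (X - z.1)) * q₂ z.2 :=
    (hm hf₁ hq₁).add (hm hf₂ hq₂)
  rw [lintegral_add_left hm12, lintegral_add_left (hm hf₁ hq₁),
    lintegral_phaseMeasure_mul hL X hf₁ hq₁, lintegral_phaseMeasure_mul hL X hf₂ hq₂,
    lintegral_phaseMeasure_mul hL X hf₃ hq₃]
  have hI₁ : ∫⁻ y in box d L, f₁ y = ENNReal.ofReal (gibbsVolume N L Φ) :=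
    (ofReal_gibbsVolume hN hL hΦ hK).symm
  have hI₂ : ∫⁻ y in box d L, f₂ y ≤ ENNReal.ofReal (gibbsVolume N L Φ + l * (2 * K ^ 2 * ω / N)) := by
    have hi : IntegrableOn (fun y => f y * gibbsFactor N Φ y) (box d L) :=
      integrableOn_box_of_bound hL (hfm.mul hgm) (K := K * Real.exp K) fun y => by
        rw [norm_mul, Real.norm_eq_abs (gibbsFactor N Φ y), abs_of_pos (gibbsFactor_pos N Φ y)]
        exact mul_le_mul (hf.bound y) (gibbsFactor_le hN hK y) (gibbsFactor_pos N Φ y).le hK0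
    have hi₁ := integrableOn_gibbsFactor hN hL hΦ hK
    have e0 : (fun y => (1 + l * f y) * gibbsFactor N Φ y) =
        fun y => gibbsFactor N Φ y + l * (f y * gibbsFactor N Φ y) := by
      ext y; ring
    have hi₂ : IntegrableOn (fun y => (1 + l * f y) * gibbsFactor N Φ y) (box d L) := by
      rw [e0]; exact hi₁.add (hi.const_mul l)
    rw [← ofReal_integral_eq_lintegral_ofReal hi₂ (Filter.Eventually.of_forall fun y => ?_)]
    · apply ENNReal.ofReal_le_ofReal
      rw [e0, integral_add hi₁ (hi.const_mul l), integral_const_mul]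
      refine add_le_add le_rfl (mul_le_mul_of_nonneg_left ?_ hl)
      exact (le_abs_self _).trans (abs_integral_mul_gibbsFactor_le hRL hN hΦ hK hKN hf hf0)
    · have : 0 ≤ (1 + l * f y) * gibbsFactor N Φ y :=
        mul_nonneg (by linarith [neg_le_of_abs_le (hlf y)]) (gibbsFactor_pos N Φ y).le
      exact this
  have hI₃ : ∫⁻ y in box d L, f₃ y ≤ ENNReal.ofReal (l ^ 2 * (K ^ 2 * Real.exp K * ω)) := by
    calc _ ≤ ∫⁻ y, f₃ y := setLIntegral_le_lintegral _ _
      _ ≤ ∫⁻ y, S.indicator (fun _ => ENNReal.ofReal (l ^ 2 * K ^ 2 * Real.exp K)) y := by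
          refine lintegral_mono fun y => Set.indicator_le_indicator (ENNReal.ofReal_le_ofReal ?_)
          exact mul_le_mul_of_nonneg_left (gibbsFactor_le hN hK y) (by positivity)
      _ = _ := by
          rw [lintegral_indicator_const hS,
            ← ENNReal.ofReal_toReal (measure_closedBall_lt_top (x := (0 : Space d)) (r := R)).ne,
            ← ENNReal.ofReal_mul (by positivity)]
          congr 1
          change _ * ω = _
          ring
  have hq12 : (∫⁻ v, q₁ v) + ∫⁻ v, q₂ v = 1 := by
    rw [← lintegral_add_left hq₁, ← lintegral_gaussianDensity (d := d)]
    refine lintegral_congr fun v => ?_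
    simp only [q₁, q₂]
    have hγ0 := gaussianDensity_pos v
    rw [← ENNReal.ofReal_add (mul_nonneg (by linarith [hχ1 v]) hγ0.le) (mul_nonneg (hχ0 _) hγ0.le)]
    congr 1; ring
  have hq3 : ∫⁻ v, q₃ v = 1 := lintegral_gaussianDensity
  have hc : 0 ≤ l * (2 * K ^ 2 * ω / N) := by positivity
  rw [hI₁, hq3, mul_one, ENNReal.ofReal_add (by linarith) (by positivity)]
  refine add_le_add ?_ hI₃
  calc _ ≤ ENNReal.ofReal (gibbsVolume N L Φ + l * (2 * K ^ 2 * ω / N)) * (∫⁻ v, q₁ v) +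
        ENNReal.ofReal (gibbsVolume N L Φ + l * (2 * K ^ 2 * ω / N)) * ∫⁻ v, q₂ v := by
        gcongr
        linarith
    _ = _ := by rw [← mul_add, hq12, mul_one]

/-! ### Regularity of the partial derivatives of the potential -/

theorem isLipBump_apply {n : ℕ} {R K : ℝ}
    {D : Space d → ContinuousMultilinearMap ℝ (fun _ : Fin n => Space d) ℝ} (hD : IsLipBump R K D)
    (I : Fin n → Fin d) :
    IsLipBump R K fun y => D y fun j => EuclideanSpace.single (I j) (1 : ℝ) := by
  have h1 : ∀ A : ContinuousMultilinearMap ℝ (fun _ : Fin n => Space d) ℝ,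
      ‖A fun j => EuclideanSpace.single (I j) (1 : ℝ)‖ ≤ ‖A‖ := fun A => by
    refine (A.le_opNorm _).trans (le_of_eq ?_)
    simp
  refine ⟨fun x y => ?_, fun x => (h1 _).trans (hD.bound x), fun x hx => by simp [hD.supp x hx]⟩
  rw [← sub_apply]
  exact (h1 _).trans (hD.lip x y)

theorem exists_isLipBump_iteratedFDeriv {Φ : Space d → ℝ} (hΦ : ContDiff ℝ 4 Φ)
    (hΦ_lip : ∃ K : NNReal, LipschitzWith K (iteratedFDeriv ℝ 4 Φ)) {R : ℝ}
    (hs : tsupport Φ ⊆ Metric.closedBall 0 R) {n : ℕ} (hn : n ≤ 4) :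
    ∃ K, IsLipBump R K (iteratedFDeriv ℝ n Φ) := by
  have hsn := (tsupport_iteratedFDeriv_subset (𝕜 := ℝ) (f := Φ) n).trans hs
  rcases hn.lt_or_eq with h | rfl
  · refine exists_isLipBump_of_contDiff (hΦ.iteratedFDeriv_right ?_) hsn
    have : 1 + n ≤ 4 := by omega
    exact_mod_cast this
  · obtain ⟨K, hK⟩ := hΦ_lip
    exact exists_isLipBump_of_lipschitz hK hsn

theorem integral_fderiv_apply_eq_zero {g : Space d → ℝ} (hg : ContDiff ℝ 1 g)
    (hc : HasCompactSupport g) (e : Space d) : ∫ y, fderiv ℝ g y e = 0 := by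
  have h1 : Continuous fun y => fderiv ℝ g y e :=
    (hg.continuous_fderiv one_ne_zero).clm_apply continuous_const
  have h2 : HasCompactSupport fun y => fderiv ℝ g y e := hc.fderiv_apply (𝕜 := ℝ) e
  have := integral_mul_fderiv_eq_neg_fderiv_mul_of_integrable (μ := (volume : Measure (Space d)))
    (f := fun _ : Space d => (1 : ℝ)) (g := g) (v := e) (by simp)
    (by simpa using h1.integrable_of_hasCompactSupport h2)
    (by simpa using hg.continuous.integrable_of_hasCompactSupport hc)
    (fun x _ => differentiableAt_const _) (fun x _ => hg.differentiable one_ne_zero x)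
  simpa using this

theorem integral_partialDeriv_eq_zero {Φ : Space d → ℝ} (hΦ : ContDiff ℝ 4 Φ) {R : ℝ}
    (hs : tsupport Φ ⊆ Metric.closedBall 0 R) {n : ℕ} (hn : n < 4) (I : Fin (n + 1) → Fin d) :
    ∫ y, partialDeriv Φ I y = 0 := by
  set D := iteratedFDeriv ℝ n Φ
  have hD : ContDiff ℝ 1 D := hΦ.iteratedFDeriv_right (by
    have : 1 + n ≤ 4 := by omega
    exact_mod_cast this)
  set m : Fin n → Space d := fun j => EuclideanSpace.single (I j.succ) (1 : ℝ)
  set g : Space d → ℝ := fun y => D y m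
  have hg : ContDiff ℝ 1 g :=
    (ContinuousMultilinearMap.apply ℝ (fun _ : Fin n => Space d) ℝ m).contDiff.comp hD
  have hDs : tsupport D ⊆ Metric.closedBall 0 R :=
    (tsupport_iteratedFDeriv_subset (𝕜 := ℝ) (f := Φ) n).trans hs
  have hgc : HasCompactSupport g :=
    (hasCompactSupport_of_tsupport hDs).comp_left
      (g := fun A : ContinuousMultilinearMap ℝ (fun _ : Fin n => Space d) ℝ => A m) rfl
  rw [← integral_fderiv_apply_eq_zero hg hgc (EuclideanSpace.single (I 0) (1 : ℝ))]
  refine integral_congr_ae (Filter.Eventually.of_forall fun y => ?_)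
  simp only [partialDeriv]
  rw [iteratedFDeriv_succ_apply_left]
  have h1 := ((ContinuousMultilinearMap.apply ℝ (fun _ : Fin n => Space d) ℝ m).hasFDerivAt.comp y
    (hD.differentiable one_ne_zero y).hasFDerivAt).fderiv
  have h2 : fderiv ℝ g y = _ := h1
  rw [h2]
  rfl

/-- A common bound for the potential and its derivatives. -/
structure PotentialBounds (R K : ℝ) (Φ : Space d → ℝ) : Prop where
  one_le : 1 ≤ K
  smooth : ContDiff ℝ 2 Φ
  supp : tsupport Φ ⊆ Metric.closedBall 0 R
  bound : ∀ y, ‖Φ y‖ ≤ K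
  grad : IsLipBump R K (gradient Φ)
  partialDeriv : ∀ (n : Fin 4) (I : Fin (n + 1) → Fin d), IsLipBump R K (partialDeriv Φ I)
  integral_eq_zero : ∀ (n : Fin 4) (I : Fin (n + 1) → Fin d), ∫ y, TaggedParticle.partialDeriv Φ I y = 0

theorem exists_potentialBounds {Φ : Space d → ℝ} (hΦ : ContDiff ℝ 4 Φ)
    (hΦ_lip : ∃ K : NNReal, LipschitzWith K (iteratedFDeriv ℝ 4 Φ)) {R : ℝ}
    (hs : tsupport Φ ⊆ Metric.closedBall 0 R) : ∃ K, PotentialBounds R K Φ := by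
  have h2 : ContDiff ℝ 2 Φ := hΦ.of_le (by norm_num)
  obtain ⟨K₁, hK₁⟩ := exists_isLipBump_of_contDiff (hΦ.of_le (by norm_num) : ContDiff ℝ 1 Φ) hs
  obtain ⟨K₂, hK₂⟩ := exists_isLipBump_gradient h2 hs
  have h3 : ∀ n : Fin 4, ∃ K, IsLipBump R K (iteratedFDeriv ℝ (n + 1) Φ) := fun n =>
    exists_isLipBump_iteratedFDeriv hΦ hΦ_lip hs (by omega)
  choose K₃ hK₃ using h3
  have hle : ∀ n, K₃ n ≤ ∑ n, K₃ n := fun n =>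
    Finset.single_le_sum (fun n _ => (hK₃ n).nonneg) (Finset.mem_univ n)
  have hn₁ := hK₁.nonneg
  have hn₂ := hK₂.nonneg
  have hn₃ : 0 ≤ ∑ n, K₃ n := Finset.sum_nonneg fun n _ => (hK₃ n).nonneg
  refine ⟨1 + K₁ + K₂ + ∑ n, K₃ n, by linarith, h2, hs, fun y => (hK₁.bound y).trans (by linarith),
    hK₂.mono (by linarith), fun n I => ?_, fun n I => integral_partialDeriv_eq_zero hΦ hs n.2 I⟩
  exact (isLipBump_apply (hK₃ n) I).mono (by linarith [hle n])

/-! ### Norms of the gradient and of the Hessian in coordinates -/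

theorem partialDeriv_one {Φ : Space d → ℝ} (i : Fin d) (y : Space d) :
    partialDeriv Φ (fun _ : Fin (0 + 1) => i) y = gradient Φ y i := by
  rw [partialDeriv, iteratedFDeriv_succ_apply_left]
  have h : gradient Φ y i = fderiv ℝ Φ y (EuclideanSpace.single i 1) := by
    rw [← inner_gradient_left, EuclideanSpace.inner_single_right]
    simp
  rw [h]
  have := iteratedFDeriv_one_apply (𝕜 := ℝ) (f := Φ) (x := y)
    (fun _ => EuclideanSpace.single i (1 : ℝ))
  rw [← this, iteratedFDeriv_succ_apply_left]

theorem partialDeriv_two {Φ : Space d → ℝ} (hΦ : ContDiff ℝ 2 Φ) (i j : Fin d) (y : Space d) :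
    partialDeriv Φ (![i, j] : Fin (1 + 1) → Fin d) y =
      fderiv ℝ (gradient Φ) y (EuclideanSpace.single i 1) j := by
  have h0 := (hΦ.fderiv_right (m := 1) (by norm_num)).differentiable one_ne_zero y
  have h1 : fderiv ℝ (gradient Φ) y (EuclideanSpace.single i 1) =
      (InnerProductSpace.toDual ℝ (Space d)).symm
        (fderiv ℝ (fderiv ℝ Φ) y (EuclideanSpace.single i 1)) := by
    have := ((InnerProductSpace.toDual ℝ (Space d)).symm.toContinuousLinearEquiv.hasFDerivAt.comp y
      h0.hasFDerivAt).fderiv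
    have h2 : fderiv ℝ (gradient Φ) y = _ := this
    rw [h2]
    rfl
  have h3 : ∀ w : Space d, w j = inner ℝ w (EuclideanSpace.single j (1 : ℝ)) := fun w => by
    rw [EuclideanSpace.inner_single_right]; simp
  rw [h3, h1, InnerProductSpace.toDual_symm_apply, partialDeriv]
  have := iteratedFDeriv_two_apply (𝕜 := ℝ) Φ y fun k : Fin 2 =>
    EuclideanSpace.single ((![i, j] : Fin 2 → Fin d) k) (1 : ℝ)
  simpa using this

theorem norm_sq_le_of_coord {w : Space d} {a : ℝ} (h : ∀ i, |w i| ≤ a) : ‖w‖ ^ 2 ≤ d * a ^ 2 := by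
  rw [EuclideanSpace.norm_sq_eq]
  refine (Finset.sum_le_card_nsmul _ _ (a ^ 2) fun i _ => ?_).trans (by simp)
  rw [Real.norm_eq_abs]
  exact pow_le_pow_left₀ (abs_nonneg _) (h i) 2

theorem opNorm_le_of_coord {A : Space d →L[ℝ] Space d} {a : ℝ} (ha : 0 ≤ a)
    (h : ∀ i j, |A (EuclideanSpace.single i 1) j| ≤ a) : ‖A‖ ≤ d ^ 2 * a := by
  have hA : ∀ i, ‖A (EuclideanSpace.single i 1)‖ ≤ d * a := fun i => by
    refine abs_le_of_sq_le_sq' ?_ (by positivity) |>.2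
    refine (norm_sq_le_of_coord (h i)).trans ?_
    rw [mul_pow]
    gcongr
    rcases Nat.eq_zero_or_pos d with rfl | hd
    · simp
    · have : (1 : ℝ) ≤ d := by exact_mod_cast hd
      nlinarith
  refine A.opNorm_le_bound (by positivity) fun w => ?_
  have hw : w = ∑ i, w i • EuclideanSpace.single i (1 : ℝ) := by
    have := (EuclideanSpace.basisFun (Fin d) ℝ).sum_repr w
    simpa using this.symm
  have e1 : A w = ∑ i, w i • A (EuclideanSpace.single i (1 : ℝ)) := by
    conv_lhs => rw [hw]
    simp
  rw [e1]
  refine (norm_sum_le_of_le _ fun i _ => (?_ : _ ≤ ‖w‖ * (d * a))).trans (le_of_eq ?_)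
  · rw [norm_smul]
    exact mul_le_mul (PiLp.norm_apply_le w i) (hA i) (norm_nonneg _) (norm_nonneg _)
  · simp
    ring

/-! ### Continuous controls at a fixed time -/

/-- The point of `[0, 1]` closest to `t`. -/
def clamp (t : ℝ) : ℝ := max 0 (min 1 t)

theorem clamp_nonneg (t : ℝ) : 0 ≤ clamp t := le_max_left _ _

theorem clamp_le_one (t : ℝ) : clamp t ≤ 1 := max_le zero_le_one (min_le_left _ _)

theorem clamp_of_one_le {t : ℝ} (h : 1 ≤ t) : clamp t = 1 := by
  rw [clamp, min_eq_left h, max_eq_right zero_le_one]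

theorem clamp_of_nonpos {t : ℝ} (h : t ≤ 0) : clamp t = 0 := by
  rw [clamp, min_eq_right (h.trans zero_le_one), max_eq_left h]

theorem continuous_clamp : Continuous clamp := by unfold clamp; fun_prop

/-- A cutoff equal to `1` at distance at most `R + 1` on the torus, and to `0` beyond `R + 2`. -/
def nearCutoff (L R : ℝ) (y : Space d) : ℝ := clamp (R + 2 - ‖wrap L y‖)

/-- A continuous approximation, on the scale `ε`, of the indicator of `r ≥ m`. -/
def rampCutoff (m ε r : ℝ) : ℝ := clamp ((r - m) / ε)

/-- A cutoff equal to `1` for `|r - m| ≤ 2 ε`, and to `0` for `|r - m| ≥ 3 ε`. -/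
def shellCutoff (m ε r : ℝ) : ℝ := clamp (3 - |r - m| / ε)

/-- Controls on positions and velocities by continuous functions on the torus, in a form that
Chernoff's bound applies to and strong enough to persist for a short time. -/
structure StaticControls (N : ℕ) (L R : ℝ) (Φ : Space d → ℝ) (δ m ε P C₁ a : ℝ) {M : ℕ}
    (Z : Phase d) (b : Fin M → Phase d) : Prop where
  tagged : 1 / 4 * ‖Z.2‖ ^ 2 ≤ (N : ℝ) / 16
  few : ∑ _i : Fin M, (1 : ℝ) ≤ P
  many : ∑ _i : Fin M, (-1 : ℝ) ≤ -(3 / 2)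
  back : ∑ i, max (0 : ℝ) ((‖(b i).2‖ ^ 2 - N / 8) / 8) ≤ N / 64
  near : ∑ i, nearCutoff L R (Z.1 - (b i).1) ≤ C₁ * N
  time : ∑ i, nearCutoff L R (Z.1 - (b i).1) * cubedTime N ((b i).2 - Z.2) / (N : ℝ) ≤ (N : ℝ) ^ δ
  shell : ∑ i, nearCutoff L R (Z.1 - (b i).1) * shellCutoff m ε ‖(b i).2 - Z.2‖ ≤ Real.sqrt N
  deriv : ∀ (n : Fin 4) (I : Fin (n + 1) → Fin d),
    |1 / Real.sqrt N * ∑ i, partialDeriv Φ I (wrap L (Z.1 - (b i).1))| ≤ a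
  drift : ∀ (n : Fin 4) (I : Fin (n + 1) → Fin d),
    |1 / Real.sqrt N * ∑ i, partialDeriv Φ I (wrap L (Z.1 - (b i).1)) *
      rampCutoff m ε ‖(b i).2 - Z.2‖| ≤ a

theorem cutInterTime_eq {N : ℕ} (hN : 1 ≤ N) (v V : Space d) :
    cutInterTime N v V = (max ‖v - V‖ ((N : ℝ) ^ (-(1 / 3) : ℝ)))⁻¹ := by
  have hN' : (0 : ℝ) < N := by exact_mod_cast hN
  have h0 : 0 < (N : ℝ) ^ (-(1 / 3) : ℝ) := by positivity
  have h1 : ENNReal.ofReal ((N : ℝ) ^ (1 / 3 : ℝ)) =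
      (ENNReal.ofReal ((N : ℝ) ^ (-(1 / 3) : ℝ)))⁻¹ := by
    rw [← ENNReal.ofReal_inv_of_pos h0, Real.rpow_neg hN'.le, inv_inv]
  have h2 : min (ENNReal.ofReal ‖v - V‖)⁻¹ (ENNReal.ofReal ((N : ℝ) ^ (-(1 / 3) : ℝ)))⁻¹ =
      (ENNReal.ofReal (max ‖v - V‖ ((N : ℝ) ^ (-(1 / 3) : ℝ))))⁻¹ := by
    rcases le_total ‖v - V‖ ((N : ℝ) ^ (-(1 / 3) : ℝ)) with h | h
    · rw [max_eq_right h, min_eq_right (ENNReal.inv_le_inv.2 (ENNReal.ofReal_le_ofReal h))]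
    · rw [max_eq_left h, min_eq_left (ENNReal.inv_le_inv.2 (ENNReal.ofReal_le_ofReal h))]
  rw [cutInterTime, interTime, h1, h2, ← ENNReal.ofReal_inv_of_pos (lt_max_of_lt_right h0),
    ENNReal.toReal_ofReal (by positivity)]

theorem cutInterTime_pow_three {N : ℕ} (hN : 1 ≤ N) (v V : Space d) :
    cutInterTime N v V ^ 3 = cubedTime N (v - V) := by
  rw [cutInterTime_eq hN, cubedTime]

theorem cutInterTime_nonneg (N : ℕ) (v V : Space d) : 0 ≤ cutInterTime N v V :=
  ENNReal.toReal_nonneg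

theorem cutInterTime_le {N : ℕ} (hN : 1 ≤ N) (v V : Space d) :
    cutInterTime N v V ≤ (N : ℝ) ^ (1 / 3 : ℝ) := by
  have hN' : (0 : ℝ) < N := by exact_mod_cast hN
  rw [cutInterTime_eq hN]
  calc _ ≤ ((N : ℝ) ^ (-(1 / 3) : ℝ))⁻¹ := by gcongr; exact le_max_right _ _
    _ = _ := by rw [Real.rpow_neg hN'.le, inv_inv]

/-- Changing the relative velocity by at most `N ^ (-1/3)` at most doubles the interaction time. -/
theorem cubedTime_le_mul {N : ℕ} (hN : 1 ≤ N) {w w' : Space d}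
    (h : ‖w' - w‖ ≤ (N : ℝ) ^ (-(1 / 3) : ℝ)) : cubedTime N w' ≤ 8 * cubedTime N w := by
  have hN' : (0 : ℝ) < N := by exact_mod_cast hN
  have h0 : 0 < (N : ℝ) ^ (-(1 / 3) : ℝ) := by positivity
  set s := (N : ℝ) ^ (-(1 / 3) : ℝ)
  have h1 : max ‖w‖ s ≤ 2 * max ‖w'‖ s := by
    have h2 := norm_le_norm_add_norm_sub' w w'
    rw [norm_sub_rev] at h2
    refine max_le ?_ ?_
    · linarith [le_max_left ‖w'‖ s, le_max_right ‖w'‖ s]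
    · linarith [le_max_right ‖w'‖ s]
  have h3 : 0 < max ‖w‖ s := lt_max_of_lt_right h0
  unfold cubedTime
  calc (max ‖w'‖ s)⁻¹ ^ 3 ≤ (2 * (max ‖w‖ s)⁻¹) ^ 3 := by
        gcongr
        rw [inv_le_comm₀ (by positivity) (by positivity), mul_inv, inv_inv]
        linarith
    _ = _ := by ring

/-- For powers `k ≤ 3` and `k > 3`, the truncated interaction time is controlled by its cube. -/
theorem cutInterTime_pow_le {N : ℕ} (hN : 1 ≤ N) (v V : Space d) (k : ℕ) :
    cutInterTime N v V ^ k ≤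
      if k ≤ 3 then 1 + cubedTime N (v - V) else
        (N : ℝ) ^ (((k : ℝ) - 3) / 3) * cubedTime N (v - V) := by
  have hN' : (0 : ℝ) < N := by exact_mod_cast hN
  have hc := cutInterTime_nonneg N v V
  rw [← cutInterTime_pow_three hN]
  set c := cutInterTime N v V with hcdef
  split_ifs with hk
  · rcases le_or_gt c 1 with h | h
    · have := pow_le_one₀ hc h (n := k)
      have := pow_nonneg hc 3
      linarith
    · have := pow_le_pow_right₀ h.le hk
      linarith
  · have e1 : c ^ k = c ^ (k - 3) * c ^ 3 := by rw [← pow_add]; congr 1; omega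
    rw [e1]
    gcongr
    calc c ^ (k - 3) ≤ ((N : ℝ) ^ (1 / 3 : ℝ)) ^ (k - 3) := by
          gcongr
          exact cutInterTime_le hN v V
      _ = _ := by
          rw [← Real.rpow_natCast, ← Real.rpow_mul hN'.le, Nat.cast_sub (by omega)]
          congr 1
          push_cast
          ring

theorem abs_indicator_sub_rampCutoff_le {m ε r r' : ℝ} (hε : 0 < ε) (h : |r' - r| ≤ ε) :
    |(if m ≤ r' then (1 : ℝ) else 0) - rampCutoff m ε r| ≤ shellCutoff m ε r := by
  rw [abs_le] at h
  unfold rampCutoff shellCutoff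
  rcases le_or_gt |r - m| (2 * ε) with h1 | h1
  · have h2 : 1 ≤ 3 - |r - m| / ε := by
      have : |r - m| / ε ≤ 2 := by rw [div_le_iff₀ hε]; exact h1
      linarith
    rw [clamp_of_one_le h2, abs_le]
    have := clamp_nonneg ((r - m) / ε)
    have := clamp_le_one ((r - m) / ε)
    split_ifs <;> constructor <;> linarith
  · refine le_trans (le_of_eq ?_) (clamp_nonneg _)
    rcases lt_abs.1 h1 with h2 | h2
    · rw [if_pos (by linarith), clamp_of_one_le (by rw [le_div_iff₀ hε]; linarith), sub_self, abs_zero]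
    · rw [if_neg (by linarith), clamp_of_nonpos (div_nonpos_of_nonpos_of_nonneg (by linarith) hε.le),
        sub_self, abs_zero]

namespace StaticControls

variable {N : ℕ} {L R : ℝ} {Φ : Space d → ℝ} {δ m ε P C₁ a : ℝ} {M : ℕ} {Z : Phase d}
  {b : Fin M → Phase d}

theorem one_lt (h : StaticControls N L R Φ δ m ε P C₁ a Z b) : 1 < M := by
  have h1 := h.many
  simp only [Finset.sum_const, Finset.card_univ, Fintype.card_fin, nsmul_eq_mul] at h1
  have : (1 : ℝ) < M := by linarith
  exact_mod_cast this

theorem card_le (h : StaticControls N L R Φ δ m ε P C₁ a Z b) : (M : ℝ) ≤ P := by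
  simpa using h.few

theorem norm_tagged_le (h : StaticControls N L R Φ δ m ε P C₁ a Z b) :
    ‖Z.2‖ ≤ Real.sqrt N / 2 := by
  have h1 := h.tagged
  have h2 := Real.sq_sqrt (Nat.cast_nonneg (α := ℝ) N)
  refine abs_le_of_sq_le_sq' ?_ (by positivity) |>.2
  nlinarith

theorem norm_back_le (h : StaticControls N L R Φ δ m ε P C₁ a Z b) (i : Fin M) :
    ‖(b i).2‖ ≤ Real.sqrt N / 2 := by
  have h1 := Finset.single_le_sum (f := fun i => max (0 : ℝ) ((‖(b i).2‖ ^ 2 - (N : ℝ) / 8) / 8))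
    (fun i _ => le_max_left _ _) (Finset.mem_univ i)
  have h2 := (le_max_right _ _).trans (h1.trans h.back)
  have h3 := Real.sq_sqrt (Nat.cast_nonneg (α := ℝ) N)
  refine abs_le_of_sq_le_sq' ?_ (by positivity) |>.2
  nlinarith

/-- Weighted sums of derivatives of the potential change by at most `1` under small
displacements. -/
theorem abs_sum_mul_sub_le {K : ℝ} (h : StaticControls N L R Φ δ m ε P C₁ a Z b)
    (hK : PotentialBounds R K Φ) (hR : 0 ≤ R) (hL : R + 1 ≤ L) (hε : 0 ≤ ε)
    (hεP : P * (3 * K * ε) ≤ 1) {X' : Space d} {x' : Fin M → Space d}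
    (hrel : ∀ i, ‖(X' - x' i) - (Z.1 - (b i).1)‖ ≤ ε) {c : Fin M → ℝ} (hc : ∀ i, |c i| ≤ 1)
    (n : Fin 4) (I : Fin (n + 1) → Fin d) :
    |∑ i, c i * (partialDeriv Φ I (wrap L (X' - x' i)) -
      partialDeriv Φ I (wrap L (Z.1 - (b i).1)))| ≤ 1 := by
  have hK0 : 0 ≤ K := hK.grad.nonneg
  have h1 : ∀ i, |c i * (partialDeriv Φ I (wrap L (X' - x' i)) -
      partialDeriv Φ I (wrap L (Z.1 - (b i).1)))| ≤ 3 * K * ε := fun i => by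
    rw [abs_mul]
    refine (mul_le_of_le_one_left (abs_nonneg _) (hc i)).trans ?_
    refine ((hK.partialDeriv n I).norm_wrap_sub_le hR hL _ _).trans ?_
    exact mul_le_mul_of_nonneg_left (hrel i) (by positivity)
  refine (Finset.abs_sum_le_sum_abs _ _).trans ?_
  refine (Finset.sum_le_card_nsmul _ _ _ fun i _ => h1 i).trans ?_
  simp only [Finset.card_univ, Fintype.card_fin, nsmul_eq_mul]
  exact le_trans (mul_le_mul_of_nonneg_right h.card_le (by positivity)) hεP

theorem abs_deriv_le {K : ℝ} (h : StaticControls N L R Φ δ m ε P C₁ a Z b)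
    (hK : PotentialBounds R K Φ) (hR : 0 ≤ R) (hL : R + 1 ≤ L) (hN : 1 ≤ N) (hε : 0 ≤ ε)
    (hεP : P * (3 * K * ε) ≤ 1) (ha1 : 1 ≤ a) {X' : Space d} {x' : Fin M → Space d}
    (hrel : ∀ i, ‖(X' - x' i) - (Z.1 - (b i).1)‖ ≤ ε) (n : Fin 4) (I : Fin (n + 1) → Fin d) :
    |1 / Real.sqrt N * ∑ i, partialDeriv Φ I (wrap L (X' - x' i))| ≤ 2 * a := by
  have hs : 1 ≤ Real.sqrt N := Real.one_le_sqrt.2 (by exact_mod_cast hN)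
  have hs0 : 0 < Real.sqrt N := by linarith
  have e1 : 1 / Real.sqrt N * ∑ i, partialDeriv Φ I (wrap L (X' - x' i)) =
      1 / Real.sqrt N * ∑ i, partialDeriv Φ I (wrap L (Z.1 - (b i).1)) +
      1 / Real.sqrt N * ∑ i, 1 * (partialDeriv Φ I (wrap L (X' - x' i)) -
        partialDeriv Φ I (wrap L (Z.1 - (b i).1))) := by
    simp only [one_mul, Finset.sum_sub_distrib]
    ring
  rw [e1]
  refine (abs_add_le _ _).trans ?_
  have e2 := h.abs_sum_mul_sub_le hK hR hL hε hεP hrel (c := fun _ => 1) (fun _ => by simp) n I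
  have e3 : |1 / Real.sqrt N * ∑ i, 1 * (partialDeriv Φ I (wrap L (X' - x' i)) -
        partialDeriv Φ I (wrap L (Z.1 - (b i).1)))| ≤ 1 := by
    rw [abs_mul, abs_of_pos (by positivity)]
    exact mul_le_one₀ (by rw [div_le_one hs0]; exact hs) (abs_nonneg _) e2
  linarith [h.deriv n I]

/-- The drift due to the particles of relative velocity at least `m`: the sharp cutoff is compared
to the smooth one, at the cost of the particles whose relative velocity is close to `m`. -/
theorem abs_drift_le {K : ℝ} (h : StaticControls N L R Φ δ m ε P C₁ a Z b)
    (hK : PotentialBounds R K Φ) (hR : 0 ≤ R) (hL : R + 1 ≤ L) (hN : 1 ≤ N) (hε : 0 < ε)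
    (hεP : P * (3 * K * ε) ≤ 1) {X' V' : Space d} {x' v' : Fin M → Space d}
    (hrel : ∀ i, ‖(X' - x' i) - (Z.1 - (b i).1)‖ ≤ ε)
    (hrelv : ∀ i, ‖(v' i - V') - ((b i).2 - Z.2)‖ ≤ ε) (n : Fin 4) (I : Fin (n + 1) → Fin d) :
    |∑ i, (if m ≤ ‖v' i - V'‖ then 1 else 0) * partialDeriv Φ I (wrap L (X' - x' i))| ≤
      1 + Real.sqrt N * a + Real.sqrt N * K := by
  have hK0 : 0 ≤ K := hK.grad.nonneg
  have hs0 : 0 < Real.sqrt N := Real.sqrt_pos.2 (by exact_mod_cast hN)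
  have hdr := h.drift n I
  have hb := hK.partialDeriv n I
  have e1 : ∑ i, (if m ≤ ‖v' i - V'‖ then 1 else 0) * partialDeriv Φ I (wrap L (X' - x' i)) =
      ∑ i, (if m ≤ ‖v' i - V'‖ then 1 else 0) * (partialDeriv Φ I (wrap L (X' - x' i)) -
        partialDeriv Φ I (wrap L (Z.1 - (b i).1))) +
      ∑ i, partialDeriv Φ I (wrap L (Z.1 - (b i).1)) * rampCutoff m ε ‖(b i).2 - Z.2‖ +
      ∑ i, ((if m ≤ ‖v' i - V'‖ then 1 else 0) - rampCutoff m ε ‖(b i).2 - Z.2‖) *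
        partialDeriv Φ I (wrap L (Z.1 - (b i).1)) := by
    simp only [← Finset.sum_add_distrib]
    exact Finset.sum_congr rfl fun i _ => by ring
  have h1 := h.abs_sum_mul_sub_le hK hR hL hε.le hεP hrel
    (c := fun i => if m ≤ ‖v' i - V'‖ then (1 : ℝ) else 0)
    (fun i => by beta_reduce; split_ifs <;> simp) n I
  have h2 : |∑ i, partialDeriv Φ I (wrap L (Z.1 - (b i).1)) *
      rampCutoff m ε ‖(b i).2 - Z.2‖| ≤ Real.sqrt N * a := by
    rw [abs_mul, abs_of_pos (by positivity), one_div, inv_mul_le_iff₀ hs0] at hdr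
    exact hdr
  have h3 : |∑ i, ((if m ≤ ‖v' i - V'‖ then (1 : ℝ) else 0) -
      rampCutoff m ε ‖(b i).2 - Z.2‖) * partialDeriv Φ I (wrap L (Z.1 - (b i).1))| ≤
      Real.sqrt N * K := by
    refine (Finset.abs_sum_le_sum_abs _ _).trans (le_trans (Finset.sum_le_sum fun i _ => ?_)
      ((Finset.sum_mul _ _ _).symm.le.trans (mul_le_mul_of_nonneg_right h.shell hK0)))
    have hcut : 0 ≤ nearCutoff L R (Z.1 - (b i).1) := clamp_nonneg _
    rw [abs_mul]
    rcases le_or_gt ‖wrap L (Z.1 - (b i).1)‖ R with hy | hy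
    · have e2 : nearCutoff L R (Z.1 - (b i).1) = 1 := clamp_of_one_le (by linarith)
      rw [e2, one_mul]
      exact mul_le_mul (abs_indicator_sub_rampCutoff_le hε
        ((abs_norm_sub_norm_le _ _).trans (hrelv i))) (hb.bound _) (abs_nonneg _) (clamp_nonneg _)
    · rw [hb.supp _ hy, abs_zero, mul_zero]
      exact mul_nonneg (mul_nonneg hcut (clamp_nonneg _)) hK0
  rw [e1]
  exact (abs_add_three _ _ _).trans (by linarith)

/-- The controls at a given time imply those of the good set at all nearby configurations. -/
theorem controls {K : ℝ} (h : StaticControls N L R Φ δ (min m (2 * Real.sqrt N)) ε P C₁ a Z b)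
    (hK : PotentialBounds R K Φ) (hR : 0 ≤ R) (hL : R + 1 ≤ L) (hN : 4 ≤ N) (hδ : 0 ≤ δ)
    (hε : 0 < ε) (hε1 : ε ≤ (N : ℝ) ^ (-(1 / 3) : ℝ)) (hεP : P * (3 * K * ε) ≤ 1)
    (ha1 : 1 ≤ a) (ha : 2 * d ^ 2 * a ≤ (N : ℝ) ^ (δ / 2)) (hd : 1 ≤ d) (hC₁ : 0 ≤ C₁)
    {X' V' : Space d} {x' v' : Fin M → Space d} (hX : ‖X' - Z.1‖ ≤ ε / 2) (hV : ‖V' - Z.2‖ ≤ ε / 2)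
    (hx : ∀ i, ‖x' i - (b i).1‖ ≤ ε / 2) (hv : ∀ i, ‖v' i - (b i).2‖ ≤ ε / 2) :
    Controls N L R Φ δ m C₁ (C₁ + 8) (K + 2) X' V' x' v' := by
  have hN1 : 1 ≤ N := by omega
  have hN' : (4 : ℝ) ≤ N := by exact_mod_cast hN
  have hN0 : (0 : ℝ) < N := by linarith
  have hL0 : 0 < L := by linarith
  have hK0 : 0 ≤ K := hK.grad.nonneg
  have hd' : (1 : ℝ) ≤ d := by exact_mod_cast hd
  have hs2 : 2 ≤ Real.sqrt N := by
    rw [show (2 : ℝ) = Real.sqrt 4 by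
      rw [show (4 : ℝ) = 2 ^ 2 by norm_num]; exact (Real.sqrt_sq (by norm_num)).symm]
    exact Real.sqrt_le_sqrt hN'
  have hs0 : 0 < Real.sqrt N := by linarith
  have hε2 : ε ≤ 1 := hε1.trans (Real.rpow_le_one_of_one_le_of_nonpos (by linarith) (by norm_num))
  have hsq : Real.sqrt N * Real.sqrt N = N := Real.mul_self_sqrt hN0.le
  have hV' : ‖V'‖ < Real.sqrt N := by
    have := norm_le_norm_add_norm_sub' V' Z.2
    linarith [h.norm_tagged_le]
  have hv' : ∀ i, ‖v' i‖ < Real.sqrt N := fun i => by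
    have := norm_le_norm_add_norm_sub' (v' i) (b i).2
    linarith [h.norm_back_le i, hv i]
  have hrel : ∀ i, ‖(X' - x' i) - (Z.1 - (b i).1)‖ ≤ ε := fun i => by
    have : (X' - x' i) - (Z.1 - (b i).1) = (X' - Z.1) - (x' i - (b i).1) := by abel
    rw [this]
    exact (norm_sub_le _ _).trans (by linarith [hx i])
  have hrelv : ∀ i, ‖(v' i - V') - ((b i).2 - Z.2)‖ ≤ ε := fun i => by
    have : (v' i - V') - ((b i).2 - Z.2) = (v' i - (b i).2) - (V' - Z.2) := by abel
    rw [this]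
    exact (norm_sub_le _ _).trans (by linarith [hv i])
  have hnear : ∀ i, ‖wrap L (x' i - X')‖ ≤ R → nearCutoff L R (Z.1 - (b i).1) = 1 := fun i hi => by
    refine clamp_of_one_le ?_
    rw [norm_wrap_sub_comm hL0] at hi
    have := norm_wrap_le_add hL0 (X' - x' i) (Z.1 - (b i).1)
    rw [norm_sub_rev] at this
    linarith [hrel i]
  have hcut0 : ∀ i, 0 ≤ nearCutoff L R (Z.1 - (b i).1) := fun i => clamp_nonneg _
  have hderiv := h.abs_deriv_le hK hR hL hN1 hε.le hεP ha1 hrel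
  have hpow : (N : ℝ) ^ δ = ((N : ℝ) ^ (δ / 2)) ^ 2 := by
    rw [← Real.rpow_natCast, ← Real.rpow_mul hN0.le]; congr 1; push_cast; ring
  have hd2 : (d : ℝ) ≤ d ^ 2 := le_self_pow₀ hd' two_ne_zero
  have hda : a ≤ d ^ 2 * a := le_mul_of_one_le_left (by linarith) (hd'.trans hd2)
  have haN : a ≤ (N : ℝ) ^ (δ / 2) := by linarith
  have hTime : ∑ i, nearCutoff L R (Z.1 - (b i).1) * cubedTime N ((b i).2 - Z.2) ≤
      (N : ℝ) ^ (1 + δ) := by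
    have h1 := h.time
    rw [← Finset.sum_div, div_le_iff₀ hN0] at h1
    refine h1.trans (le_of_eq ?_)
    rw [Real.rpow_add hN0, Real.rpow_one, mul_comm]
  -- All the time moments are bounded by means of the cubes of the interaction times.
  have hcube : ∀ i, (if ‖wrap L (x' i - X')‖ ≤ R then cubedTime N (v' i - V') else 0) ≤
      8 * (nearCutoff L R (Z.1 - (b i).1) * cubedTime N ((b i).2 - Z.2)) := fun i => by
    split_ifs with hi
    · rw [hnear i hi, one_mul]
      exact cubedTime_le_mul hN1 ((hrelv i).trans hε1)
    · exact mul_nonneg (by norm_num) (mul_nonneg (hcut0 i) (cubedTime_nonneg _ _))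
  have hcubes : ∑ i, (if ‖wrap L (x' i - X')‖ ≤ R then cubedTime N (v' i - V') else 0) ≤
      8 * (N : ℝ) ^ (1 + δ) :=
    (Finset.sum_le_sum fun i _ => hcube i).trans (by rw [← Finset.mul_sum]; gcongr)
  have hcount : (∑ i, if ‖wrap L (x' i - X')‖ ≤ R then (1 : ℝ) else 0) ≤ C₁ * N := by
    refine le_trans (Finset.sum_le_sum fun i _ => ?_) h.near
    split_ifs with hi
    · rw [hnear i hi]
    · exact hcut0 i
  refine ⟨⟨?_, fun i => ?_⟩, hcount, ?_, ?_, ?_, ?_, ?_⟩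
  · rw [← Real.sqrt_eq_rpow]; exact hV'
  · rw [← Real.sqrt_eq_rpow]; exact hv' i
  · intro n hn1 hn4 I
    obtain ⟨n, rfl⟩ : ∃ k, n = k + 1 := ⟨n - 1, by omega⟩
    rw [hpow]
    refine pow_le_pow_left₀ (abs_nonneg _) ((hderiv ⟨n, by omega⟩ I).trans (le_trans ?_ ha)) 2
    linarith
  · have h1 : ∀ i, |((1 / Real.sqrt N) • ∑ k, gradient Φ (wrap L (X' - x' k))) i| ≤ 2 * a := by
      intro i
      have := hderiv 0 (fun _ => i)
      simp only [Fin.val_zero, partialDeriv_one] at this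
      simpa using this
    refine (norm_sq_le_of_coord h1).trans ?_
    rw [hpow]
    calc (d : ℝ) * (2 * a) ^ 2 ≤ (d ^ 2) ^ 2 * (2 * a) ^ 2 := by
          gcongr
          exact hd2.trans (le_self_pow₀ (hd'.trans hd2) two_ne_zero)
      _ = (2 * d ^ 2 * a) ^ 2 := by ring
      _ ≤ _ := by gcongr
  · rw [hpow]
    refine pow_le_pow_left₀ (norm_nonneg _) (le_trans (opNorm_le_of_coord (a := 2 * a) (by linarith)
      fun i j => ?_) (le_trans (le_of_eq ?_) ha)) 2
    · have := hderiv 1 ![i, j]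
      simp only [Fin.val_one] at this
      have e : ∀ y, partialDeriv Φ (![i, j] : Fin (1 + 1) → Fin d) y = _ :=
        partialDeriv_two hK.smooth i j
      simp only [e] at this
      simpa [sum_apply] using this
    · ring
  · intro k hk1 hk6
    have h1 : ∀ i, (if ‖wrap L (x' i - X')‖ ≤ R then cutInterTime N (v' i) V' ^ k else 0) ≤
        if k ≤ 3 then (if ‖wrap L (x' i - X')‖ ≤ R then (1 : ℝ) else 0) +
          (if ‖wrap L (x' i - X')‖ ≤ R then cubedTime N (v' i - V') else 0)
        else (N : ℝ) ^ (((k : ℝ) - 3) / 3) *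
          (if ‖wrap L (x' i - X')‖ ≤ R then cubedTime N (v' i - V') else 0) := fun i => by
      have h2 := cutInterTime_pow_le hN1 (v' i) V' k
      split_ifs at h2 ⊢ <;> simp_all
    refine (Finset.sum_le_sum fun i _ => h1 i).trans ?_
    split_ifs with hk
    · rw [Finset.sum_add_distrib]
      have h2 : (N : ℝ) ≤ (N : ℝ) ^ (1 + δ) := by
        conv_lhs => rw [← Real.rpow_one (N : ℝ)]
        exact Real.rpow_le_rpow_of_exponent_le (by linarith) (by linarith)
      have : C₁ * N ≤ C₁ * (N : ℝ) ^ (1 + δ) := by gcongr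
      linarith
    · rw [← Finset.mul_sum]
      have e1 : (N : ℝ) ^ ((k : ℝ) / 3 + δ) = (N : ℝ) ^ (((k : ℝ) - 3) / 3) * (N : ℝ) ^ (1 + δ) := by
        rw [← Real.rpow_add hN0]; congr 1; ring
      rw [e1]
      have h3 : 0 ≤ (N : ℝ) ^ (((k : ℝ) - 3) / 3) := by positivity
      have h4 : 0 ≤ (N : ℝ) ^ (1 + δ) := by positivity
      calc _ ≤ (N : ℝ) ^ (((k : ℝ) - 3) / 3) * (8 * (N : ℝ) ^ (1 + δ)) := by gcongr
        _ ≤ _ := by linarith [mul_nonneg hC₁ (mul_nonneg h3 h4)]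
  · intro n hn1 hn4 I
    obtain ⟨n, rfl⟩ : ∃ k, n = k + 1 := ⟨n - 1, by omega⟩
    set m' := min m (2 * Real.sqrt N)
    -- Relative velocities are below `2 √N`, so that `m` may be replaced by `m'`.
    have hind : ∀ i, (if m ≤ ‖v' i - V'‖ then partialDeriv Φ I (wrap L (X' - x' i)) else 0) =
        (if m' ≤ ‖v' i - V'‖ then 1 else 0) * partialDeriv Φ I (wrap L (X' - x' i)) := fun i => by
      have h1 : ‖v' i - V'‖ < 2 * Real.sqrt N :=
        (norm_sub_le _ _).trans_lt (by linarith [hv' i])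
      have h2 : m' ≤ ‖v' i - V'‖ ↔ m ≤ ‖v' i - V'‖ := by
        simp only [m', min_le_iff, or_iff_left (not_le.2 h1)]
      by_cases h3 : m ≤ ‖v' i - V'‖
      · rw [if_pos h3, if_pos (h2.2 h3), one_mul]
      · rw [if_neg h3, if_neg (mt h2.1 h3), zero_mul]
    have h1 := h.abs_drift_le hK hR hL hN1 hε hεP hrel hrelv ⟨n, by omega⟩ I
    simp only at h1
    have h4 : |∑ i, (if m ≤ ‖v' i - V'‖ then partialDeriv Φ I (wrap L (X' - x' i)) else 0)| ≤
        (K + 2) * (Real.sqrt N * (N : ℝ) ^ (δ / 2)) := by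
      rw [Finset.sum_congr rfl fun i _ => hind i]
      refine h1.trans ?_
      have h5 : 1 ≤ Real.sqrt N * (N : ℝ) ^ (δ / 2) :=
        one_le_mul_of_one_le_of_one_le (by linarith) (ha1.trans haN)
      have h6 : Real.sqrt N * a ≤ Real.sqrt N * (N : ℝ) ^ (δ / 2) := by gcongr
      have h7 : Real.sqrt N * K ≤ Real.sqrt N * (N : ℝ) ^ (δ / 2) * K := by
        gcongr
        exact le_mul_of_one_le_right hs0.le (ha1.trans haN)
      linarith
    rw [abs_mul, abs_of_pos (by positivity : 0 < 1 / (N : ℝ))]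
    calc _ ≤ 1 / (N : ℝ) * ((K + 2) * (Real.sqrt N * (N : ℝ) ^ (δ / 2))) := by gcongr
      _ = _ := by
        have e3 : (N : ℝ) = (N : ℝ) ^ ((1 - δ) / 2) * (Real.sqrt N * (N : ℝ) ^ (δ / 2)) := by
          rw [Real.sqrt_eq_rpow, ← Real.rpow_add hN0, ← Real.rpow_add hN0]
          conv_lhs => rw [← Real.rpow_one (N : ℝ)]
          congr 1
          ring
        have h8 : 0 < (N : ℝ) ^ ((1 - δ) / 2) := by positivity
        have h9 : 0 < Real.sqrt N * (N : ℝ) ^ (δ / 2) := by positivity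
        rw [show 1 / (N : ℝ) = 1 / ((N : ℝ) ^ ((1 - δ) / 2) * (Real.sqrt N * (N : ℝ) ^ (δ / 2))) by
          rw [← e3]]
        field_simp

end StaticControls

/-! ### Exponential tests -/

/-- A one-sided control `tag V + ∑ back (X, V) (x_i, v_i) ≤ level` on a configuration. -/
structure Test (d : ℕ) where
  /-- The contribution of the velocity of the tagged particle. -/
  tag : Space d → ℝ
  /-- The contribution of each background particle, given the tagged one. -/
  back : Phase d → Phase d → ℝ
  /-- The level not to be exceeded. -/
  level : ℝ

namespace Test

/-- The configurations that violate the control. -/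
def exceeds (T : Test d) : Set (Config d) :=
  {c | T.level < T.tag c.2.1.2 + ∑ i, T.back c.2.1 (c.2.2 i)}

/-- A control by continuous functions on the torus, violated with equilibrium probability at most
`r` at a fixed time. -/
structure IsRare (N : ℕ) (L : ℝ) (Φ : Space d → ℝ) (r : ℝ) (T : Test d) : Prop where
  continuous_tag : Continuous T.tag
  continuous_back : Continuous (Function.uncurry T.back)
  periodic : ∀ Z z, T.back (wrap L Z.1, Z.2) (wrap L z.1, z.2) = T.back Z z
  mass_le : gcMass N L Φ (fun _ => 1) T.exceeds ≤
    ENNReal.ofReal r * gcMass N L Φ (fun _ => 1) Set.univ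

variable {N : ℕ} {L R K : ℝ} {Φ : Space d → ℝ} {T : Test d}

theorem IsRare.mono {r r' : ℝ} (h : T.IsRare N L Φ r) (hr : r ≤ r') : T.IsRare N L Φ r' :=
  ⟨h.continuous_tag, h.continuous_back, h.periodic, h.mass_le.trans (by gcongr)⟩

theorem isRare_of_exp (hN : 1 ≤ N) (hL : 0 < L) (hK : PotentialBounds R K Φ)
    (htag : Continuous T.tag) (hback : Continuous (Function.uncurry T.back))
    (hper : ∀ Z z, T.back (wrap L Z.1, Z.2) (wrap L z.1, z.2) = T.back Z z) {s : ℝ} (hs : 0 ≤ s)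
    (hψ : ∀ Z, ∫⁻ z, ENNReal.ofReal (Real.exp (T.back Z z)) * backDensity N L Φ Z.1 z
      ∂(phaseMeasure d L) ≤ ENNReal.ofReal s) {H : ℝ} (hH : 0 ≤ H)
    (hh : ∫⁻ V, ENNReal.ofReal (Real.exp (T.tag V)) * ENNReal.ofReal (gaussianDensity V) ≤
      ENNReal.ofReal H) :
    T.IsRare N L Φ (H * Real.exp (-T.level + N * (s - gibbsVolume N L Φ))) :=
  ⟨htag, hback, hper, gcMass_le_exp hN hL hK.smooth.continuous hK.bound htag.measurable
    hback.measurable hs hψ hH hh T.level⟩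

/-- The case of a control that involves the background particles only. -/
theorem isRare_of_back (hN : 1 ≤ N) (hL : 0 < L) (hK : PotentialBounds R K Φ)
    (htag : T.tag = fun _ => 0) (hback : Continuous (Function.uncurry T.back))
    (hper : ∀ Z z, T.back (wrap L Z.1, Z.2) (wrap L z.1, z.2) = T.back Z z) {s : ℝ}
    (hs : 0 ≤ gibbsVolume N L Φ + s)
    (hψ : ∀ Z, ∫⁻ z, ENNReal.ofReal (Real.exp (T.back Z z)) * backDensity N L Φ Z.1 z
      ∂(phaseMeasure d L) ≤ ENNReal.ofReal (gibbsVolume N L Φ + s)) :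
    T.IsRare N L Φ (Real.exp (-T.level + N * s)) := by
  refine (isRare_of_exp hN hL hK (by rw [htag]; fun_prop) hback hper hs hψ zero_le_one ?_).mono ?_
  · simp [htag, lintegral_gaussianDensity]
  · rw [add_sub_cancel_left, one_mul]

/-- The control of the velocity of the tagged particle. -/
def tagged (d N : ℕ) : Test d := ⟨fun V => 1 / 4 * ‖V‖ ^ 2, fun _ _ => 0, (N : ℝ) / 16⟩

theorem isRare_tagged (hN : 1 ≤ N) (hL : 0 < L) (hK : PotentialBounds R K Φ) :
    (tagged d N).IsRare N L Φ (gaussMoment d * Real.exp (-((N : ℝ) / 16))) := by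
  have hκ : 0 ≤ gibbsVolume N L Φ := integral_nonneg fun _ => (Real.exp_pos _).le
  refine (isRare_of_exp hN hL hK (T := tagged d N) (s := gibbsVolume N L Φ) ?_ ?_
    (fun _ _ => rfl) hκ (fun Z => ?_) (gaussMoment_nonneg d)
    (lintegral_exp_sq_gaussianDensity d).le).mono ?_
  · unfold tagged; fun_prop
  · unfold tagged Function.uncurry; fun_prop
  · simp [tagged, lintegral_backDensity hN hL hK.smooth.continuous hK.bound]
  · simp [tagged]

/-- The controls of the number of background particles. -/
def number (d : ℕ) (c a : ℝ) : Test d := ⟨fun _ => 0, fun _ _ => c, a⟩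

theorem isRare_number (hN : 1 ≤ N) (hL : 0 < L) (hK : PotentialBounds R K Φ) (c a : ℝ) :
    (number d c a).IsRare N L Φ (Real.exp (-a + N * ((Real.exp c - 1) * gibbsVolume N L Φ))) := by
  have hκ : 0 ≤ gibbsVolume N L Φ := integral_nonneg fun _ => (Real.exp_pos _).le
  have e : gibbsVolume N L Φ + (Real.exp c - 1) * gibbsVolume N L Φ =
      Real.exp c * gibbsVolume N L Φ := by ring
  refine isRare_of_back hN hL hK (T := number d c a) rfl ?_ (fun _ _ => rfl) ?_ fun Z => ?_
  · unfold number Function.uncurry; fun_prop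
  · rw [e]; positivity
  · rw [e, ENNReal.ofReal_mul (Real.exp_pos _).le]
    simp only [number]
    rw [lintegral_const_mul' _ _ ENNReal.ofReal_ne_top,
      lintegral_backDensity hN hL hK.smooth.continuous hK.bound]

/-- The control of the velocities of the background particles. -/
def fastBack (d N : ℕ) : Test d :=
  ⟨fun _ => 0, fun _ z => max (0 : ℝ) ((‖z.2‖ ^ 2 - N / 8) / 8), N / 64⟩

theorem isRare_fastBack (hN : 1 ≤ N) (hL : 0 < L) (hK : PotentialBounds R K Φ) :
    (fastBack d N).IsRare N L Φ (Real.exp (-((N : ℝ) / 64) +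
      N * (Real.exp K * (2 * L) ^ d * (Real.exp (-((N : ℝ) / 32)) * gaussMoment d)))) := by
  have hκ : 0 ≤ gibbsVolume N L Φ := integral_nonneg fun _ => (Real.exp_pos _).le
  have hG := gaussMoment_nonneg d
  refine isRare_of_back hN hL hK (T := fastBack d N) rfl ?_ (fun _ _ => rfl)
    (by positivity) fun Z => ?_
  · unfold fastBack Function.uncurry; fun_prop
  · refine lintegral_exp_le_of_le hN hL hK.smooth.continuous hK.bound MeasurableSet.univ
      (w := (2 * L) ^ d) (by positivity) (by rw [Set.univ_inter, volume_box d hL])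
      (q := fun v => Real.exp (-((N : ℝ) / 32)) * Real.exp (1 / 4 * ‖v‖ ^ 2)) (by fun_prop)
      (fun v => by positivity) (by positivity) ?_ Z.1 fun z => ?_
    · simp only [ENNReal.ofReal_mul (Real.exp_pos _).le, mul_assoc]
      rw [lintegral_const_mul' _ _ ENNReal.ofReal_ne_top, lintegral_exp_sq_gaussianDensity]
    · simp only [fastBack, Set.indicator_univ, one_mul, ← Real.exp_add]
      rcases max_cases (0 : ℝ) ((‖z.2‖ ^ 2 - N / 8) / 8) with h | h
      · rw [h.1, Real.exp_zero]
        linarith [Real.exp_pos (-((N : ℝ) / 32) + 1 / 4 * ‖z.2‖ ^ 2)]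
      · rw [h.1]
        have : Real.exp ((‖z.2‖ ^ 2 - N / 8) / 8) ≤
            Real.exp (-((N : ℝ) / 32) + 1 / 4 * ‖z.2‖ ^ 2) := Real.exp_le_exp.2 (by linarith [h.2])
        linarith

/-- The controls of sums, over the background particles close to the tagged one, of a function of
the relative velocity. -/
def near (L R : ℝ) (u : Space d → ℝ) (a : ℝ) : Test d :=
  ⟨fun _ => 0, fun Z z => nearCutoff L R (Z.1 - z.1) * u (z.2 - Z.2), a⟩

theorem exp_le_one_add_two_mul {x : ℝ} (h0 : 0 ≤ x) (h1 : x ≤ 1) : Real.exp x ≤ 1 + 2 * x := by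
  have := Real.abs_exp_sub_one_le (x := x) (by rwa [abs_of_nonneg h0])
  rw [abs_of_nonneg h0] at this
  linarith [le_abs_self (Real.exp x - 1)]

theorem isRare_near (hN : 1 ≤ N) (hL : 0 < L) (hK : PotentialBounds R K Φ) {u : Space d → ℝ}
    (hu : Continuous u) (hu0 : ∀ w, 0 ≤ u w) (hu1 : ∀ w, u w ≤ 1) {J : ℝ} (hJ : 0 ≤ J)
    (huJ : ∀ V, ∫⁻ v, ENNReal.ofReal (u (v - V)) * ENNReal.ofReal (gaussianDensity v) ≤
      ENNReal.ofReal J) (a : ℝ) :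
    (near L R u a).IsRare N L Φ (Real.exp (-a + N * (Real.exp K *
      volume.real (Metric.closedBall (0 : Space d) (R + 2)) * (2 * J)))) := by
  have hκ : 0 ≤ gibbsVolume N L Φ := integral_nonneg fun _ => (Real.exp_pos _).le
  refine isRare_of_back hN hL hK (T := near L R u a) rfl ?_ (fun Z z => ?_)
    (by positivity) fun Z => ?_
  · have h1 : Continuous fun y : Space d => nearCutoff L R y := by
      unfold nearCutoff
      have := continuous_norm_wrap (d := d) hL
      exact continuous_clamp.comp (by fun_prop)
    unfold near Function.uncurry
    exact (h1.comp (by fun_prop)).mul (hu.comp (by fun_prop))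
  · simp only [near, nearCutoff, wrap_wrap_sub_wrap hL]
  · refine lintegral_exp_le_of_le hN hL hK.smooth.continuous hK.bound
      (Metric.isClosed_closedBall (x := (0 : Space d)) (ε := R + 2)).measurableSet
      measureReal_nonneg ?_ (q := fun v => 2 * u (v - Z.2)) (by fun_prop)
      (fun v => mul_nonneg zero_le_two (hu0 _)) (by positivity) ?_ Z.1 fun z => ?_
    · rw [ofReal_measureReal measure_closedBall_lt_top.ne]
      exact measure_mono Set.inter_subset_left
    · simp only [ENNReal.ofReal_mul zero_le_two, mul_assoc]
      rw [lintegral_const_mul' _ _ ENNReal.ofReal_ne_top]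
      gcongr
      exact huJ Z.2
    · simp only [near]
      have h0 : 0 ≤ nearCutoff L R (Z.1 - z.1) := clamp_nonneg _
      have h1 : nearCutoff L R (Z.1 - z.1) ≤ 1 := clamp_le_one _
      by_cases hy : wrap L (Z.1 - z.1) ∈ Metric.closedBall (0 : Space d) (R + 2)
      · rw [Set.indicator_of_mem hy, one_mul]
        refine (exp_le_one_add_two_mul (mul_nonneg h0 (hu0 _))
          (mul_le_one₀ h1 (hu0 _) (hu1 _))).trans ?_
        have := mul_le_of_le_one_left (hu0 (z.2 - Z.2)) h1
        linarith
      · rw [Set.indicator_of_notMem hy, zero_mul, add_zero]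
        rw [mem_closedBall_zero_iff, not_le] at hy
        have : nearCutoff L R (Z.1 - z.1) = 0 := clamp_of_nonpos (by linarith)
        rw [this, zero_mul, Real.exp_zero]

/-- The control of the number of interacting particles. -/
theorem isRare_near_one (hN : 1 ≤ N) (hL : 0 < L) (hK : PotentialBounds R K Φ) (a : ℝ) :
    (near L R (fun _ : Space d => 1) a).IsRare N L Φ (Real.exp (-a + N * (Real.exp K *
      volume.real (Metric.closedBall (0 : Space d) (R + 2)) * (2 * 1)))) :=
  isRare_near hN hL hK continuous_const (fun _ => zero_le_one) (fun _ => le_rfl) zero_le_one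
    (fun _ => (lintegral_const_mul_gaussianDensity 1).le) a

theorem isRare_near_cubedTime (hd : 3 ≤ d) (hN : 1 ≤ N) (hL : 0 < L) (hK : PotentialBounds R K Φ)
    {J : ℕ} (hJ : N ≤ 2 ^ J) (a : ℝ) :
    (near L R (fun w : Space d => cubedTime N w / N) a).IsRare N L Φ (Real.exp (-a + Real.exp K *
      volume.real (Metric.closedBall (0 : Space d) (R + 2)) *
        (2 * (1 + (J + 1) * (8 * unitVolume d))))) := by
  have hN0 : (0 : ℝ) < N := by exact_mod_cast hN
  have hU := unitVolume_nonneg d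
  refine (isRare_near hN hL hK ((continuous_cubedTime hN).div_const _)
    (fun w => div_nonneg (cubedTime_nonneg _ _) hN0.le)
    (fun w => (div_le_one hN0).2 (cubedTime_le hN w))
    (J := (1 + (J + 1) * (8 * unitVolume d)) / N) (by positivity) (fun V => ?_) a).mono ?_
  · simp only [div_eq_inv_mul, ENNReal.ofReal_mul (inv_nonneg.2 hN0.le), mul_assoc]
    rw [lintegral_const_mul' _ _ ENNReal.ofReal_ne_top]
    gcongr
    simpa only [mul_assoc] using lintegral_cubedTime_le hd hN hJ V
  · apply le_of_eq
    congr 2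
    field_simp

theorem isRare_near_shellCutoff (hd : d ≠ 0) (hN : 1 ≤ N) (hL : 0 < L)
    (hK : PotentialBounds R K Φ) {m ε P : ℝ} (hm : 0 ≤ m) (hε : 0 < ε) (hP : 1 ≤ P)
    (hmP : m + 3 * ε ≤ P) (a : ℝ) :
    (near L R (fun w : Space d => shellCutoff m ε ‖w‖) a).IsRare N L Φ (Real.exp (-a + N *
      (Real.exp K * volume.real (Metric.closedBall (0 : Space d) (R + 2)) *
        (2 * (d * P ^ d * (2 * (3 * ε)) * unitVolume d))))) := by
  have hU := unitVolume_nonneg d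
  refine isRare_near hN hL hK (u := fun w => shellCutoff m ε ‖w‖) ?_ (fun w => clamp_nonneg _)
    (fun w => clamp_le_one _) (by positivity) (fun V => ?_) a
  · unfold shellCutoff
    exact continuous_clamp.comp (by fun_prop)
  · have hS : MeasurableSet {v : Space d | |‖v - V‖ - m| ≤ 3 * ε} :=
      (isClosed_le (by fun_prop) continuous_const).measurableSet
    refine le_trans (lintegral_mono fun v => ?_)
      ((lintegral_indicator_gaussianDensity_le _ hS).trans
        (volume_shell_le hd V hm (by positivity) hP hmP))
    gcongr
    by_cases hv : v ∈ {v : Space d | |‖v - V‖ - m| ≤ 3 * ε}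
    · rw [Set.indicator_of_mem hv]
      exact ENNReal.ofReal_le_one.2 (clamp_le_one _)
    · rw [Set.indicator_of_notMem hv]
      have h1 : 3 * ε < |‖v - V‖ - m| := not_le.1 hv
      have h2 : shellCutoff m ε ‖v - V‖ = 0 := by
        refine clamp_of_nonpos ?_
        rw [sub_nonpos, le_div_iff₀ hε]
        exact h1.le
      rw [h2, ENNReal.ofReal_zero]

/-- The controls of the derivatives of the force, up to the sign `σ`, with a cutoff `χ` of the
relative velocity. -/
def force (N : ℕ) (L : ℝ) (Φ : Space d → ℝ) {n : ℕ} (I : Fin n → Fin d) (σ : ℝ)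
    (χ : Space d → ℝ) (a : ℝ) : Test d :=
  ⟨fun _ => 0, fun Z z => 1 / Real.sqrt N *
    (σ * partialDeriv Φ I (wrap L (Z.1 - z.1)) * χ (z.2 - Z.2)), a⟩

theorem isRare_force (hN : 1 ≤ N) (hR : 0 ≤ R) (hL : R + 1 ≤ L) (hK : PotentialBounds R K Φ)
    (hKN : K ≤ Real.sqrt N) (n : Fin 4) (I : Fin (n + 1) → Fin d) {σ : ℝ} (hσ : |σ| ≤ 1)
    {χ : Space d → ℝ} (hχ : Continuous χ) (hχ0 : ∀ w, 0 ≤ χ w) (hχ1 : ∀ w, χ w ≤ 1) (a : ℝ) :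
    (force N L Φ I σ χ a).IsRare N L Φ (Real.exp (-a + (2 * K ^ 2 + K ^ 2 * Real.exp K) *
      volume.real (Metric.closedBall (0 : Space d) R))) := by
  have hκ : 0 ≤ gibbsVolume N L Φ := integral_nonneg fun _ => (Real.exp_pos _).le
  have hL0 : 0 < L := by linarith
  have hN1 : (1 : ℝ) ≤ N := by exact_mod_cast hN
  have hs1 : 1 ≤ Real.sqrt N := Real.one_le_sqrt.2 hN1
  have hs0 : 0 < Real.sqrt N := by linarith
  have hsq : Real.sqrt N * Real.sqrt N = N := Real.mul_self_sqrt (by linarith)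
  have hK1 := hK.one_le
  have hb := hK.partialDeriv n I
  have hf : IsLipBump R K fun y => σ * partialDeriv Φ I y := by
    refine ⟨fun x y => ?_, fun x => ?_, fun x hx => ?_⟩
    · rw [← mul_sub, norm_mul]
      exact (mul_le_of_le_one_left (norm_nonneg _) hσ).trans (hb.lip x y)
    · rw [norm_mul]
      exact (mul_le_of_le_one_left (norm_nonneg _) hσ).trans (hb.bound x)
    · rw [hb.supp x hx, mul_zero]
  have hf0 : ∫ y, σ * partialDeriv Φ I y = 0 := by
    rw [integral_const_mul, hK.integral_eq_zero, mul_zero]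
  set ω := volume.real (Metric.closedBall (0 : Space d) R)
  have hω : 0 ≤ ω := measureReal_nonneg
  refine (isRare_of_back hN hL0 hK (T := force N L Φ I σ χ a) rfl ?_ (fun Z z => ?_)
    (s := 1 / Real.sqrt N * (2 * K ^ 2 * ω / N) +
      (1 / Real.sqrt N) ^ 2 * (K ^ 2 * Real.exp K * ω)) (by positivity) fun Z => ?_).mono ?_
  · have h1 := hb.continuous_wrap hR hL
    unfold force Function.uncurry
    have h2 : Continuous fun p : Phase d × Phase d => partialDeriv Φ I (wrap L (p.1.1 - p.2.1)) :=
      h1.comp (by fun_prop : Continuous fun p : Phase d × Phase d => p.1.1 - p.2.1)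
    exact continuous_const.mul ((continuous_const.mul h2).mul (hχ.comp (by fun_prop)))
  · simp only [force, wrap_wrap_sub_wrap hL0]
  · rw [← add_assoc]
    exact lintegral_exp_signed_le hL0 (by linarith) hN hK.smooth.continuous hK.bound
      (hKN.trans (by nlinarith)) hf hf0 (by positivity)
      (by rw [one_div, inv_mul_le_iff₀ hs0, mul_one]; exact hKN)
      (χ := fun v => χ (v - Z.2)) (by fun_prop) (fun v => hχ0 _) (fun v => hχ1 _) Z.1
  · refine Real.exp_le_exp.2 (add_le_add le_rfl ?_)
    have e1 : (N : ℝ) * (1 / Real.sqrt N * (2 * K ^ 2 * ω / N) +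
        (1 / Real.sqrt N) ^ 2 * (K ^ 2 * Real.exp K * ω)) =
        1 / Real.sqrt N * (2 * K ^ 2 * ω) + K ^ 2 * Real.exp K * ω := by
      rw [div_pow, Real.sq_sqrt (by linarith)]
      field_simp
    rw [e1]
    have : 1 / Real.sqrt N * (2 * K ^ 2 * ω) ≤ 2 * K ^ 2 * ω :=
      mul_le_of_le_one_left (by positivity) ((div_le_one hs0).2 hs1)
    linarith

/-- A control satisfied at equilibrium is satisfied at any given time, by the invariance of the
equilibrium measure. -/
theorem IsRare.mass_flow_le {r : ℝ} (h : T.IsRare N L Φ r) (hR : 0 ≤ R) (hL : R + 1 ≤ L)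
    (hK : PotentialBounds R K Φ) (t : ℝ) {A : Set (Config d)}
    (hA : ∀ c ∈ A, ∃ X V x v, IsTrajectory N L Φ c X V x v ∧ configAt X V x v t ∈ T.exceeds) :
    gcMass N L Φ (fun _ => 1) A ≤ ENNReal.ofReal r * gcMass N L Φ (fun _ => 1) Set.univ := by
  refine (gcMass_le_of_flow hR hL (hK.smooth.of_le (by norm_num)) hK.supp hK.grad N
    (fun M => ?_) (fun M z => ?_) t hA).trans h.mass_le
  · have h1 := h.continuous_tag
    have h2 : ∀ i : Fin M, Continuous fun z : State d M => T.back z.1 (z.2 i) := fun i =>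
      h.continuous_back.comp (by fun_prop : Continuous fun z : State d M => (z.1, z.2 i))
    have h3 : Continuous fun z : State d M => T.tag z.1.2 + ∑ i, T.back z.1 (z.2 i) :=
      (h1.comp (by fun_prop : Continuous fun z : State d M => z.1.2)).add
        (continuous_finsetSum _ fun i _ => h2 i)
    exact isOpen_lt continuous_const h3
  · simp only [exceeds, Set.mem_ofPred_eq, wrapState, h.periodic]

end Test

/-! ### From a time grid to all times -/

/-- The tests equivalent to the controls at a fixed time. -/
def controlTests (N : ℕ) (L R : ℝ) (Φ : Space d → ℝ) (δ m ε P C₁ a : ℝ) :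
    Fin 7 ⊕ ((Σ n : Fin 4, Fin (n + 1) → Fin d) × Bool × Bool) → Test d :=
  Sum.elim
    ![Test.tagged d N, Test.number d 1 P, Test.number d (-1) (-(3 / 2)), Test.fastBack d N,
      Test.near L R (fun _ => 1) (C₁ * N), Test.near L R (fun w => cubedTime N w / N) ((N : ℝ) ^ δ),
      Test.near L R (fun w => shellCutoff m ε ‖w‖) (Real.sqrt N)]
    fun q => Test.force N L Φ q.1.2 (if q.2.1 then 1 else -1)
      (if q.2.2 then fun _ => 1 else fun w => rampCutoff m ε ‖w‖) a

theorem staticControls_of_notMem {N : ℕ} {L R : ℝ} {Φ : Space d → ℝ} {δ m ε P C₁ a : ℝ} {M : ℕ}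
    {Z : Phase d} {b : Fin M → Phase d}
    (h : ∀ j, (⟨M, Z, b⟩ : Config d) ∉ (controlTests N L R Φ δ m ε P C₁ a j).exceeds) :
    StaticControls N L R Φ δ m ε P C₁ a Z b := by
  have h' : ∀ j, (controlTests N L R Φ δ m ε P C₁ a j).tag Z.2 +
      ∑ i, (controlTests N L R Φ δ m ε P C₁ a j).back Z (b i) ≤
        (controlTests N L R Φ δ m ε P C₁ a j).level := fun j => not_lt.1 (h j)
  have h0 := h' (Sum.inl 0)
  have h1 := h' (Sum.inl 1)
  have h2 := h' (Sum.inl 2)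
  have h3 := h' (Sum.inl 3)
  have h4 := h' (Sum.inl 4)
  have h5 := h' (Sum.inl 5)
  have h6 := h' (Sum.inl 6)
  simp only [controlTests, Sum.elim_inl, Test.tagged, Test.number, Test.fastBack, Test.near,
    Matrix.cons_val, zero_add, Finset.sum_const_zero, add_zero, mul_one, ← mul_div_assoc]
    at h0 h1 h2 h3 h4 h5 h6
  have hF : ∀ (n : Fin 4) (I : Fin (n + 1) → Fin d) (σ : Bool) (χ : Bool), 0 +
      ∑ i, 1 / Real.sqrt N * ((if σ then 1 else -1) * partialDeriv Φ I (wrap L (Z.1 - (b i).1)) *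
        (if χ then fun _ => 1 else fun w => rampCutoff m ε ‖w‖) ((b i).2 - Z.2)) ≤ a :=
    fun n I σ χ => h' (Sum.inr (⟨n, I⟩, σ, χ))
  refine ⟨h0, h1, h2, h3, h4, h5, h6, fun n I => ?_, fun n I => ?_⟩
  · have hp := hF n I true true
    have hm := hF n I false true
    simp only [if_true, zero_add, ← Finset.mul_sum, one_mul, mul_one, Bool.false_eq_true, if_false,
      neg_mul, Finset.sum_neg_distrib, mul_neg] at hp hm
    exact abs_le.2 ⟨by linarith, hp⟩
  · have hp := hF n I true false
    have hm := hF n I false false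
    simp only [if_true, zero_add, ← Finset.mul_sum, one_mul, Bool.false_eq_true, if_false,
      neg_mul, Finset.sum_neg_distrib, mul_neg] at hp hm
    exact abs_le.2 ⟨by linarith, hp⟩

/-- Controls at one time of a trajectory extend to all close enough times, as the forces and the
velocities are bounded by powers of `N`. -/
theorem StaticControls.controls_trajectory {N : ℕ} {L R K : ℝ} {Φ : Space d → ℝ}
    {δ m ε P C₁ a : ℝ} {c : Config d} {X V : ℝ → Space d} {x v : Fin c.1 → ℝ → Space d}
    (hT : IsTrajectory N L Φ c X V x v) {s t τ : ℝ}
    (h : StaticControls N L R Φ δ (min m (2 * Real.sqrt N)) ε P C₁ a (X s, V s)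
      fun i => (x i s, v i s))
    (hK : PotentialBounds R K Φ) (hR : 0 ≤ R) (hL : R + 1 ≤ L) (hN : 4 ≤ N) (hδ : 0 ≤ δ)
    (hε : 0 < ε) (hε1 : ε ≤ (N : ℝ) ^ (-(1 / 3) : ℝ)) (hεP : P * (3 * K * ε) ≤ 1)
    (ha1 : 1 ≤ a) (ha : 2 * d ^ 2 * a ≤ (N : ℝ) ^ (δ / 2)) (hd : 1 ≤ d) (hC₁ : 0 ≤ C₁)
    (hτP : P * K * τ ≤ ε / 2) (hτN : Real.sqrt N * τ ≤ ε / 2) (hτ : 0 ≤ τ) (ht : |t - s| ≤ τ) :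
    Controls N L R Φ δ m C₁ (C₁ + 8) (K + 2) (X t) (V t) (fun i => x i t) (fun i => v i t) := by
  have hN' : (4 : ℝ) ≤ N := by exact_mod_cast hN
  have hK0 : 0 ≤ K := zero_le_one.trans hK.one_le
  have hM : (c.1 : ℝ) ≤ P := h.card_le
  have hM1 : (1 : ℝ) ≤ c.1 := by exact_mod_cast h.one_lt.le
  have hs1 : 1 ≤ Real.sqrt N := Real.one_le_sqrt.2 (by linarith)
  have hε2 : ε ≤ 1 := hε1.trans (Real.rpow_le_one_of_one_le_of_nonpos (by linarith) (by norm_num))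
  have hN2 : 1 / (N : ℝ) ≤ 1 := by rw [div_le_one (by linarith)]; linarith
  have hforce : ∀ (F : ℝ → Space d) (F' : ℝ → Space d), (∀ r, HasDerivAt F (F' r) r) →
      (∀ r, ‖F' r‖ ≤ P * K) → ∀ r, |r - s| ≤ τ → ‖F r - F s‖ ≤ ε / 2 := by
    intro F F' hF hF' r hr
    have h1 := convex_univ.norm_image_sub_le_of_norm_hasDerivWithin_le
      (fun r _ => (hF r).hasDerivWithinAt) (fun r _ => hF' r) (Set.mem_univ s) (Set.mem_univ r)
    refine h1.trans (le_trans ?_ hτP)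
    rw [Real.norm_eq_abs]
    gcongr
    exact mul_nonneg (by linarith) hK0
  have hpos : ∀ (F G : ℝ → Space d), (∀ r, HasDerivAt F (G r) r) → ‖G s‖ ≤ Real.sqrt N / 2 →
      (∀ r, |r - s| ≤ τ → ‖G r - G s‖ ≤ ε / 2) → ‖F t - F s‖ ≤ ε / 2 := by
    intro F G hF hG hGs
    have h1 := (convex_Icc (s - τ) (s + τ)).norm_image_sub_le_of_norm_hasDerivWithin_le
      (C := Real.sqrt N) (fun r _ => (hF r).hasDerivWithinAt) (fun r hr => ?_)
      (show s ∈ Set.Icc (s - τ) (s + τ) from ⟨by linarith, by linarith⟩)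
      (show t ∈ Set.Icc (s - τ) (s + τ) from ⟨by linarith [(abs_le.1 ht).1],
        by linarith [(abs_le.1 ht).2]⟩)
    · refine h1.trans (le_trans ?_ hτN)
      rw [Real.norm_eq_abs]
      gcongr
    · have h2 := hGs r (abs_le.2 ⟨by linarith [hr.1], by linarith [hr.2]⟩)
      have h3 := norm_le_norm_add_norm_sub' (G r) (G s)
      linarith
  have hg : ∀ y, ‖gradient Φ y‖ ≤ K := hK.grad.bound
  have hV := hforce V _ hT.tagged_vel fun r => by
    rw [norm_neg, norm_smul, Real.norm_of_nonneg (by positivity)]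
    refine (mul_le_of_le_one_left (norm_nonneg _) hN2).trans ?_
    refine (norm_sum_le_of_le _ fun i _ => hg _).trans ?_
    simp only [Finset.sum_const, Finset.card_univ, Fintype.card_fin, nsmul_eq_mul]
    gcongr
  have hv : ∀ i, ∀ r, |r - s| ≤ τ → ‖v i r - v i s‖ ≤ ε / 2 := fun i =>
    hforce (v i) _ (hT.back_vel i) fun r => by
      rw [norm_smul, Real.norm_of_nonneg (by positivity)]
      refine (mul_le_of_le_one_left (norm_nonneg _) hN2).trans ((hg _).trans ?_)
      exact le_mul_of_one_le_left hK0 (hM1.trans hM)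
  exact h.controls hK hR hL hN hδ hε hε1 hεP ha1 ha hd hC₁
    (hpos X V hT.tagged_pos h.norm_tagged_le hV) (hV t ht)
    (fun i => hpos (x i) (v i) (hT.back_pos i) (h.norm_back_le i) (hv i)) (fun i => hv i t ht)

/-- The union bound over a time grid of step `τ` and over the tests. -/
theorem gcMass_compl_goodSet_le {N : ℕ} {L R K : ℝ} {Φ : Space d → ℝ} {δ m ε P C₁ a τ r : ℝ}
    (hK : PotentialBounds R K Φ) (hR : 0 ≤ R) (hL : R + 1 ≤ L) (hN : 4 ≤ N) (hδ : 0 ≤ δ)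
    (hε : 0 < ε) (hε1 : ε ≤ (N : ℝ) ^ (-(1 / 3) : ℝ)) (hεP : P * (3 * K * ε) ≤ 1)
    (ha1 : 1 ≤ a) (ha : 2 * d ^ 2 * a ≤ (N : ℝ) ^ (δ / 2)) (hd : 1 ≤ d) (hC₁ : 0 ≤ C₁)
    (hτP : P * K * τ ≤ ε / 2) (hτN : Real.sqrt N * τ ≤ ε / 2) (hτ : 0 < τ) {n : ℕ}
    (hn : 4 * N ≤ n * τ)
    (hr : ∀ j, (controlTests N L R Φ δ (min m (2 * Real.sqrt N)) ε P C₁ a j).IsRare N L Φ r) :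
    gcMass N L Φ (fun _ => 1) (goodSet N L R Φ δ m C₁ (C₁ + 8) (K + 2))ᶜ ≤
      ENNReal.ofReal ((n + 1) * Fintype.card
        (Fin 7 ⊕ ((Σ n : Fin 4, Fin (n + 1) → Fin d) × Bool × Bool)) * r) *
          gcMass N L Φ (fun _ => 1) Set.univ := by
  let ι := Fin 7 ⊕ ((Σ n : Fin 4, Fin (n + 1) → Fin d) × Bool × Bool)
  let T : ι → Test d := controlTests N L R Φ δ (min m (2 * Real.sqrt N)) ε P C₁ a
  let A : ℕ × ι → Set (Config d) := fun q => {c | ∃ X V x v, IsTrajectory N L Φ c X V x v ∧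
    configAt X V x v (-(2 * N) + q.1 * τ) ∈ (T q.2).exceeds}
  have hsub : (goodSet N L R Φ δ m C₁ (C₁ + 8) (K + 2))ᶜ ⊆
      ⋃ q ∈ Finset.range (n + 1) ×ˢ (Finset.univ : Finset ι), A q := by
    intro c hc
    by_contra hcon
    simp only [Set.mem_iUnion, not_exists, Finset.mem_product, Finset.mem_range, Finset.mem_univ,
      and_true] at hcon
    obtain ⟨X, V, x, v, hT⟩ := exists_isTrajectory hR hL hK.grad N c
    have hstat : ∀ k : ℕ, k < n + 1 → StaticControls N L R Φ δ (min m (2 * Real.sqrt N)) ε P C₁ a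
        (X (-(2 * N) + k * τ), V (-(2 * N) + k * τ))
        fun i => (x i (-(2 * N) + k * τ), v i (-(2 * N) + k * τ)) := fun k hk =>
      staticControls_of_notMem fun j hj => hcon (k, j) hk ⟨X, V, x, v, hT, hj⟩
    refine hc ⟨(hstat 0 (by omega)).one_lt, X, V, x, v, hT, fun t ht => ?_⟩
    have h0 : 0 ≤ (t + 2 * N) / τ := div_nonneg (by linarith [ht.1]) hτ.le
    have h1 := Nat.floor_le h0
    have h2 := Nat.lt_floor_add_one ((t + 2 * N) / τ)
    rw [le_div_iff₀ hτ] at h1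
    rw [div_lt_iff₀ hτ] at h2
    have h3 : ⌊(t + 2 * N) / τ⌋₊ < n + 1 := by
      refine Nat.lt_succ_of_le (Nat.floor_le_of_le ?_)
      rw [div_le_iff₀ hτ]
      linarith [ht.2]
    refine (hstat _ h3).controls_trajectory hT hK hR hL hN hδ hε hε1 hεP ha1 ha hd hC₁ hτP hτN hτ.le
      (abs_le.2 ⟨?_, ?_⟩)
    · linarith
    · linarith
  refine (measure_mono hsub).trans ((measure_biUnion_finset_le _ _).trans ?_)
  have hA : ∀ q : ℕ × ι, gcMass N L Φ (fun _ => 1) (A q) ≤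
      ENNReal.ofReal r * gcMass N L Φ (fun _ => 1) Set.univ := fun q =>
    (hr q.2).mass_flow_le hR hL hK (-(2 * N) + q.1 * τ) fun c hc => hc
  refine (Finset.sum_le_card_nsmul _ _ _ fun q _ => hA q).trans (le_of_eq ?_)
  rw [Finset.card_product, Finset.card_range, Finset.card_univ, nsmul_eq_mul, ← mul_assoc,
    ENNReal.ofReal_mul (by positivity)]
  congr 2
  rw [← Nat.cast_succ, ← Nat.cast_mul, ENNReal.ofReal_natCast]

/-! ### Asymptotics -/

open Filter

theorem tendsto_natCast_rpow {α : ℝ} (hα : 0 < α) :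
    Tendsto (fun N : ℕ => (N : ℝ) ^ α) atTop atTop :=
  (tendsto_rpow_atTop hα).comp tendsto_natCast_atTop_atTop

/-- A quadratic function of `N ^ α` dominates all affine functions of `N ^ α`. -/
theorem eventually_le_mul_sq {α : ℝ} (hα : 0 < α) {c : ℝ} (hc : 0 < c) (b : ℝ) :
    ∀ᶠ N : ℕ in atTop, b * (1 + (N : ℝ) ^ α) + 2 * (N : ℝ) ^ α ≤ c * ((N : ℝ) ^ α) ^ 2 := by
  filter_upwards [(tendsto_natCast_rpow hα).eventually_ge_atTop 1,
    (tendsto_natCast_rpow hα).eventually_ge_atTop ((2 * |b| + 2) / c)] with N h1 h2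
  rw [div_le_iff₀ hc] at h2
  set y := (N : ℝ) ^ α
  have h3 : b * (1 + y) ≤ |b| * (y + y) := by
    refine (mul_le_mul_of_nonneg_right (le_abs_self b) (by linarith)).trans ?_
    exact mul_le_mul_of_nonneg_left (by linarith) (abs_nonneg b)
  have h4 := mul_le_mul_of_nonneg_right h2 (by linarith : 0 ≤ y)
  linarith

theorem eventually_mul_pow_le_exp (c : ℝ) (k : ℕ) {b : ℝ} (hb : 0 < b) :
    ∀ᶠ N : ℕ in atTop, c * (N : ℝ) ^ k ≤ Real.exp (b * N) := by
  have h := ((isLittleO_pow_exp_pos_mul_atTop k hb).const_mul_left c).bound one_pos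
  filter_upwards [tendsto_natCast_atTop_atTop.eventually h] with N hN
  rw [one_mul, Real.norm_of_nonneg (Real.exp_pos _).le] at hN
  exact (le_abs_self _).trans hN

theorem eventually_mul_pow_mul_exp_le (c : ℝ) (k : ℕ) {α : ℝ} (hα : 0 < α) :
    ∀ᶠ N : ℕ in atTop,
      c * (N : ℝ) ^ k * Real.exp (-(2 * (N : ℝ) ^ α)) ≤ Real.exp (-(N : ℝ) ^ α) := by
  have h := ((isLittleO_rpow_exp_atTop (k / α)).const_mul_left c).bound one_pos
  filter_upwards [(tendsto_natCast_rpow hα).eventually h, eventually_ge_atTop 1] with N hN h1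
  have hN0 : (0 : ℝ) ≤ N := Nat.cast_nonneg N
  rw [one_mul, Real.norm_of_nonneg (Real.exp_pos _).le, ← Real.rpow_mul hN0,
    mul_div_cancel₀ _ hα.ne', Real.rpow_natCast] at hN
  calc _ ≤ Real.exp ((N : ℝ) ^ α) * Real.exp (-(2 * (N : ℝ) ^ α)) := by
        gcongr
        exact (le_abs_self _).trans hN
    _ = _ := by rw [← Real.exp_add]; congr 1; ring

theorem gibbsVolume_le {N : ℕ} (hN : 1 ≤ N) {L : ℝ} (hL : 0 < L) {Φ : Space d → ℝ}
    (hΦ : Continuous Φ) {K : ℝ} (hK : ∀ y, ‖Φ y‖ ≤ K) :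
    gibbsVolume N L Φ ≤ Real.exp K * (2 * L) ^ d := by
  have hb : volume.real (box d L) = (2 * L) ^ d := by
    rw [measureReal_def, volume_box d hL, ENNReal.toReal_ofReal (by positivity)]
  have hfin : volume (box d L) ≠ ⊤ := by rw [volume_box d hL]; exact ENNReal.ofReal_ne_top
  have h := setIntegral_mono (s := box d L) (integrableOn_gibbsFactor hN hL hΦ hK)
    (integrableOn_const hfin) (gibbsFactor_le hN hK)
  rw [setIntegral_const, hb, smul_eq_mul, mul_comm] at h
  exact h

theorem le_gibbsVolume {N : ℕ} (hN : 1 ≤ N) {L : ℝ} (hL : 0 < L) {Φ : Space d → ℝ}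
    (hΦ : Continuous Φ) {K : ℝ} (hK : ∀ y, ‖Φ y‖ ≤ K) :
    Real.exp (-K) * (2 * L) ^ d ≤ gibbsVolume N L Φ := by
  have hb : volume.real (box d L) = (2 * L) ^ d := by
    rw [measureReal_def, volume_box d hL, ENNReal.toReal_ofReal (by positivity)]
  have hfin : volume (box d L) ≠ ⊤ := by rw [volume_box d hL]; exact ENNReal.ofReal_ne_top
  have h := setIntegral_mono (s := box d L) (integrableOn_const hfin)
    (integrableOn_gibbsFactor hN hL hΦ hK) (le_gibbsFactor hN hK)
  rw [setIntegral_const, hb, smul_eq_mul, mul_comm] at h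
  exact h

/-- The constant bounding the number of interacting particles. -/
def countConst (d : ℕ) (R K : ℝ) : ℝ :=
  2 * Real.exp K * volume.real (Metric.closedBall (0 : Space d) (R + 2)) + 1

theorem countConst_pos (d : ℕ) (R K : ℝ) : 0 < countConst d R K := by
  unfold countConst
  have : 0 ≤ volume.real (Metric.closedBall (0 : Space d) (R + 2)) := measureReal_nonneg
  positivity

theorem rpow_quarter_sq (N : ℕ) (δ : ℝ) : ((N : ℝ) ^ (δ / 4)) ^ 2 = (N : ℝ) ^ (δ / 2) := by
  rw [← Real.rpow_natCast, ← Real.rpow_mul (Nat.cast_nonneg N)]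
  congr 1
  push_cast
  ring

theorem rpow_quarter_sq_le_sqrt {N : ℕ} (hN : 1 ≤ N) {δ : ℝ} (hδ : δ ≤ 1) :
    ((N : ℝ) ^ (δ / 4)) ^ 2 ≤ Real.sqrt N := by
  rw [rpow_quarter_sq, Real.sqrt_eq_rpow]
  exact Real.rpow_le_rpow_of_exponent_le (by exact_mod_cast hN) (by linarith)

theorem sqrt_natCast_le {N : ℕ} (hN : 1 ≤ N) : Real.sqrt N ≤ N := by
  have hN' : (1 : ℝ) ≤ N := by exact_mod_cast hN
  exact Real.sqrt_le_iff.2 ⟨by linarith, le_self_pow₀ hN' two_ne_zero⟩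

theorem rpow_quarter_sq_le {N : ℕ} (hN : 1 ≤ N) {δ : ℝ} (hδ : δ ≤ 1) :
    ((N : ℝ) ^ (δ / 4)) ^ 2 ≤ N :=
  (rpow_quarter_sq_le_sqrt hN hδ).trans (sqrt_natCast_le hN)

theorem two_mul_rpow_pow_le {N : ℕ} (hN : 1 ≤ N) (η : ℝ) (d : ℕ) :
    (2 * (N : ℝ) ^ η) ^ d ≤ 2 ^ d * (N : ℝ) ^ (⌈η⌉₊ * d) := by
  have hN' : (1 : ℝ) ≤ N := by exact_mod_cast hN
  rw [mul_pow, pow_mul]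
  gcongr
  rw [← Real.rpow_natCast]
  exact Real.rpow_le_rpow_of_exponent_le hN' (Nat.le_ceil η)

namespace Test

variable {R K η δ : ℝ} {Φ : Space d → ℝ}

theorem eventually_isRare_tagged (hK : PotentialBounds R K Φ) (hδ : 0 < δ) (hδ1 : δ ≤ 1) :
    ∀ᶠ N : ℕ in atTop, (tagged d N).IsRare N ((N : ℝ) ^ η) Φ
      (Real.exp (-(2 * (N : ℝ) ^ (δ / 4)))) := by
  have hα : 0 < δ / 4 := by linarith
  have hG := gaussMoment_nonneg d
  filter_upwards [eventually_ge_atTop 1,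
    eventually_le_mul_sq hα (by norm_num : (0 : ℝ) < 1 / 16) (gaussMoment d)] with N hN h1
  have hN0 : (0 : ℝ) < N := by exact_mod_cast hN
  have hy := rpow_quarter_sq_le hN hδ1
  refine (isRare_tagged hN (by positivity) hK).mono ?_
  calc gaussMoment d * Real.exp (-((N : ℝ) / 16)) ≤
        Real.exp (gaussMoment d) * Real.exp (-((N : ℝ) / 16)) := by
        gcongr
        linarith [Real.add_one_le_exp (gaussMoment d)]
    _ ≤ _ := by
      rw [← Real.exp_add]
      refine Real.exp_le_exp.2 ?_
      have : 0 ≤ gaussMoment d * (N : ℝ) ^ (δ / 4) := by positivity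
      linarith

theorem eventually_isRare_few (hK : PotentialBounds R K Φ) (hδ : 0 < δ) (hδ1 : δ ≤ 1) :
    ∀ᶠ N : ℕ in atTop, (number d 1 ((N : ℝ) ^ (⌈η⌉₊ * d + 3))).IsRare N ((N : ℝ) ^ η) Φ
      (Real.exp (-(2 * (N : ℝ) ^ (δ / 4)))) := by
  have hα : 0 < δ / 4 := by linarith
  filter_upwards [eventually_ge_atTop 1, (tendsto_natCast_rpow hα).eventually_ge_atTop 2,
    tendsto_natCast_atTop_atTop.eventually_ge_atTop (2 * Real.exp K * 2 ^ d + 1)] with N hN hy2 hNc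
  have hN1 : (1 : ℝ) ≤ N := by exact_mod_cast hN
  have hN0 : (0 : ℝ) < N := by linarith
  have hy := rpow_quarter_sq_le hN hδ1
  have hvol := two_mul_rpow_pow_le hN η d
  have hκ1 := gibbsVolume_le hN (L := (N : ℝ) ^ η) (by positivity) hK.smooth.continuous hK.bound
  have hκ0 : 0 ≤ gibbsVolume N ((N : ℝ) ^ η) Φ := integral_nonneg fun _ => (Real.exp_pos _).le
  refine (isRare_number hN (by positivity) hK _ _).mono (Real.exp_le_exp.2 ?_)
  set k := ⌈η⌉₊ * d
  have h1 : (N : ℝ) * ((Real.exp 1 - 1) * gibbsVolume N ((N : ℝ) ^ η) Φ) ≤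
      N ^ (k + 1) * (2 * Real.exp K * 2 ^ d) := by
    calc _ ≤ (N : ℝ) * (2 * (Real.exp K * (2 ^ d * (N : ℝ) ^ k))) := by
          gcongr
          · linarith [Real.exp_one_lt_d9]
          · exact hκ1.trans (by gcongr)
      _ = _ := by ring
  -- The threshold exceeds the mean number of particles by a factor of order `N ^ 2`.
  have h2 : (N : ℝ) ^ (k + 3) = N ^ (k + 1) * N ^ 2 := by ring
  have h3 : (N : ℝ) ≤ N ^ (k + 1) := le_self_pow₀ hN1 (by omega)
  have h4 : (N : ℝ) ^ (k + 1) * (2 * Real.exp K * 2 ^ d + 1) ≤ N ^ (k + 1) * N ^ 2 := by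
    gcongr
    exact hNc.trans (le_self_pow₀ hN1 two_ne_zero)
  have h5 : 2 * (N : ℝ) ^ (δ / 4) ≤ ((N : ℝ) ^ (δ / 4)) ^ 2 := by
    rw [sq]
    gcongr
  linarith

theorem eventually_isRare_many (hK : PotentialBounds R K Φ) (hη : 0 ≤ η) (hδ : 0 < δ)
    (hδ1 : δ ≤ 1) :
    ∀ᶠ N : ℕ in atTop, (number d (-1) (-(3 / 2))).IsRare N ((N : ℝ) ^ η) Φ
      (Real.exp (-(2 * (N : ℝ) ^ (δ / 4)))) := by
  have hα : 0 < δ / 4 := by linarith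
  filter_upwards [eventually_ge_atTop 1, (tendsto_natCast_rpow hα).eventually_ge_atTop 0,
    eventually_le_mul_sq hα (by positivity : (0 : ℝ) < Real.exp (-K) / 2) (3 / 2)]
    with N hN hy0 hc
  have hN1 : (1 : ℝ) ≤ N := by exact_mod_cast hN
  have hN0 : (0 : ℝ) < N := by linarith
  have hy := rpow_quarter_sq_le hN hδ1
  have hL : (1 : ℝ) ≤ (N : ℝ) ^ η := Real.one_le_rpow hN1 hη
  have hκ := le_gibbsVolume hN (L := (N : ℝ) ^ η) (by positivity) hK.smooth.continuous hK.bound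
  refine (isRare_number hN (by positivity) hK _ _).mono (Real.exp_le_exp.2 ?_)
  have h1 : Real.exp (-K) ≤ gibbsVolume N ((N : ℝ) ^ η) Φ :=
    le_trans (le_mul_of_one_le_right (Real.exp_pos _).le (one_le_pow₀ (by linarith))) hκ
  have h2 : Real.exp (-1) ≤ 2⁻¹ := by
    rw [Real.exp_neg]
    gcongr
    linarith [Real.add_one_le_exp (1 : ℝ)]
  have h3 : (Real.exp (-1) - 1) * gibbsVolume N ((N : ℝ) ^ η) Φ ≤ -(Real.exp (-K) / 2) := by
    have h4 : (Real.exp (-1) - 1) * gibbsVolume N ((N : ℝ) ^ η) Φ ≤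
        -(1 / 2) * gibbsVolume N ((N : ℝ) ^ η) Φ :=
      mul_le_mul_of_nonneg_right (by linarith) ((Real.exp_pos _).le.trans h1)
    linarith
  have h5 := mul_le_mul_of_nonneg_left h3 hN0.le
  have h6 := mul_le_mul_of_nonneg_left hy (by positivity : 0 ≤ Real.exp (-K) / 2)
  linarith

theorem eventually_isRare_fastBack (hK : PotentialBounds R K Φ) (hδ : 0 < δ) (hδ1 : δ ≤ 1) :
    ∀ᶠ N : ℕ in atTop, (fastBack d N).IsRare N ((N : ℝ) ^ η) Φ
      (Real.exp (-(2 * (N : ℝ) ^ (δ / 4)))) := by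
  have hα : 0 < δ / 4 := by linarith
  have hG := gaussMoment_nonneg d
  filter_upwards [eventually_ge_atTop 1, (tendsto_natCast_rpow hα).eventually_ge_atTop 0,
    eventually_le_mul_sq hα (by norm_num : (0 : ℝ) < 1 / 64) 1,
    eventually_mul_pow_le_exp (Real.exp K * 2 ^ d * gaussMoment d) (⌈η⌉₊ * d + 1)
      (by norm_num : (0 : ℝ) < 1 / 32)] with N hN hy0 hc1 hc2
  have hN0 : (0 : ℝ) < N := by exact_mod_cast hN
  have hy := rpow_quarter_sq_le hN hδ1
  have hvol := two_mul_rpow_pow_le hN η d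
  refine (isRare_fastBack hN (by positivity) hK).mono (Real.exp_le_exp.2 ?_)
  have h1 : (N : ℝ) * (Real.exp K * (2 * (N : ℝ) ^ η) ^ d *
      (Real.exp (-((N : ℝ) / 32)) * gaussMoment d)) ≤ 1 := by
    calc _ ≤ (N : ℝ) * (Real.exp K * (2 ^ d * (N : ℝ) ^ (⌈η⌉₊ * d)) *
          (Real.exp (-((N : ℝ) / 32)) * gaussMoment d)) := by gcongr
      _ = Real.exp K * 2 ^ d * gaussMoment d * (N : ℝ) ^ (⌈η⌉₊ * d + 1) *
          Real.exp (-((N : ℝ) / 32)) := by ring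
      _ ≤ Real.exp (1 / 32 * N) * Real.exp (-((N : ℝ) / 32)) := by gcongr
      _ = 1 := by
        rw [← Real.exp_add, show 1 / 32 * (N : ℝ) + -((N : ℝ) / 32) = 0 by ring, Real.exp_zero]
  linarith

theorem eventually_isRare_near_one (hK : PotentialBounds R K Φ) (hδ : 0 < δ) (hδ1 : δ ≤ 1) :
    ∀ᶠ N : ℕ in atTop, (near ((N : ℝ) ^ η) R (fun _ : Space d => 1) (countConst d R K * N)).IsRare
      N ((N : ℝ) ^ η) Φ (Real.exp (-(2 * (N : ℝ) ^ (δ / 4)))) := by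
  have hα : 0 < δ / 4 := by linarith
  filter_upwards [eventually_ge_atTop 1, (tendsto_natCast_rpow hα).eventually_ge_atTop 2]
    with N hN hy2
  have hN0 : (0 : ℝ) < N := by exact_mod_cast hN
  have hy := rpow_quarter_sq_le hN hδ1
  refine (isRare_near_one hN (by positivity) hK _).mono (Real.exp_le_exp.2 ?_)
  have h1 : 2 * (N : ℝ) ^ (δ / 4) ≤ ((N : ℝ) ^ (δ / 4)) ^ 2 := by
    rw [sq]
    gcongr
  unfold countConst
  linarith

theorem eventually_isRare_near_cubedTime (hd : 3 ≤ d) (hK : PotentialBounds R K Φ) (hδ : 0 < δ) :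
    ∀ᶠ N : ℕ in atTop, (near ((N : ℝ) ^ η) R (fun w : Space d => cubedTime N w / N)
      ((N : ℝ) ^ δ)).IsRare N ((N : ℝ) ^ η) Φ (Real.exp (-(2 * (N : ℝ) ^ (δ / 4)))) := by
  have hα : 0 < δ / 4 := by linarith
  have hU := unitVolume_nonneg d
  have hω : 0 ≤ volume.real (Metric.closedBall (0 : Space d) (R + 2)) := measureReal_nonneg
  set U := unitVolume d
  set ω := volume.real (Metric.closedBall (0 : Space d) (R + 2))
  filter_upwards [eventually_ge_atTop 1, (tendsto_natCast_rpow hα).eventually_ge_atTop 0,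
    eventually_le_mul_sq hα one_pos (Real.exp K * ω * (2 * (1 + (3 + 8 / δ) * (8 * U))))]
    with N hN hy0 hc
  have hN1 : (1 : ℝ) ≤ N := by exact_mod_cast hN
  have hN0 : (0 : ℝ) < N := by linarith
  refine (isRare_near_cubedTime hd hN (by positivity) hK
    (Nat.lt_pow_succ_log_self one_lt_two N).le _).mono (Real.exp_le_exp.2 ?_)
  set y := (N : ℝ) ^ (δ / 4) with hydef
  have hy4 : y ^ 2 ≤ (N : ℝ) ^ δ := by
    rw [hydef, rpow_quarter_sq]
    exact Real.rpow_le_rpow_of_exponent_le hN1 (by linarith)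
  have h1 : (Nat.log 2 N : ℝ) ≤ 8 / δ * y := by
    have h3 : Real.log N ≤ y / (δ / 4) := Real.log_le_rpow_div hN0.le hα
    have h4 : 1 / 2 ≤ Real.log 2 := by linarith [Real.log_two_gt_d9]
    refine (Real.natLog_le_logb N 2).trans ?_
    rw [Real.logb, Nat.cast_ofNat, div_le_iff₀ (by linarith)]
    calc Real.log N ≤ y / (δ / 4) := h3
      _ = 8 / δ * y * (1 / 2) := by ring
      _ ≤ _ := by gcongr
  have h6 : (((Nat.log 2 N).succ : ℕ) : ℝ) + 1 ≤ (3 + 8 / δ) * (1 + y) := by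
    push_cast
    have : 0 < 8 / δ := by positivity
    linarith
  have h5 : Real.exp K * ω * (2 * (1 + ((((Nat.log 2 N).succ : ℕ) : ℝ) + 1) * (8 * U))) ≤
      Real.exp K * ω * (2 * (1 + (3 + 8 / δ) * (8 * U))) * (1 + y) := by
    calc _ ≤ Real.exp K * ω * (2 * ((1 + y) + (3 + 8 / δ) * (1 + y) * (8 * U))) := by
          gcongr
          linarith
      _ = _ := by ring
  linarith

theorem eventually_isRare_near_shellCutoff (hd : 3 ≤ d) (hK : PotentialBounds R K Φ) (hδ : 0 < δ)
    (hδ1 : δ ≤ 1) {q : ℕ} (hq : d + 1 ≤ q) :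
    ∀ᶠ N : ℕ in atTop, ∀ m, 0 ≤ m → m ≤ 2 * Real.sqrt N →
      (near ((N : ℝ) ^ η) R (fun w : Space d => shellCutoff m ((N : ℝ) ^ q)⁻¹ ‖w‖)
        (Real.sqrt N)).IsRare N ((N : ℝ) ^ η) Φ (Real.exp (-(2 * (N : ℝ) ^ (δ / 4)))) := by
  have hα : 0 < δ / 4 := by linarith
  have hU := unitVolume_nonneg d
  have hω : 0 ≤ volume.real (Metric.closedBall (0 : Space d) (R + 2)) := measureReal_nonneg
  set U := unitVolume d
  set ω := volume.real (Metric.closedBall (0 : Space d) (R + 2))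
  set C := Real.exp K * ω * (2 * (d * 4 ^ d * (2 * 3) * U)) with hC
  have hC0 : 0 ≤ C := by positivity
  filter_upwards [eventually_ge_atTop 2, (tendsto_natCast_rpow hα).eventually_ge_atTop 0,
    eventually_le_mul_sq hα one_pos C] with N hN hy0 hc m hm0 hm
  have hN2 : (2 : ℝ) ≤ N := by exact_mod_cast hN
  have hN0 : (0 : ℝ) < N := by linarith
  have hy := rpow_quarter_sq_le_sqrt (by omega : 1 ≤ N) hδ1
  have hs := sqrt_natCast_le (by omega : 1 ≤ N)
  have hε1 : ((N : ℝ) ^ q)⁻¹ ≤ 1 / 2 := by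
    rw [one_div]
    gcongr
    exact hN2.trans (le_self_pow₀ (by linarith) (by omega))
  refine (isRare_near_shellCutoff (by omega) (by omega) (by positivity) hK hm0
    (by positivity : 0 < ((N : ℝ) ^ q)⁻¹) (P := 4 * N) (by linarith) (by linarith) _).mono
    (Real.exp_le_exp.2 ?_)
  -- As `q ≥ d + 1`, the mean number of close particles with velocities in the shell is bounded.
  have h1 : (N : ℝ) * (Real.exp K * ω * (2 * (d * (4 * N) ^ d *
      (2 * (3 * ((N : ℝ) ^ q)⁻¹)) * U))) ≤ C := by
    calc _ = C * ((N : ℝ) ^ (d + 1) * ((N : ℝ) ^ q)⁻¹) := by rw [hC, mul_pow]; ring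
      _ ≤ C * 1 := by
        gcongr
        rw [← div_eq_mul_inv, div_le_one (by positivity)]
        exact pow_le_pow_right₀ (by linarith) hq
      _ = C := mul_one _
  have h2 := mul_nonneg hC0 hy0
  linarith

theorem eventually_isRare_force (hd : 3 ≤ d) (hR : 0 ≤ R) (hK : PotentialBounds R K Φ)
    (hη : 1 ≤ η) (hδ : 0 < δ) :
    ∀ᶠ N : ℕ in atTop, ∀ (n : Fin 4) (I : Fin (n + 1) → Fin d) (σ : ℝ), |σ| ≤ 1 →
      ∀ χ : Space d → ℝ, Continuous χ → (∀ w, 0 ≤ χ w) → (∀ w, χ w ≤ 1) →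
        (force N ((N : ℝ) ^ η) Φ I σ χ ((N : ℝ) ^ (δ / 2) / (2 * d ^ 2))).IsRare N ((N : ℝ) ^ η) Φ
          (Real.exp (-(2 * (N : ℝ) ^ (δ / 4)))) := by
  have hα : 0 < δ / 4 := by linarith
  have hd0 : (0 : ℝ) < d := by exact_mod_cast (by omega : 0 < d)
  have hω : 0 ≤ volume.real (Metric.closedBall (0 : Space d) R) := measureReal_nonneg
  set ω := volume.real (Metric.closedBall (0 : Space d) R)
  filter_upwards [eventually_ge_atTop 1, (tendsto_natCast_rpow hα).eventually_ge_atTop 0,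
    tendsto_natCast_atTop_atTop.eventually_ge_atTop (R + 1),
    tendsto_natCast_atTop_atTop.eventually_ge_atTop (K ^ 2),
    eventually_le_mul_sq hα (by positivity : (0 : ℝ) < 1 / (2 * d ^ 2))
      ((2 * K ^ 2 + K ^ 2 * Real.exp K) * ω)] with N hN hy0 hNR hNK hc n I σ hσ χ hχ hχ0 hχ1
  have hN1 : (1 : ℝ) ≤ N := by exact_mod_cast hN
  have hL : R + 1 ≤ (N : ℝ) ^ η := by
    refine hNR.trans ?_
    conv_lhs => rw [← Real.rpow_one (N : ℝ)]
    exact Real.rpow_le_rpow_of_exponent_le hN1 hη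
  refine (isRare_force hN hR hL hK (Real.le_sqrt_of_sq_le hNK) n I hσ hχ hχ0 hχ1 _).mono
    (Real.exp_le_exp.2 ?_)
  have h2 : 0 ≤ (2 * K ^ 2 + K ^ 2 * Real.exp K) * ω * (N : ℝ) ^ (δ / 4) := by positivity
  have h3 : (N : ℝ) ^ (δ / 2) / (2 * (d : ℝ) ^ 2) =
      1 / (2 * d ^ 2) * ((N : ℝ) ^ (δ / 4)) ^ 2 := by rw [rpow_quarter_sq]; ring
  rw [h3]
  linarith

end Test

/-- All tests are violated with stretched exponentially small probability, uniformly in the cutoff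
`m` of the relative velocities. -/
theorem eventually_isRare_controlTests (hd : 3 ≤ d) {R K : ℝ} (hR : 0 ≤ R) {Φ : Space d → ℝ}
    (hK : PotentialBounds R K Φ) {η δ : ℝ} (hη : 1 ≤ η) (hδ : 0 < δ) (hδ1 : δ ≤ 1) {q : ℕ}
    (hq : d + 1 ≤ q) :
    ∀ᶠ N : ℕ in atTop, ∀ m, 0 ≤ m → m ≤ 2 * Real.sqrt N → ∀ j,
      (controlTests N ((N : ℝ) ^ η) R Φ δ m ((N : ℝ) ^ q)⁻¹ ((N : ℝ) ^ (⌈η⌉₊ * d + 3))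
        (countConst d R K) ((N : ℝ) ^ (δ / 2) / (2 * d ^ 2)) j).IsRare N ((N : ℝ) ^ η) Φ
          (Real.exp (-(2 * (N : ℝ) ^ (δ / 4)))) := by
  filter_upwards [Test.eventually_isRare_tagged (η := η) hK hδ hδ1,
    Test.eventually_isRare_few (η := η) hK hδ hδ1,
    Test.eventually_isRare_many hK (zero_le_one.trans hη) hδ hδ1,
    Test.eventually_isRare_fastBack (η := η) hK hδ hδ1,
    Test.eventually_isRare_near_one (η := η) hK hδ hδ1,
    Test.eventually_isRare_near_cubedTime (η := η) hd hK hδ,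
    Test.eventually_isRare_near_shellCutoff (η := η) hd hK hδ hδ1 hq,
    Test.eventually_isRare_force hd hR hK hη hδ]
    with N h0 h1 h2 h3 h4 h5 h6 hF m hm0 hm j
  rcases j with j | ⟨⟨n, I⟩, σ, χ⟩
  · fin_cases j
    exacts [h0, h1, h2, h3, h4, h5, h6 m hm0 hm]
  · refine hF n I (if σ then 1 else -1) ?_ _ ?_ ?_ ?_
    · split_ifs <;> simp
    · split_ifs
      · exact continuous_const
      · unfold rampCutoff
        exact continuous_clamp.comp (by fun_prop)
    · intro w
      split_ifs
      · exact zero_le_one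
      · exact clamp_nonneg _
    · intro w
      split_ifs
      · exact le_rfl
      · exact clamp_le_one _

/-! ### Probability of the complement of the good set -/

theorem eventually_gcMass_compl_goodSet_le (hd : 3 ≤ d) {R K : ℝ} (hR : 0 ≤ R) {Φ : Space d → ℝ}
    (hK : PotentialBounds R K Φ) {η δ : ℝ} (hη : 1 ≤ η) (hδ : 0 < δ) (hδ1 : δ ≤ 1) :
    ∀ᶠ N : ℕ in Filter.atTop, ∀ m, 0 ≤ m → gcMass N ((N : ℝ) ^ η) Φ (fun _ => 1)
      (goodSet N ((N : ℝ) ^ η) R Φ δ m (countConst d R K) (countConst d R K + 8) (K + 2))ᶜ ≤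
        ENNReal.ofReal (Real.exp (-(N : ℝ) ^ (δ / 4))) *
          gcMass N ((N : ℝ) ^ η) Φ (fun _ => 1) Set.univ := by
  have hd0 : (0 : ℝ) < d := by exact_mod_cast (by omega : 0 < d)
  have hK1 := hK.one_le
  -- There are at most `N ^ p` particles, tests are compared at distance `N ^ (-q)`, small against the
  -- inverse of their number, and the time step `N ^ (-A)` keeps displacements below that distance.
  obtain ⟨p, hp⟩ : ∃ p, p = ⌈η⌉₊ * d + 3 := ⟨_, rfl⟩
  obtain ⟨q, hq⟩ : ∃ q, q = p + d + 1 := ⟨_, rfl⟩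
  obtain ⟨A, hA⟩ : ∃ A, A = p + q + 1 := ⟨_, rfl⟩
  have hev := eventually_isRare_controlTests hd hR hK hη hδ hδ1 (by omega : d + 1 ≤ q)
  rw [← hp] at hev
  set ι := Fin 7 ⊕ ((Σ n : Fin 4, Fin (n + 1) → Fin d) × Bool × Bool)
  filter_upwards [Filter.eventually_ge_atTop 4,
    tendsto_natCast_atTop_atTop.eventually_ge_atTop (R + 1),
    tendsto_natCast_atTop_atTop.eventually_ge_atTop (3 * K),
    (tendsto_natCast_rpow (by linarith : 0 < δ / 2)).eventually_ge_atTop (2 * (d : ℝ) ^ 2),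
    eventually_mul_pow_mul_exp_le (5 * Fintype.card ι) (A + 1) (by linarith : 0 < δ / 4),
    hev] with N hN hNR hNK hNd hNA hrare m hm
  have hN4 : (4 : ℝ) ≤ N := by exact_mod_cast hN
  have hN1 : (1 : ℝ) ≤ N := by linarith
  have hN0 : (0 : ℝ) < N := by linarith
  have hpow : ∀ k : ℕ, 0 < (N : ℝ) ^ k := fun k => by positivity
  have hL : R + 1 ≤ (N : ℝ) ^ η := by
    refine hNR.trans ?_
    conv_lhs => rw [← Real.rpow_one (N : ℝ)]
    exact Real.rpow_le_rpow_of_exponent_le hN1 hη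
  have hε1 : ((N : ℝ) ^ q)⁻¹ ≤ (N : ℝ) ^ (-(1 / 3) : ℝ) := by
    rw [← Real.rpow_natCast, ← Real.rpow_neg hN0.le]
    refine Real.rpow_le_rpow_of_exponent_le hN1 (neg_le_neg ?_)
    have : (1 : ℝ) ≤ q := by exact_mod_cast (by omega : 1 ≤ q)
    linarith
  have hεP : (N : ℝ) ^ p * (3 * K * ((N : ℝ) ^ q)⁻¹) ≤ 1 := by
    rw [← mul_assoc, ← div_eq_mul_inv, div_le_one (hpow q), hq, pow_succ, pow_add, mul_assoc]
    exact mul_le_mul_of_nonneg_left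
      (hNK.trans (le_mul_of_one_le_left hN0.le (one_le_pow₀ hN1))) (hpow p).le
  have hτP : (N : ℝ) ^ p * K * ((N : ℝ) ^ A)⁻¹ ≤ ((N : ℝ) ^ q)⁻¹ / 2 := by
    rw [hA, pow_succ, pow_add, mul_inv, mul_inv]
    calc _ = ((N : ℝ) ^ q)⁻¹ * (K * (N : ℝ)⁻¹) := by
          have := (hpow p).ne'
          field_simp
      _ ≤ ((N : ℝ) ^ q)⁻¹ * (1 / 2) := by
          gcongr
          rw [← div_eq_mul_inv, div_le_iff₀ hN0]
          linarith
      _ = _ := by ring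
  have hτN : Real.sqrt N * ((N : ℝ) ^ A)⁻¹ ≤ ((N : ℝ) ^ q)⁻¹ / 2 := by
    refine le_trans ?_ hτP
    gcongr
    refine (sqrt_natCast_le (by omega)).trans (le_trans (le_self_pow₀ hN1 (by omega : p ≠ 0)) ?_)
    exact le_mul_of_one_le_right (hpow p).le hK1
  have hn : 4 * (N : ℝ) ≤ ((4 * N ^ (A + 1) : ℕ) : ℝ) * ((N : ℝ) ^ A)⁻¹ := by
    push_cast
    rw [pow_succ]
    apply le_of_eq
    have := (hpow A).ne'
    field_simp
  have ha : 2 * (d : ℝ) ^ 2 * ((N : ℝ) ^ (δ / 2) / (2 * d ^ 2)) ≤ (N : ℝ) ^ (δ / 2) := by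
    apply le_of_eq
    field_simp
  refine (gcMass_compl_goodSet_le hK hR hL hN hδ.le (inv_pos.2 (hpow q)) hε1 hεP
    ((one_le_div (by positivity)).2 hNd) ha (by omega) (countConst_pos d R K).le hτP hτN
    (inv_pos.2 (hpow A)) hn (hrare _ (le_min hm (by positivity)) (min_le_right _ _))).trans ?_
  gcongr
  refine le_trans ?_ hNA
  refine mul_le_mul_of_nonneg_right ?_ (Real.exp_pos _).le
  push_cast
  have h1 : (1 : ℝ) ≤ (N : ℝ) ^ (A + 1) := one_le_pow₀ hN1
  have h2 : (0 : ℝ) ≤ Fintype.card ι := Nat.cast_nonneg _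
  calc (4 * (N : ℝ) ^ (A + 1) + 1) * (Fintype.card ι : ℝ) ≤
        (5 * (N : ℝ) ^ (A + 1)) * (Fintype.card ι : ℝ) := by gcongr; linarith
    _ = _ := by ring

end TaggedParticle

end

theorem proposition3p3 (d : ℕ) (hd : 3 ≤ d) (R : ℝ) (hR : 0 < R)
    (Φ : EuclideanSpace ℝ (Fin d) → ℝ) (hΦ : ContDiff ℝ 4 Φ)
    (hΦ_lip : ∃ K : NNReal, LipschitzWith K (iteratedFDeriv ℝ 4 Φ))
    (hΦ_supp : tsupport Φ ⊆ Metric.closedBall 0 R) (hΦ_even : ∀ x, Φ (-x) = Φ x) :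
    ∃ Cint > 0, ∃ Ctime > 0, ∃ Cdrift > 0, ∃ C > 0,
      ∀ η : ℝ, 2 ≤ η → ∀ δ : ℝ, 0 < δ → δ < 1 / 4 →
        ∃ N₀ : ℕ, ∀ N : ℕ, N₀ ≤ N →
          ∀ (m : ℕ → ℝ), (∀ n, 0 ≤ m n) →
          ∀ (g₀ : EuclideanSpace ℝ (Fin d) → ℝ) (K : ℝ), Measurable g₀ →
            (∀ V, 0 ≤ g₀ V ∧ g₀ V ≤ K) →
            ∫ V, g₀ V * TaggedParticle.gaussianDensity V = 1 →
              TaggedParticle.gcMeasure N ((N : ℝ) ^ η) Φ g₀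
                  (TaggedParticle.goodSet N ((N : ℝ) ^ η) R Φ δ (m N) Cint Ctime Cdrift)ᶜ
                ≤ ENNReal.ofReal (C * K * Real.exp (-(N : ℝ) ^ (δ / 4))) := by
  obtain ⟨K₀, hK₀⟩ := TaggedParticle.exists_potentialBounds hΦ hΦ_lip hΦ_supp
  have hC := TaggedParticle.countConst_pos d R K₀
  have hK1 := hK₀.one_le
  refine ⟨TaggedParticle.countConst d R K₀, hC, TaggedParticle.countConst d R K₀ + 8, by linarith,
    K₀ + 2, by linarith, 1, one_pos, fun η hη δ hδ hδ1 => ?_⟩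
  obtain ⟨N₀, hN₀⟩ := Filter.eventually_atTop.1
    (TaggedParticle.eventually_gcMass_compl_goodSet_le hd hR.le hK₀ (by linarith : 1 ≤ η) hδ
      (by linarith : δ ≤ 1))
  refine ⟨max 1 N₀, fun N hN m hm g₀ K hg hg0 hg1 => ?_⟩
  have hN1 : 1 ≤ N := le_of_max_le_left hN
  have hN0 : (0 : ℝ) < N := by exact_mod_cast hN1
  rw [one_mul]
  exact TaggedParticle.gcMeasure_le hN1 (by positivity) hK₀.smooth.continuous hK₀.bound hg hg0 hg1 _
    (hN₀ N (le_of_max_le_right hN) (m N) (hm N))
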